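/- Let $N\ge 3$ be an integer, $\alpha\in(0,N)$, $1<p<\frac{N+\alpha}{N-2}$, $2^*=\frac{2N}{N-2}$, $q=2\,\frac{2p+\alpha}{2+\alpha}$, and let $r\in[q,2^*)$; if $r=q$, assume also $\alpha>1$. All integrals are over $\mathbb{R}^N$ with respect to Lebesgue measure. For $0<\beta<N$ let $I_\beta(x)=A_\beta|x|^{\beta-N}$, $A_\beta=\frac{\Gamma((N-\beta)/2)}{\Gamma(\beta/2)\,\pi^{N/2}\,2^{\beta}}$, be the Riesz potential. Let $E_R$ be the space of radial, measurable, weakly differentiable functions $u:\mathbb{R}^N\to\mathbb{R}$ (identified when equal almost everywhere) with $$\int|\nabla u|^2<\infty\quad\text{and}\quad \int \big|I_{\alpha/2}\star|u|^p\big|^2<\infty .$$ For $u\in E_R$ put $$I(u)=\frac12\int|\nabla u|^2+\frac1{2p}\int\big|I_{\alpha/2}\star|u|^p\big|^2,\qquad F(u)=\frac1r\int|u|^r,\qquad G(u)=\frac1{2^*}\int|u|^{2^*},$$ and, for $c\in\mathbb{R}$ and $u\ne0$, $$\lambda_c(u)=\frac{I(u)-G(u)-c}{F(u)} .$$ Let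 $\sigma=\frac{2+\alpha}{2(p-1)}$ and $s_\ell=\sigma\ell-N$ for $\ell\in\mathbb{R}$. For $t>0$ let $u_t(x)=t^\sigma u(tx)$ and $\varphi_{c,u}(t)=\lambda_c(u_t)$, and define the scaled Nehari manifold $$\mathcal N_c=\{u_t:\ u\in E_R\setminus\{0\},\ t>0,\ \varphi_{c,u}'(t)=0\},\qquad \Lambda_c=\lambda_c|_{\mathcal N_c}.$$ Let $S$ be the biggest constant such that $S\,\|u\|_{2^*}^2\le\|\nabla u\|_2^2$ for all $u\in E_R$, and let $$c^*=\frac12\,\frac{s_{2^*}-s_q}{s_{2^*}}\left(\frac{2^*}{2}\,\frac{s_q}{s_{2^*}}\right)^{\frac{s_q}{s_{2^*}-s_q}}S^{\frac{s_{2^*}}{s_{2^*}-s_q}} .$$ Then $\mathcal N_{c^*}\neq\emptyset$ and $$\inf_{u\in\mathcal N_{c^*}}\Lambda_{c^*}(u)=0$$ in each of the following cases: 1. $\frac{2Np}{N+\alpha}>\frac{N}{N-2}$, $\ N+\alpha-(N-2)(p+1)\ge0$, $\ (N-2)r-4>0$; 2. $\frac{2Np}{N+\alpha}>\frac{N}{N-2}$,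 $\ N+\alpha-(N-2)(p+1)<0$, $\ 2\alpha+(N-2)(r-2p)>0$; 3. $\frac{2Np}{N+\alpha}=\frac{N}{N-2}$, $\ 4+\alpha-N>0$, $\ (N-2)r-4>0$; 4. $\frac{2Np}{N+\alpha}=\frac{N}{N-2}$, $\ 4+\alpha-N\le0$, $\ \alpha-N+(N-2)r>0$; 5. $\frac{2Np}{N+\alpha}<\frac{N}{N-2}$, $\ (N-2)r-4>0$. -/

import Mathlib

open MeasureTheory
open scoped ENNReal ContDiff

noncomputable section

namespace SPS

/-- `ℝ^N` with its Euclidean norm. -/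
abbrev Space (N : ℕ) : Type := EuclideanSpace ℝ (Fin N)

/-- The critical Sobolev exponent `2^* = 2N/(N-2)`. -/
def twoStar (N : ℕ) : ℝ := 2 * (N : ℝ) / ((N : ℝ) - 2)

/-- The exponent `q = 2(2p+α)/(2+α)`. -/
def qExp (α p : ℝ) : ℝ := 2 * ((2 * p + α) / (2 + α))

/-- The exponent `σ = (2+α)/(2(p-1))`. -/
def sigma (α p : ℝ) : ℝ := (2 + α) / (2 * (p - 1))

/-- `s_ℓ = σ ℓ - N`. -/
def sExp (N : ℕ) (α p l : ℝ) : ℝ := sigma α p * l - (N : ℝ)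

/-- The normalizing constant `A_β` of the Riesz potential of order `β`. -/
def rieszConst (N : ℕ) (β : ℝ) : ℝ :=
  Real.Gamma (((N : ℝ) - β) / 2) /
    (Real.Gamma (β / 2) * Real.pi ^ ((N : ℝ) / 2) * (2 : ℝ) ^ β)

/-- The Riesz kernel `I_β(x) = A_β / |x|^(N-β)`. -/
def rieszKernel (N : ℕ) (β : ℝ) (x : Space N) : ℝ :=
  rieszConst N β / ‖x‖ ^ ((N : ℝ) - β)

/-- The convolution `(I_{α/2} ⋆ |u|^p)(x)` of nonnegative functions, as an element of `[0,∞]`. -/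
def rieszConv (N : ℕ) (α p : ℝ) (u : Space N → ℝ) (x : Space N) : ℝ≥0∞ :=
  ∫⁻ y, ENNReal.ofReal (rieszKernel N (α / 2) (x - y) * |u y| ^ p)

/-- The Coulomb integral `∫ |I_{α/2} ⋆ |u|^p|^2`, as an element of `[0,∞]`. -/
def coulomb (N : ℕ) (α p : ℝ) (u : Space N → ℝ) : ℝ≥0∞ :=
  ∫⁻ x, rieszConv N α p u x ^ 2

/-- `g` is a weak gradient of `u` on `ℝ^N`. -/
def HasWeakGradient (N : ℕ) (u : Space N → ℝ) (g : Space N → Space N) : Prop :=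
  LocallyIntegrable u volume ∧ LocallyIntegrable g volume ∧
    ∀ φ : Space N → ℝ, ContDiff ℝ ∞ φ → HasCompactSupport φ →
      ∫ x, u x • gradient φ x = - ∫ x, φ x • g x

open Classical in
/-- The weak gradient of `u` (unique up to null sets), and `0` if `u` has none. -/
def weakGrad (N : ℕ) (u : Space N → ℝ) : Space N → Space N :=
  if h : ∃ g, HasWeakGradient N u g then h.choose else 0

/-- `u` agrees almost everywhere with a function of `|x|`. -/
def IsRadial (N : ℕ) (u : Space N → ℝ) : Prop :=
  ∃ f : ℝ → ℝ, u =ᵐ[volume] fun x => f ‖x‖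

/-- The radial Coulomb-Sobolev space `E_R^{α,p}(ℝ^N)`, as the set of all representatives of
its elements (functions are identified when they agree almost everywhere). -/
def ER (N : ℕ) (α p : ℝ) : Set (Space N → ℝ) :=
  {u | AEStronglyMeasurable u volume ∧ coulomb N α p u < ⊤ ∧
    (∃ g, HasWeakGradient N u g ∧ MemLp g 2 volume) ∧ IsRadial N u}

/-- `E_R^{α,p}(ℝ^N) \ {0}`; here `u = 0` means `u = 0` almost everywhere. -/
def ERNonzero (N : ℕ) (α p : ℝ) : Set (Space N → ℝ) :=
  {u | u ∈ ER N α p ∧ ¬ u =ᵐ[volume] 0}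

/-- `∫ |∇u|^2`. -/
def dirichlet (N : ℕ) (u : Space N → ℝ) : ℝ := ∫ x, ‖weakGrad N u x‖ ^ 2

/-- `I(u) = (1/2) ∫ |∇u|^2 + (1/(2p)) ∫ |I_{α/2} ⋆ |u|^p|^2`. -/
def energyI (N : ℕ) (α p : ℝ) (u : Space N → ℝ) : ℝ :=
  1 / 2 * dirichlet N u + 1 / (2 * p) * (coulomb N α p u).toReal

/-- `F(u) = (1/r) ∫ |u|^r`. -/
def energyF (N : ℕ) (r : ℝ) (u : Space N → ℝ) : ℝ := 1 / r * ∫ x, |u x| ^ r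

/-- `G(u) = (1/2^*) ∫ |u|^{2^*}`. -/
def energyG (N : ℕ) (u : Space N → ℝ) : ℝ :=
  1 / twoStar N * ∫ x, |u x| ^ twoStar N

/-- `λ_c(u) = (I(u) - G(u) - c) / F(u)`. -/
def lam (N : ℕ) (α p r c : ℝ) (u : Space N → ℝ) : ℝ :=
  (energyI N α p u - energyG N u - c) / energyF N r u

/-- The scaling `u_t(x) = t^σ u(tx)`. -/
def scale (N : ℕ) (α p t : ℝ) (u : Space N → ℝ) : Space N → ℝ :=
  fun x => t ^ sigma α p * u (t • x)

/-- The fibering map `φ_{c,u}(t) = λ_c(u_t)`. -/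
def fiber (N : ℕ) (α p r c : ℝ) (u : Space N → ℝ) (t : ℝ) : ℝ :=
  lam N α p r c (scale N α p t u)

/-- The scaled Nehari manifold
`N_c = {u_t : u ∈ E_R^{α,p}(ℝ^N) \ {0}, t > 0, φ_{c,u}'(t) = 0}`. -/
def scaledNehari (N : ℕ) (α p r c : ℝ) : Set (Space N → ℝ) :=
  {w | ∃ u ∈ ERNonzero N α p, ∃ t : ℝ, 0 < t ∧
    HasDerivAt (fiber N α p r c u) 0 t ∧ w = scale N α p t u}

/-- `Λ_c`, the restriction of `λ_c` to `N_c`. -/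
def Lam (N : ℕ) (α p r c : ℝ) : scaledNehari N α p r c → ℝ :=
  (scaledNehari N α p r c).domRestrict (lam N α p r c)

/-- The best Sobolev constant: the biggest `S` such that `S ‖u‖_{2^*}^2 ≤ ‖∇u‖_2^2` for all
`u` in `E_R^{α,p}(ℝ^N)`. -/
def sobolevConst (N : ℕ) (α p : ℝ) : ℝ :=
  sSup {S : ℝ | ∀ u ∈ ER N α p,
    S * ((∫ x, |u x| ^ twoStar N) ^ (1 / twoStar N)) ^ 2 ≤ dirichlet N u}

/-- The threshold energy
`c^* = (1/2) ((s_{2^*} - s_q)/s_{2^*}) ((2^*/2) (s_q/s_{2^*}))^{s_q/(s_{2^*}-s_q)}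
  S^{s_{2^*}/(s_{2^*}-s_q)}`. -/
def cStar (N : ℕ) (α p : ℝ) : ℝ :=
  let sq := sExp N α p (qExp α p)
  let s2 := sExp N α p (twoStar N)
  1 / 2 * ((s2 - sq) / s2) * (twoStar N / 2 * (sq / s2)) ^ (sq / (s2 - sq)) *
    sobolevConst N α p ^ (s2 / (s2 - sq))

end SPS

end

/-!
The exponents satisfy `s_{2^*} = (2^*/2) s_q` with `s_q > 0`, because the Dirichlet energy `D(u)`
and the Coulomb energy both scale like `t^(s_q)` while `X(u) = ∫ |u|^(2^*)` scales like
`t^(s_{2^*})`. Hence `c^* = S^(N/2)/N`, the energy level of the Sobolev extremal.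

*Lower bound.* On the scaled Nehari manifold, with `y = I(u)` and `z = G(u)`, the vanishing of the
derivative reads `(s_r - s_q) y + (s_{2^*} - s_r) z = c s_r`. If the numerator `y - z - c` were
negative, this equation would give `2y < X(u)`; Sobolev's inequality `S X^(2/2^*) ≤ D ≤ 2y` would
then give `y > S^(N/2)/2 = (N/2) c`, contradicting the same equation
(`lam_nonneg_of_mem_scaledNehari`). This uses that `S` is positive and
itself satisfies the Sobolev inequality.

*The Sobolev constant.* Both bounds need the Sobolev inequality on `E_R`, the upper one with its
sharp constant. All functions are radial, so it reduces to Bliss' inequality on the half-line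
(`bliss_inequality`), proved by a calibration: for `v = r^γ f` with `γ = (N-2)/2`, the energy
density minus `(N-2)²` times the mass density equals the derivative of `-γ v²` plus
`((r v')² + W(v))/r`, where `W(v) = γ² v² - 4 γ² |v|^(2^*)`; the last term dominates the derivative
of `±2Ψ(v)`, `Ψ` being a primitive of `√W`, with equality for the Aubin–Talenti profile
`(1 + r²)^(-γ)`. Weakly differentiable functions are treated by radial mollification and Fatou's
lemma (`sharp_sobolev_of_hasWeakGradient`). The truncated extremals show that `S` is a supremum of
a bounded set, and `S` is at least the sharp radial constant.

*Upper bound.* Let `w_R` be the extremal lowered by its value at radius `R` and cut off there, and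
`v_R = R^γ w_R(R ·)`. The Sobolev quotient of `v_R` exceeds the optimal one by `O(R^(2-N))`
(`exists_quotient_truncBubble_le`). Splitting `w_R^p` into dyadic layers, on each of which it is
bounded by a multiple of the indicator function of a ball, bounds the Coulomb energy by a power of
`R` up to a logarithm (`exists_coulomb_truncBubble_le`). The fibering map of `v_R` has a critical
point by the intermediate value theorem, and the value of `λ_{c^*}` there is at most a constant
times the sum of these two errors divided by `∫ |v_R|^r` (`critical_value_le`). That integral is
bounded below by a multiple of `R^((N-2)r/2 - N)`, so the bound tends to `0` as `R → ∞`
(`exists_tendsto_lam_le`) provided that `(N-2) r > 4` and that the Coulomb error is negligible.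
The former holds in each of the five cases (`four_lt_of_cases`), and the latter follows from it,
`r ≥ q` and `p < (N+α)/(N-2)` (`coulomb_exponent_neg`).
-/

namespace SPS

/-! ### Weak gradients -/

section WeakGradient

variable {N : ℕ} {u : Space N → ℝ} {g : Space N → Space N}

theorem HasWeakGradient.ae_unique {g' : Space N → Space N} (h : HasWeakGradient N u g)
    (h' : HasWeakGradient N u g') : g =ᵐ[volume] g' := by
  refine ae_eq_of_integral_contDiff_smul_eq h.2.1 h'.2.1 fun φ hφ hc => ?_
  have h1 := h.2.2 φ hφ hc
  rw [h'.2.2 φ hφ hc] at h1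
  exact (neg_injective h1).symm

theorem HasWeakGradient.weakGrad_ae_eq (h : HasWeakGradient N u g) :
    weakGrad N u =ᵐ[volume] g := by
  have hex : ∃ g, HasWeakGradient N u g := ⟨g, h⟩
  rw [weakGrad, dif_pos hex]
  exact hex.choose_spec.ae_unique h

theorem HasWeakGradient.dirichlet_eq (h : HasWeakGradient N u g) :
    dirichlet N u = ∫ x, ‖g x‖ ^ 2 := by
  refine integral_congr_ae ?_
  filter_upwards [h.weakGrad_ae_eq] with x hx
  rw [hx]

end WeakGradient

/-! ### Dilations -/

section Dilation

variable {N : ℕ}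

theorem integral_comp_dilation {F : Type*} [NormedAddCommGroup F] [NormedSpace ℝ F]
    {t : ℝ} (ht : 0 < t) {f g : Space N → F} (h : ∀ x, g x = f (t • x)) :
    ∫ x, g x = t ^ (-(N : ℝ)) • ∫ x, f x := by
  rw [funext h, Measure.integral_comp_smul_of_nonneg volume f t (hR := ht.le),
    finrank_euclideanSpace_fin,
    Real.rpow_neg ht.le, Real.rpow_natCast]

theorem lintegral_comp_dilation {t : ℝ} (ht : 0 < t) {f g : Space N → ℝ≥0∞}
    (h : ∀ x, g x = f (t • x)) :
    ∫⁻ x, g x = ENNReal.ofReal (t ^ (-(N : ℝ))) * ∫⁻ x, f x := by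
  rw [funext h]
  calc
    ∫⁻ x, f (t • x) = ∫⁻ y, f y ∂(Measure.map (fun x : Space N => t • x) volume) :=
      (lintegral_map_equiv f
        (Homeomorph.smul (isUnit_iff_ne_zero.2 ht.ne').unit).toMeasurableEquiv).symm
    _ = _ := by
      rw [Measure.map_addHaar_smul volume ht.ne', lintegral_smul_measure,
        finrank_euclideanSpace_fin, Real.rpow_neg ht.le, Real.rpow_natCast,
        abs_of_pos (by positivity), smul_eq_mul]

theorem locallyIntegrable_comp_dilation {F : Type*} [NormedAddCommGroup F]
    {t : ℝ} (ht : t ≠ 0) {f : Space N → F} (hf : LocallyIntegrable f volume) :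
    LocallyIntegrable (fun x => f (t • x)) volume := by
  rw [locallyIntegrable_iff] at hf ⊢
  intro K hK
  have hK' : IsCompact ((fun x : Space N => t • x) '' K) := hK.image (continuous_const_smul t)
  have h1 := hf _ hK'
  rw [← integrable_indicator_iff hK'.measurableSet] at h1
  rw [← integrable_indicator_iff hK.measurableSet]
  have h2 := (integrable_comp_smul_iff volume _ ht).2 h1
  refine h2.congr (Filter.Eventually.of_forall fun x => ?_)
  by_cases hx : x ∈ K
  · have : t • x ∈ (fun x : Space N => t • x) '' K := ⟨x, hx, rfl⟩
    simp only [Set.indicator_of_mem hx, Set.indicator_of_mem this]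
  · have : t • x ∉ (fun x : Space N => t • x) '' K := by
      rintro ⟨y, hy, hyx⟩
      exact hx (smul_right_injective _ ht hyx ▸ hy)
    simp only [Set.indicator_of_notMem hx, Set.indicator_of_notMem this]

/-- The dilation `x ↦ A u(tx)`. -/
def dilate (A t : ℝ) (u : Space N → ℝ) : Space N → ℝ := fun x => A * u (t • x)

theorem scale_eq_dilate (α p t : ℝ) (u : Space N → ℝ) :
    scale N α p t u = dilate (t ^ sigma α p) t u := rfl

theorem gradient_comp_smul (φ : Space N → ℝ) (t : ℝ) (x : Space N) :
    gradient (fun y => φ (t • y)) x = t • gradient φ (t • x) := by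
  unfold gradient
  rw [fderiv_comp_smul, map_smul]

variable {u : Space N → ℝ} {g : Space N → Space N} {A t : ℝ}

theorem HasWeakGradient.dilate (h : HasWeakGradient N u g) (ht : 0 < t) :
    HasWeakGradient N (dilate A t u) (fun x => (A * t) • g (t • x)) := by
  refine ⟨(locallyIntegrable_comp_dilation ht.ne' h.1).smul A,
    (locallyIntegrable_comp_dilation ht.ne' h.2.1).smul (A * t), fun φ hφ hc => ?_⟩
  let ψ : Space N → ℝ := fun y => φ (t⁻¹ • y)
  have hψ : ContDiff ℝ ∞ ψ := hφ.comp (contDiff_const_smul _)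
  have hψc : HasCompactSupport ψ :=
    hc.comp_homeomorph (Homeomorph.smulOfNeZero t⁻¹ (inv_ne_zero ht.ne'))
  have hφψ : φ = fun y => ψ (t • y) := by
    funext y
    simp only [ψ, smul_smul, inv_mul_cancel₀ ht.ne', one_smul]
  have h1 : ∀ x, SPS.dilate A t u x • gradient φ x
      = (fun y => (A * t) • u y • gradient ψ y) (t • x) := by
    intro x
    rw [hφψ, gradient_comp_smul]
    simp only [SPS.dilate, smul_smul]
    congr 1
    ring
  have h2 : ∀ x, φ x • (A * t) • g (t • x) = (fun y => (A * t) • ψ y • g y) (t • x) := by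
    intro x
    rw [hφψ]
    simp only [smul_smul]
    congr 1
    ring
  rw [integral_comp_dilation ht (f := fun y => (A * t) • u y • gradient ψ y) h1,
    integral_comp_dilation ht (f := fun y => (A * t) • ψ y • g y) h2, integral_smul, integral_smul,
    h.2.2 ψ hψ hψc, smul_neg, smul_neg]

theorem HasWeakGradient.dirichlet_dilate (h : HasWeakGradient N u g) (ht : 0 < t) :
    dirichlet N (SPS.dilate A t u) = A ^ 2 * t ^ (2 - (N : ℝ)) * dirichlet N u := by
  rw [(h.dilate ht).dirichlet_eq, h.dirichlet_eq]
  have : ∀ x : Space N, ‖(A * t) • g (t • x)‖ ^ 2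
      = (fun y => (A * t) ^ 2 * ‖g y‖ ^ 2) (t • x) := by
    intro x
    rw [norm_smul, mul_pow, Real.norm_eq_abs, sq_abs]
  rw [integral_comp_dilation ht (f := fun y => (A * t) ^ 2 * ‖g y‖ ^ 2) this,
    integral_const_mul, smul_eq_mul, sub_eq_add_neg,
    Real.rpow_add ht, Real.rpow_two]
  ring

theorem integral_rpow_dilate (hA : 0 ≤ A) (ht : 0 < t) (l : ℝ) :
    ∫ x, |dilate A t u x| ^ l = A ^ l * t ^ (-(N : ℝ)) * ∫ x, |u x| ^ l := by
  have : ∀ x : Space N, |dilate A t u x| ^ l = (fun y => A ^ l * |u y| ^ l) (t • x) := by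
    intro x
    simp only [dilate]
    rw [abs_mul, abs_of_nonneg hA, Real.mul_rpow hA (abs_nonneg _)]
  rw [integral_comp_dilation ht (f := fun y => A ^ l * |u y| ^ l) this,
    integral_const_mul, smul_eq_mul]
  ring

theorem rieszKernel_smul (β : ℝ) (ht : 0 < t) (x : Space N) :
    rieszKernel N β x = t ^ ((N : ℝ) - β) * rieszKernel N β (t • x) := by
  unfold rieszKernel
  rw [norm_smul, Real.norm_of_nonneg ht.le, Real.mul_rpow ht.le (norm_nonneg _)]
  have := (Real.rpow_pos_of_pos ht ((N : ℝ) - β)).ne'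
  rw [← mul_div_assoc, mul_div_mul_left _ _ this]

theorem rieszConv_dilate (α p : ℝ) (hA : 0 ≤ A) (ht : 0 < t) (x : Space N) :
    rieszConv N α p (dilate A t u) x
      = ENNReal.ofReal (A ^ p * t ^ (-(α / 2))) * rieszConv N α p u (t • x) := by
  unfold rieszConv
  have h : ∀ y : Space N, ENNReal.ofReal (rieszKernel N (α / 2) (x - y) * |dilate A t u y| ^ p)
      = (fun z => ENNReal.ofReal (A ^ p * t ^ ((N : ℝ) - α / 2)) *
          ENNReal.ofReal (rieszKernel N (α / 2) (t • x - z) * |u z| ^ p)) (t • y) := by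
    intro y
    simp only [dilate]
    rw [← ENNReal.ofReal_mul (by positivity), ← smul_sub, abs_mul, abs_of_nonneg hA,
      Real.mul_rpow hA (abs_nonneg _), rieszKernel_smul _ ht]
    congr 1
    ring
  rw [lintegral_comp_dilation ht (f := fun z => ENNReal.ofReal (A ^ p * t ^ ((N : ℝ) - α / 2)) *
    ENNReal.ofReal (rieszKernel N (α / 2) (t • x - z) * |u z| ^ p)) h,
    lintegral_const_mul' _ _ ENNReal.ofReal_ne_top, ← mul_assoc,
    ← ENNReal.ofReal_mul (by positivity)]
  congr 2
  rw [mul_comm, mul_assoc, ← Real.rpow_add ht]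
  congr 2
  ring

theorem coulomb_dilate (α p : ℝ) (hA : 0 ≤ A) (ht : 0 < t) :
    coulomb N α p (dilate A t u)
      = ENNReal.ofReal (A ^ (2 * p) * t ^ (-(α + N))) * coulomb N α p u := by
  unfold coulomb
  have h : ∀ x : Space N, rieszConv N α p (dilate A t u) x ^ 2
      = (fun z => ENNReal.ofReal ((A ^ p * t ^ (-(α / 2))) ^ 2) *
        rieszConv N α p u z ^ 2) (t • x) := by
    intro x
    simp only []
    rw [rieszConv_dilate α p hA ht, mul_pow, ENNReal.ofReal_pow (by positivity)]
  rw [lintegral_comp_dilation ht (f := fun z => ENNReal.ofReal ((A ^ p * t ^ (-(α / 2))) ^ 2) *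
    rieszConv N α p u z ^ 2) h, lintegral_const_mul' _ _ ENNReal.ofReal_ne_top, ← mul_assoc,
    ← ENNReal.ofReal_mul (by positivity)]
  congr 2
  rw [mul_pow, ← Real.rpow_mul_natCast hA, ← Real.rpow_mul_natCast ht.le, mul_comm, mul_assoc,
    ← Real.rpow_add ht]
  congr 2 <;> push_cast <;> ring

theorem dilate_mem_ER {α p : ℝ} (hA : 0 ≤ A) (ht : 0 < t) (hu : u ∈ ER N α p) :
    dilate A t u ∈ ER N α p := by
  obtain ⟨hm, hc, ⟨g, hg, hg2⟩, f, hf⟩ := hu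
  have hq := Measure.quasiMeasurePreserving_smul (volume : Measure (Space N)) ht.ne'
  refine ⟨(hm.comp_quasiMeasurePreserving hq).const_mul A, ?_, ⟨_, hg.dilate ht, ?_⟩, ?_⟩
  · rw [coulomb_dilate α p hA ht]
    exact ENNReal.mul_lt_top ENNReal.ofReal_lt_top hc
  · have hgm : AEStronglyMeasurable (fun x => (A * t) • g (t • x)) volume :=
      AEStronglyMeasurable.const_smul (hg2.1.comp_quasiMeasurePreserving hq) (A * t)
    rw [memLp_two_iff_integrable_sq_norm hgm]
    rw [memLp_two_iff_integrable_sq_norm hg2.1] at hg2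
    have := ((integrable_comp_smul_iff volume _ ht.ne').2 hg2).const_mul ((A * t) ^ 2)
    refine this.congr (Filter.Eventually.of_forall fun x => ?_)
    simp only [norm_smul, mul_pow, Real.norm_eq_abs, sq_abs]
  · refine ⟨fun s => A * f (t * s), ?_⟩
    filter_upwards [hq.ae hf] with x hx
    simp only [dilate]
    rw [hx, norm_smul, Real.norm_of_nonneg ht.le]

theorem dilate_mem_ERNonzero {α p : ℝ} (hA : 0 < A) (ht : 0 < t) (hu : u ∈ ERNonzero N α p) :
    dilate A t u ∈ ERNonzero N α p := by
  refine ⟨dilate_mem_ER hA.le ht hu.1, fun h => hu.2 ?_⟩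
  have hq := Measure.quasiMeasurePreserving_smul (volume : Measure (Space N)) (inv_ne_zero ht.ne')
  filter_upwards [hq.ae h] with x hx
  simpa [dilate, smul_smul, mul_inv_cancel₀ ht.ne', hA.ne'] using hx

end Dilation

/-! ### A sharp one-dimensional inequality -/

section Bliss

/-- The nonnegative square root of `γ²y² - 4γ²|y|^(2+2/γ)` where the latter is nonnegative, that is
for `|y| ≤ 2^(-γ)`, and `0` elsewhere. -/
noncomputable def calib (γ y : ℝ) : ℝ := γ * |y| * √(1 - 4 * |y| ^ (2 / γ))

/-- The odd primitive of `calib γ`. -/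
noncomputable def calibPrim (γ y : ℝ) : ℝ := ∫ s in (0 : ℝ)..y, calib γ s

/-- The maximum `2^(-γ)` of the extremal profile `r ↦ r^γ (1+r²)^(-γ)`. -/
noncomputable def profileMax (γ : ℝ) : ℝ := 2 ^ (-γ)

/-- The gap `∫ f'² r^(2γ+1) - 4γ² ∫ |f|^(2+2/γ) r^(2γ+1)` of the extremal `f = (1+r²)^(-γ)`. -/
noncomputable def blissGap (γ : ℝ) : ℝ := 4 * calibPrim γ (profileMax γ)

/-- The value of `∫ |f|^(2+2/γ) r^(2γ+1)` for the extremal `f = (1+r²)^(-γ)`. -/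
noncomputable def blissMass (γ : ℝ) : ℝ := blissGap γ / (4 * γ)

/-- The optimal constant `K` in
`K (∫ |f|^(2+2/γ) r^(2γ+1))^(γ/(γ+1)) ≤ ∫ f'² r^(2γ+1)`. -/
noncomputable def blissConst (γ : ℝ) : ℝ :=
  4 * γ * (γ + 1) * blissMass γ / blissMass γ ^ (γ / (γ + 1))

variable {γ : ℝ}

theorem continuous_calib (hγ : 0 < γ) : Continuous (calib γ) := by
  unfold calib
  have : Continuous fun y : ℝ => |y| ^ (2 / γ) :=
    continuous_abs.rpow_const fun _ => Or.inr (by positivity)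
  fun_prop

theorem hasDerivAt_calibPrim (hγ : 0 < γ) (y : ℝ) :
    HasDerivAt (calibPrim γ) (calib γ y) y :=
  intervalIntegral.integral_hasDerivAt_right ((continuous_calib hγ).intervalIntegrable _ _)
    (continuous_calib hγ).stronglyMeasurable.stronglyMeasurableAtFilter
    (continuous_calib hγ).continuousAt

theorem calibPrim_zero : calibPrim γ 0 = 0 := by simp [calibPrim]

theorem calib_nonneg (hγ : 0 < γ) (y : ℝ) : 0 ≤ calib γ y := by
  unfold calib; positivity

theorem calib_le (hγ : 0 < γ) (y : ℝ) : calib γ y ≤ γ * |y| := by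
  unfold calib
  refine mul_le_of_le_one_right (by positivity) ?_
  have : 0 ≤ |y| ^ (2 / γ) := by positivity
  exact Real.sqrt_le_iff.2 ⟨zero_le_one, by linarith⟩

theorem calibPrim_nonneg (hγ : 0 < γ) {y : ℝ} (hy : 0 ≤ y) : 0 ≤ calibPrim γ y :=
  intervalIntegral.integral_nonneg hy fun s _ => calib_nonneg hγ s

theorem two_mul_calibPrim_le (hγ : 0 < γ) (y : ℝ) : 2 * calibPrim γ y ≤ γ * y ^ 2 := by
  rcases le_total 0 y with hy | hy
  · have h : calibPrim γ y ≤ ∫ s in (0 : ℝ)..y, γ * s := by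
      refine intervalIntegral.integral_mono_on hy ((continuous_calib hγ).intervalIntegrable _ _)
        (Continuous.intervalIntegrable (by fun_prop) _ _) fun s hs => ?_
      simpa [abs_of_nonneg hs.1] using calib_le hγ s
    rw [intervalIntegral.integral_const_mul, integral_id] at h
    nlinarith
  · have h : calibPrim γ y ≤ 0 := by
      unfold calibPrim
      rw [intervalIntegral.integral_symm]
      exact neg_nonpos.2 (intervalIntegral.integral_nonneg hy fun s _ => calib_nonneg hγ s)
    nlinarith [sq_nonneg y]

theorem profileMax_pos : 0 < profileMax γ := by unfold profileMax; positivity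

theorem four_mul_profileMax_rpow (hγ : 0 < γ) : 4 * profileMax γ ^ (2 / γ) = 1 := by
  unfold profileMax
  rw [← Real.rpow_mul (by norm_num), show -γ * (2 / γ) = -2 by field_simp,
    Real.rpow_neg (by norm_num)]
  norm_num

theorem calib_sq (hγ : 0 < γ) {y : ℝ} (hy : |y| ≤ profileMax γ) :
    calib γ y ^ 2 = γ ^ 2 * y ^ 2 - 4 * γ ^ 2 * |y| ^ (2 + 2 / γ) := by
  have h0 : 0 ≤ |y| ^ (2 / γ) := by positivity
  have h1 : |y| ^ (2 / γ) ≤ profileMax γ ^ (2 / γ) :=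
    Real.rpow_le_rpow (abs_nonneg y) hy (by positivity)
  have h2 := four_mul_profileMax_rpow hγ
  have h3 : |y| ^ (2 + 2 / γ) = y ^ 2 * |y| ^ (2 / γ) := by
    rw [Real.rpow_add_of_nonneg (abs_nonneg y) (by norm_num) (by positivity), Real.rpow_two, sq_abs]
  unfold calib
  rw [mul_pow, mul_pow, Real.sq_sqrt (by linarith), sq_abs, h3]
  ring

theorem blissGap_pos (hγ : 0 < γ) : 0 < blissGap γ := by
  unfold blissGap
  refine mul_pos (by norm_num) (intervalIntegral.intervalIntegral_pos_of_pos_on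
    ((continuous_calib hγ).intervalIntegrable _ _) (fun s hs => ?_) profileMax_pos)
  have h1 : s ^ (2 / γ) < profileMax γ ^ (2 / γ) :=
    Real.rpow_lt_rpow hs.1.le hs.2 (by positivity)
  have h2 := four_mul_profileMax_rpow hγ
  unfold calib
  rw [abs_of_pos hs.1]
  exact mul_pos (mul_pos hγ hs.1) (Real.sqrt_pos.2 (by linarith))

theorem blissMass_pos (hγ : 0 < γ) : 0 < blissMass γ :=
  div_pos (blissGap_pos hγ) (by positivity)

theorem blissConst_pos (hγ : 0 < γ) : 0 < blissConst γ := by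
  have := blissMass_pos hγ
  unfold blissConst
  positivity

variable {a b : ℝ} {f f' : ℝ → ℝ}

theorem hasDerivAt_rpow_mul {r : ℝ} (hr : 0 < r) (hf : HasDerivAt f (f' r) r) :
    HasDerivAt (fun s => s ^ γ * f s) (γ * r ^ (γ - 1) * f r + r ^ γ * f' r) r :=
  (Real.hasDerivAt_rpow_const (Or.inl hr.ne')).mul hf

/-- The energy density in terms of `v = r^γ f`: with `y = f(r)` and `z = f'(r)`, the bracket
`γ r^(γ-1) y + r^γ z` is the derivative of `v` at `r`. -/
theorem sq_mul_rpow_eq {r y z : ℝ} (hr : 0 < r) :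
    z ^ 2 * r ^ (2 * γ + 1)
      = r * (γ * r ^ (γ - 1) * y + r ^ γ * z) ^ 2
        - 2 * γ * (r ^ γ * y) * (γ * r ^ (γ - 1) * y + r ^ γ * z) + γ ^ 2 * (r ^ γ * y) ^ 2 / r := by
  rw [Real.rpow_sub hr, Real.rpow_one, Real.rpow_add hr, Real.rpow_one, mul_comm 2 γ,
    Real.rpow_mul hr.le, Real.rpow_two]
  field_simp
  ring

theorem abs_rpow_mul_rpow_eq (hγ : 0 < γ) {r y : ℝ} (hr : 0 < r) :
    |y| ^ (2 + 2 / γ) * r ^ (2 * γ + 1) = |r ^ γ * y| ^ (2 + 2 / γ) / r := by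
  have h0 : 0 < r ^ γ := Real.rpow_pos_of_pos hr γ
  rw [abs_mul, abs_of_pos h0, Real.mul_rpow h0.le (abs_nonneg y), ← Real.rpow_mul hr.le,
    show γ * (2 + 2 / γ) = (2 * γ + 1) + 1 by field_simp; ring, Real.rpow_add hr (2 * γ + 1),
    Real.rpow_one]
  field_simp

/-- The calibration: the energy minus `4γ²` times the mass dominates the derivative of
`-γv² + 2εΨ(v)`, for `ε = ±1`. -/
theorem calibration_le (hγ : 0 < γ) {r y z ε : ℝ} (hr : 0 < r) (hε : ε ^ 2 = 1)
    (hy : |r ^ γ * y| ≤ profileMax γ) :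
    -(γ * (2 * (r ^ γ * y) * (γ * r ^ (γ - 1) * y + r ^ γ * z)))
        + 2 * ε * (calib γ (r ^ γ * y) * (γ * r ^ (γ - 1) * y + r ^ γ * z))
      ≤ z ^ 2 * r ^ (2 * γ + 1) - 4 * γ ^ 2 * (|y| ^ (2 + 2 / γ) * r ^ (2 * γ + 1)) := by
  rw [abs_rpow_mul_rpow_eq hγ hr, sq_mul_rpow_eq (y := y) hr]
  have h := calib_sq hγ hy
  generalize γ * r ^ (γ - 1) * y + r ^ γ * z = w at *
  generalize r ^ γ * y = v at *
  -- Completing the square with `ε calib(v)`, the value of `r v'` along the extremal.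
  have h2 : 0 ≤ (r * w - ε * calib γ v) ^ 2 / r := by positivity
  have h3 : (r * w - ε * calib γ v) ^ 2 / r
      = r * w ^ 2 - 2 * ε * (calib γ v * w) + calib γ v ^ 2 / r := by
    field_simp
    linear_combination calib γ v ^ 2 * hε
  rw [h3, h] at h2
  have h4 : (γ ^ 2 * v ^ 2 - 4 * γ ^ 2 * |v| ^ (2 + 2 / γ)) / r
      = γ ^ 2 * v ^ 2 / r - 4 * γ ^ 2 * (|v| ^ (2 + 2 / γ) / r) := by ring
  linarith

theorem continuousOn_energy (ha : 0 < a) (hf' : ContinuousOn f' (Set.Icc a b)) :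
    ContinuousOn (fun r => f' r ^ 2 * r ^ (2 * γ + 1)) (Set.Icc a b) :=
  (hf'.pow 2).mul (continuousOn_id.rpow_const fun _ hr => Or.inl (ha.trans_le hr.1).ne')

theorem continuousOn_mass (hγ : 0 < γ) (ha : 0 < a) (hf : ContinuousOn f (Set.Icc a b)) :
    ContinuousOn (fun r => |f r| ^ (2 + 2 / γ) * r ^ (2 * γ + 1)) (Set.Icc a b) :=
  (hf.abs.rpow_const fun _ _ => Or.inr (by positivity)).mul
    (continuousOn_id.rpow_const fun _ hr => Or.inl (ha.trans_le hr.1).ne')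

theorem le_integral_of_calibration (hγ : 0 < γ) (ha : 0 < a) (hab : a ≤ b) {ε : ℝ} (hε : ε ^ 2 = 1)
    (hf : ∀ r ∈ Set.Icc a b, HasDerivAt f (f' r) r) (hf' : ContinuousOn f' (Set.Icc a b))
    (hv : ∀ r ∈ Set.Icc a b, |r ^ γ * f r| ≤ profileMax γ) :
    (-(γ * (b ^ γ * f b) ^ 2) + 2 * ε * calibPrim γ (b ^ γ * f b))
        - (-(γ * (a ^ γ * f a) ^ 2) + 2 * ε * calibPrim γ (a ^ γ * f a))
      ≤ ∫ r in a..b, (f' r ^ 2 * r ^ (2 * γ + 1)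
          - 4 * γ ^ 2 * (|f r| ^ (2 + 2 / γ) * r ^ (2 * γ + 1))) := by
  have hder : ∀ r ∈ Set.Icc a b, HasDerivAt
      (fun r => -(γ * (r ^ γ * f r) ^ 2) + 2 * ε * calibPrim γ (r ^ γ * f r))
      (-(γ * (2 * (r ^ γ * f r) * (γ * r ^ (γ - 1) * f r + r ^ γ * f' r)))
        + 2 * ε * (calib γ (r ^ γ * f r) * (γ * r ^ (γ - 1) * f r + r ^ γ * f' r))) r := by
    intro r hr
    have h1 := hasDerivAt_rpow_mul (γ := γ) (ha.trans_le hr.1) (hf r hr)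
    have h2 := ((h1.pow 2).const_mul γ).neg
    have h3 := ((hasDerivAt_calibPrim hγ _).comp r h1).const_mul (2 * ε)
    refine (h2.add h3).congr_deriv ?_
    norm_num
  have hfc : ContinuousOn f (Set.Icc a b) := fun r hr => (hf r hr).continuousAt.continuousWithinAt
  refine intervalIntegral.sub_le_integral_of_hasDeriv_right_of_le hab
    (fun r hr => (hder r hr).continuousAt.continuousWithinAt)
    (fun r hr => (hder r (Set.Ioo_subset_Icc_self hr)).hasDerivWithinAt) ?_ fun r hr => ?_
  · exact ((continuousOn_energy ha hf').sub
      (continuousOn_const.mul (continuousOn_mass hγ ha hfc))).integrableOn_compact isCompact_Icc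
  · exact calibration_le hγ (ha.trans hr.1) hε (hv r (Set.Ioo_subset_Icc_self hr))

/-- The calibrated inequality for `f` normalized so that `r^γ f` attains its maximum `2^(-γ)`. -/
theorem blissGap_le_of_max (hγ : 0 < γ) (ha : 0 < a) {c : ℝ} (hc : c ∈ Set.Icc a b)
    (hf : ∀ r ∈ Set.Icc a b, HasDerivAt f (f' r) r) (hf' : ContinuousOn f' (Set.Icc a b))
    (hv : ∀ r ∈ Set.Icc a b, |r ^ γ * f r| ≤ profileMax γ) (hcM : c ^ γ * f c = profileMax γ) :
    blissGap γ - 2 * γ * (b ^ γ * f b) ^ 2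
      ≤ (∫ r in a..b, f' r ^ 2 * r ^ (2 * γ + 1))
        - 4 * γ ^ 2 * ∫ r in a..b, |f r| ^ (2 + 2 / γ) * r ^ (2 * γ + 1) := by
  have hfc : ContinuousOn f (Set.Icc a b) := fun r hr => (hf r hr).continuousAt.continuousWithinAt
  have hab := hc.1.trans hc.2
  have hmass : ContinuousOn (fun r => 4 * γ ^ 2 * (|f r| ^ (2 + 2 / γ) * r ^ (2 * γ + 1)))
      (Set.Icc a b) := continuousOn_const.mul (continuousOn_mass hγ ha hfc)
  have hcont : ContinuousOn (fun r => f' r ^ 2 * r ^ (2 * γ + 1)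
      - 4 * γ ^ 2 * (|f r| ^ (2 + 2 / γ) * r ^ (2 * γ + 1))) (Set.Icc a b) :=
    (continuousOn_energy ha hf').sub hmass
  have s1 : Set.Icc a c ⊆ Set.Icc a b := Set.Icc_subset_Icc_right hc.2
  have s2 : Set.Icc c b ⊆ Set.Icc a b := Set.Icc_subset_Icc_left hc.1
  have i1 := (hcont.mono s1).intervalIntegrable_of_Icc (μ := volume) hc.1
  have i2 := (hcont.mono s2).intervalIntegrable_of_Icc (μ := volume) hc.2
  -- The sign of `ε` changes at `c`, so that `Ψ` is picked up twice at the maximum.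
  have h1 := le_integral_of_calibration hγ ha hc.1 (ε := 1) (by norm_num)
    (fun r hr => hf r (s1 hr)) (hf'.mono s1) (fun r hr => hv r (s1 hr))
  have h2 := le_integral_of_calibration hγ (ha.trans_le hc.1) hc.2 (ε := -1) (by norm_num)
    (fun r hr => hf r (s2 hr)) (hf'.mono s2) (fun r hr => hv r (s2 hr))
  rw [← intervalIntegral.integral_const_mul, ← intervalIntegral.integral_sub
    ((continuousOn_energy ha hf').intervalIntegrable_of_Icc hab)
    (hmass.intervalIntegrable_of_Icc hab),
    ← intervalIntegral.integral_add_adjacent_intervals i1 i2]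
  rw [hcM] at h1 h2
  have h3 := two_mul_calibPrim_le hγ (a ^ γ * f a)
  have h4 := two_mul_calibPrim_le hγ (b ^ γ * f b)
  unfold blissGap
  linarith

/-- Young's inequality balancing the two terms of the normalized inequality. -/
theorem blissConst_mul_rpow_le (hγ : 0 < γ) {B s : ℝ} (hB : 0 ≤ B) (hs : 0 < s) :
    blissConst γ * B ^ (γ / (γ + 1)) ≤ 4 * γ ^ 2 * (s ^ (-(1 / γ)) * B) + s * blissGap γ := by
  have hM := blissMass_pos hγ
  have hE : blissGap γ = 4 * γ * blissMass γ := by unfold blissMass; field_simp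
  have hg : 0 < γ + 1 := by linarith
  have h := Real.geom_mean_le_arith_mean2_weighted (w₁ := γ / (γ + 1)) (w₂ := 1 / (γ + 1))
    (p₁ := B / blissMass γ * s ^ (-(1 / γ))) (p₂ := s) (by positivity) (by positivity)
    (by positivity) hs.le (by field_simp)
  rw [Real.mul_rpow (by positivity) (by positivity), Real.div_rpow hB hM.le, ← Real.rpow_mul hs.le,
    mul_assoc, ← Real.rpow_add hs,
    show -(1 / γ) * (γ / (γ + 1)) + 1 / (γ + 1) = 0 by field_simp; ring, Real.rpow_zero,
    mul_one] at h
  have h2 := mul_le_mul_of_nonneg_left h (show 0 ≤ 4 * γ * (γ + 1) * blissMass γ by positivity)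
  rw [hE]
  unfold blissConst
  refine le_of_eq_of_le ?_ (h2.trans_eq ?_)
  · ring
  · field_simp

/-- Bliss' inequality on a bounded interval. The boundary term at `b` is the price for `r^γ f` not
vanishing there; no boundary term arises at `a`. -/
theorem bliss_inequality (hγ : 0 < γ) (ha : 0 < a) (hab : a ≤ b)
    (hf : ∀ r ∈ Set.Icc a b, HasDerivAt f (f' r) r) (hf' : ContinuousOn f' (Set.Icc a b)) :
    blissConst γ * (∫ r in a..b, |f r| ^ (2 + 2 / γ) * r ^ (2 * γ + 1)) ^ (γ / (γ + 1))
      ≤ (∫ r in a..b, f' r ^ 2 * r ^ (2 * γ + 1)) + 2 * γ * (b ^ γ * f b) ^ 2 := by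
  have hfc : ContinuousOn f (Set.Icc a b) := fun r hr => (hf r hr).continuousAt.continuousWithinAt
  have hvc : ContinuousOn (fun r => r ^ γ * f r) (Set.Icc a b) :=
    (continuousOn_id.rpow_const fun _ hr => Or.inl (ha.trans_le hr.1).ne').mul hfc
  obtain ⟨c, hc, hmax⟩ := isCompact_Icc.exists_isMaxOn ⟨a, Set.left_mem_Icc.2 hab⟩ hvc.abs
  have hmax : ∀ r ∈ Set.Icc a b, |r ^ γ * f r| ≤ |c ^ γ * f c| := fun r hr => hmax hr
  have hA : 0 ≤ ∫ r in a..b, f' r ^ 2 * r ^ (2 * γ + 1) :=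
    intervalIntegral.integral_nonneg hab fun r hr =>
      mul_nonneg (sq_nonneg _) (Real.rpow_nonneg (ha.le.trans hr.1) _)
  have hB : 0 ≤ ∫ r in a..b, |f r| ^ (2 + 2 / γ) * r ^ (2 * γ + 1) :=
    intervalIntegral.integral_nonneg hab fun r hr =>
      mul_nonneg (by positivity) (Real.rpow_nonneg (ha.le.trans hr.1) _)
  by_cases h0 : c ^ γ * f c = 0
  · have hz : ∫ r in a..b, |f r| ^ (2 + 2 / γ) * r ^ (2 * γ + 1) = 0 := by
      rw [intervalIntegral.integral_congr (g := fun _ => (0 : ℝ)), intervalIntegral.integral_zero]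
      intro r hr
      rw [Set.uIcc_of_le hab] at hr
      have h1 := hmax r hr
      rw [h0, abs_zero] at h1
      have h2 : f r = 0 := by
        have := (Real.rpow_pos_of_pos (ha.trans_le hr.1) γ).ne'
        simpa [this] using abs_nonpos_iff.1 h1
      simp only [h2, abs_zero]
      rw [Real.zero_rpow (by positivity), zero_mul]
    rw [hz, Real.zero_rpow (by positivity), mul_zero]
    positivity
  -- The multiple `l f` is normalized; the free parameter in Young's inequality undoes this scaling.
  · set l := profileMax γ / (c ^ γ * f c) with hl
    have hl0 : l ≠ 0 := div_ne_zero profileMax_pos.ne' h0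
    have hl1 : 0 < |l| := abs_pos.2 hl0
    have h := blissGap_le_of_max (f := fun r => l * f r) (f' := fun r => l * f' r) hγ ha hc
      (fun r hr => (hf r hr).const_mul l) (continuousOn_const.mul hf') (fun r hr => by
        rw [mul_left_comm, abs_mul, hl, abs_div, abs_of_pos profileMax_pos, div_mul_eq_mul_div,
          div_le_iff₀ (abs_pos.2 h0)]
        exact mul_le_mul_of_nonneg_left (hmax r hr) profileMax_pos.le)
      (by rw [mul_left_comm, hl, div_mul_cancel₀ _ h0])
    have e1 : ∀ r, (l * f' r) ^ 2 * r ^ (2 * γ + 1) = l ^ 2 * (f' r ^ 2 * r ^ (2 * γ + 1)) :=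
      fun r => by ring
    have e2 : ∀ r, |l * f r| ^ (2 + 2 / γ) * r ^ (2 * γ + 1)
        = |l| ^ (2 + 2 / γ) * (|f r| ^ (2 + 2 / γ) * r ^ (2 * γ + 1)) := fun r => by
      rw [abs_mul, Real.mul_rpow (abs_nonneg _) (abs_nonneg _)]
      ring
    simp only [e1, e2, intervalIntegral.integral_const_mul] at h
    have hy := blissConst_mul_rpow_le hγ hB (s := (l ^ 2)⁻¹) (by positivity)
    have e3 : |l| ^ (2 + 2 / γ) = l ^ 2 * ((l ^ 2)⁻¹) ^ (-(1 / γ)) := by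
      rw [Real.rpow_add hl1, Real.rpow_two, sq_abs, Real.inv_rpow (sq_nonneg l),
        ← Real.rpow_neg (sq_nonneg l), neg_neg, ← sq_abs l, ← Real.rpow_two,
        ← Real.rpow_mul (abs_nonneg l)]
      congr 2
      ring
    rw [e3] at h
    generalize ((l ^ 2)⁻¹) ^ (-(1 / γ)) = τ at *
    have hl2 : 0 < l ^ 2 := by positivity
    refine hy.trans ?_
    rw [← mul_le_mul_iff_right₀ hl2]
    have e4 : l ^ 2 * (4 * γ ^ 2 * (τ * ∫ r in a..b, |f r| ^ (2 + 2 / γ) * r ^ (2 * γ + 1))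
        + (l ^ 2)⁻¹ * blissGap γ)
        = 4 * γ ^ 2 * (l ^ 2 * τ * ∫ r in a..b, |f r| ^ (2 + 2 / γ) * r ^ (2 * γ + 1))
          + blissGap γ := by
      field_simp
    rw [e4]
    have e5 : (b ^ γ * (l * f b)) ^ 2 = l ^ 2 * (b ^ γ * f b) ^ 2 := by ring
    rw [e5] at h
    linarith

end Bliss

/-! ### The extremal profile -/

section Bubble

/-- The Aubin–Talenti profile `(1+r²)^(-γ)`. -/
noncomputable def bubble (γ r : ℝ) : ℝ := (1 + r ^ 2) ^ (-γ)

/-- The derivative of the Aubin–Talenti profile. -/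
noncomputable def bubbleDeriv (γ r : ℝ) : ℝ := -(2 * γ * r * (1 + r ^ 2) ^ (-γ - 1))

variable {γ : ℝ}

theorem one_add_sq_pos (r : ℝ) : 0 < 1 + r ^ 2 := by positivity

theorem bubble_pos (γ r : ℝ) : 0 < bubble γ r := Real.rpow_pos_of_pos (one_add_sq_pos r) _

theorem hasDerivAt_bubble (γ r : ℝ) : HasDerivAt (bubble γ) (bubbleDeriv γ r) r := by
  have h1 : HasDerivAt (fun r : ℝ => 1 + r ^ 2) (2 * r) r := by
    simpa using (hasDerivAt_pow 2 r).const_add 1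
  refine (h1.rpow_const (Or.inl (one_add_sq_pos r).ne')).congr_deriv ?_
  unfold bubbleDeriv
  ring

theorem continuous_bubble (γ : ℝ) : Continuous (bubble γ) :=
  continuous_iff_continuousAt.2 fun r => (hasDerivAt_bubble γ r).continuousAt

theorem continuous_bubbleDeriv (γ : ℝ) : Continuous (bubbleDeriv γ) := by
  unfold bubbleDeriv
  have : Continuous fun r : ℝ => (1 + r ^ 2) ^ (-γ - 1) :=
    Continuous.rpow_const (by fun_prop) fun r => Or.inl (one_add_sq_pos r).ne'
  fun_prop

theorem bubble_le_one (hγ : 0 < γ) (r : ℝ) : bubble γ r ≤ 1 :=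
  Real.rpow_le_one_of_one_le_of_nonpos (by nlinarith [sq_nonneg r]) (by linarith)

theorem bubble_antitoneOn (hγ : 0 < γ) {r s : ℝ} (hr : 0 ≤ r) (hrs : r ≤ s) :
    bubble γ s ≤ bubble γ r :=
  Real.rpow_le_rpow_of_nonpos (one_add_sq_pos r) (by gcongr) (by linarith)

theorem bubble_strictAntiOn (hγ : 0 < γ) {r s : ℝ} (hr : 0 ≤ r) (hrs : r < s) :
    bubble γ s < bubble γ r :=
  Real.rpow_lt_rpow_of_neg (one_add_sq_pos r) (by gcongr) (by linarith)

theorem bubble_le_rpow (hγ : 0 < γ) {r : ℝ} (hr : 0 < r) : bubble γ r ≤ r ^ (-(2 * γ)) := by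
  rw [show -(2 * γ) = 2 * (-γ) by ring, Real.rpow_mul hr.le, Real.rpow_two]
  exact Real.rpow_le_rpow_of_nonpos (by positivity) (by linarith) (by linarith)

theorem rpow_mul_bubble_eq {r : ℝ} (hr : 0 ≤ r) :
    r ^ γ * bubble γ r = (r / (1 + r ^ 2)) ^ γ := by
  rw [Real.div_rpow hr (one_add_sq_pos r).le, bubble, Real.rpow_neg (one_add_sq_pos r).le,
    div_eq_mul_inv]

theorem abs_rpow_mul_bubble_le (hγ : 0 < γ) {r : ℝ} (hr : 0 ≤ r) :
    |r ^ γ * bubble γ r| ≤ profileMax γ := by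
  rw [rpow_mul_bubble_eq hr, abs_of_nonneg (by positivity), profileMax,
    Real.rpow_neg (by norm_num), ← Real.inv_rpow (by norm_num)]
  refine Real.rpow_le_rpow (by positivity) ?_ hγ.le
  rw [div_le_iff₀ (one_add_sq_pos r)]
  nlinarith [sq_nonneg (r - 1)]

theorem mul_deriv_rpow_mul_bubble {r : ℝ} (hr : 0 < r) :
    r * (γ * r ^ (γ - 1) * bubble γ r + r ^ γ * bubbleDeriv γ r)
      = γ * (r ^ γ * bubble γ r) * ((1 - r ^ 2) / (1 + r ^ 2)) := by
  unfold bubble bubbleDeriv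
  rw [Real.rpow_sub hr, Real.rpow_one, Real.rpow_sub (one_add_sq_pos r), Real.rpow_one]
  have := one_add_sq_pos r
  field_simp
  ring

theorem calib_bubble (hγ : 0 < γ) {r : ℝ} (hr : 0 ≤ r) :
    calib γ (r ^ γ * bubble γ r) = γ * (r ^ γ * bubble γ r) * |(1 - r ^ 2) / (1 + r ^ 2)| := by
  have h0 : 0 ≤ r ^ γ * bubble γ r := by have := bubble_pos γ r; positivity
  have h1 : (r ^ γ * bubble γ r) ^ (2 / γ) = (r / (1 + r ^ 2)) ^ 2 := by
    rw [rpow_mul_bubble_eq hr, ← Real.rpow_mul (by positivity),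
      show γ * (2 / γ) = 2 by field_simp, Real.rpow_two]
  unfold calib
  rw [abs_of_nonneg h0, h1, ← Real.sqrt_sq_eq_abs]
  congr 2
  have := one_add_sq_pos r
  field_simp
  ring

/-- The calibration is exact along the extremal profile. -/
theorem calibration_bubble_eq (hγ : 0 < γ) {r ε : ℝ} (hr : 0 < r) (hε : ε ^ 2 = 1)
    (hεr : ε * |(1 - r ^ 2) / (1 + r ^ 2)| = (1 - r ^ 2) / (1 + r ^ 2)) :
    bubbleDeriv γ r ^ 2 * r ^ (2 * γ + 1)
        - 4 * γ ^ 2 * (|bubble γ r| ^ (2 + 2 / γ) * r ^ (2 * γ + 1))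
      = -(γ * (2 * (r ^ γ * bubble γ r) *
          (γ * r ^ (γ - 1) * bubble γ r + r ^ γ * bubbleDeriv γ r)))
        + 2 * ε * (calib γ (r ^ γ * bubble γ r) *
          (γ * r ^ (γ - 1) * bubble γ r + r ^ γ * bubbleDeriv γ r)) := by
  have h1 := calib_sq hγ (abs_rpow_mul_bubble_le hγ hr.le)
  have h2 : r * (γ * r ^ (γ - 1) * bubble γ r + r ^ γ * bubbleDeriv γ r)
      = ε * calib γ (r ^ γ * bubble γ r) := by
    rw [mul_deriv_rpow_mul_bubble hr, calib_bubble hγ hr.le]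
    nth_rewrite 1 [← hεr]
    ring
  rw [abs_rpow_mul_rpow_eq hγ hr, sq_mul_rpow_eq (y := bubble γ r) hr]
  generalize γ * r ^ (γ - 1) * bubble γ r + r ^ γ * bubbleDeriv γ r = w at *
  generalize r ^ γ * bubble γ r = v at *
  have h3 : w = ε * calib γ v / r := by rw [← h2]; field_simp
  have h4 : γ ^ 2 * v ^ 2 / r - 4 * γ ^ 2 * (|v| ^ (2 + 2 / γ) / r) = calib γ v ^ 2 / r := by
    rw [h1]; ring
  have h5 : r * w ^ 2 = calib γ v ^ 2 / r := by
    rw [h3]; field_simp; linear_combination calib γ v ^ 2 * hε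
  have h6 : ε * (calib γ v * w) = calib γ v ^ 2 / r := by
    rw [h3]; field_simp; linear_combination calib γ v ^ 2 * hε
  linarith

theorem continuous_bubble_energy (hγ : 0 < γ) :
    Continuous fun r => bubbleDeriv γ r ^ 2 * r ^ (2 * γ + 1) :=
  ((continuous_bubbleDeriv γ).pow 2).mul
    (continuous_id.rpow_const fun _ => Or.inr (by positivity))

theorem continuous_bubble_mass (hγ : 0 < γ) :
    Continuous fun r => |bubble γ r| ^ (2 + 2 / γ) * r ^ (2 * γ + 1) :=
  ((continuous_bubble γ).abs.rpow_const fun _ => Or.inr (by positivity)).mul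
    (continuous_id.rpow_const fun _ => Or.inr (by positivity))

theorem integral_bubble_eq (hγ : 0 < γ) {a b ε : ℝ} (ha : 0 ≤ a) (hab : a ≤ b) (hε : ε ^ 2 = 1)
    (hεr : ∀ r ∈ Set.Ioo a b,
      ε * |(1 - r ^ 2) / (1 + r ^ 2)| = (1 - r ^ 2) / (1 + r ^ 2)) :
    (∫ r in a..b, bubbleDeriv γ r ^ 2 * r ^ (2 * γ + 1))
        - 4 * γ ^ 2 * ∫ r in a..b, |bubble γ r| ^ (2 + 2 / γ) * r ^ (2 * γ + 1)
      = (-(γ * (b ^ γ * bubble γ b) ^ 2) + 2 * ε * calibPrim γ (b ^ γ * bubble γ b))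
        - (-(γ * (a ^ γ * bubble γ a) ^ 2) + 2 * ε * calibPrim γ (a ^ γ * bubble γ a)) := by
  have hm : Continuous fun r => 4 * γ ^ 2 * (|bubble γ r| ^ (2 + 2 / γ) * r ^ (2 * γ + 1)) :=
    continuous_const.mul (continuous_bubble_mass hγ)
  rw [← intervalIntegral.integral_const_mul, ← intervalIntegral.integral_sub
    ((continuous_bubble_energy hγ).intervalIntegrable _ _) (hm.intervalIntegrable _ _)]
  have hv : Continuous fun r => r ^ γ * bubble γ r :=
    (continuous_id.rpow_const fun _ => Or.inr hγ.le).mul (continuous_bubble γ)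
  have hP : Continuous (calibPrim γ) :=
    continuous_iff_continuousAt.2 fun y => (hasDerivAt_calibPrim hγ y).continuousAt
  refine intervalIntegral.integral_eq_sub_of_hasDerivAt_of_le hab
    (f := fun r => -(γ * (r ^ γ * bubble γ r) ^ 2) + 2 * ε * calibPrim γ (r ^ γ * bubble γ r))
    (Continuous.continuousOn ?_) (fun r hr => ?_)
    (((continuous_bubble_energy hγ).sub hm).intervalIntegrable _ _)
  · exact ((continuous_const.mul (hv.pow 2)).neg).add (continuous_const.mul (hP.comp hv))
  · have hr0 : 0 < r := ha.trans_lt hr.1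
    have h1 := hasDerivAt_rpow_mul (γ := γ) hr0 (hasDerivAt_bubble γ r)
    have h2 := ((h1.pow 2).const_mul γ).neg
    have h3 := ((hasDerivAt_calibPrim hγ _).comp r h1).const_mul (2 * ε)
    refine (h2.add h3).congr_deriv ?_
    rw [calibration_bubble_eq hγ hr0 hε (hεr r hr)]
    norm_num

/-- The energy of the extremal on `[0, R]`. -/
theorem integral_bubble_energy_eq (hγ : 0 < γ) {R : ℝ} (hR : 1 ≤ R) :
    (∫ r in (0 : ℝ)..R, bubbleDeriv γ r ^ 2 * r ^ (2 * γ + 1))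
        - 4 * γ ^ 2 * ∫ r in (0 : ℝ)..R, |bubble γ r| ^ (2 + 2 / γ) * r ^ (2 * γ + 1)
      = blissGap γ - γ * (R ^ γ * bubble γ R) ^ 2 - 2 * calibPrim γ (R ^ γ * bubble γ R) := by
  have h1 := integral_bubble_eq hγ (a := 0) (b := 1) (ε := 1) le_rfl zero_le_one (by norm_num)
    fun r hr => by
      rw [one_mul, abs_of_nonneg]
      exact div_nonneg (by nlinarith [hr.1, hr.2]) (one_add_sq_pos r).le
  have h2 := integral_bubble_eq hγ (a := 1) (b := R) (ε := -1) zero_le_one hR (by norm_num)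
    fun r hr => by
      rw [abs_of_nonpos, neg_one_mul, neg_neg]
      exact div_nonpos_of_nonpos_of_nonneg (by nlinarith [hr.1]) (one_add_sq_pos r).le
  have h3 : (1 : ℝ) ^ γ * bubble γ 1 = profileMax γ := by
    rw [Real.one_rpow, one_mul, bubble, profileMax]; norm_num
  rw [h3] at h1 h2
  rw [Real.zero_rpow hγ.ne', zero_mul, calibPrim_zero] at h1
  have ie := fun a b => (continuous_bubble_energy hγ).intervalIntegrable (μ := volume) a b
  have im := fun a b => (continuous_bubble_mass hγ).intervalIntegrable (μ := volume) a b
  rw [← intervalIntegral.integral_add_adjacent_intervals (ie 0 1) (ie 1 R),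
    ← intervalIntegral.integral_add_adjacent_intervals (im 0 1) (im 1 R)]
  unfold blissGap
  linarith

/-- The equation of the extremal, tested with the extremal itself. -/
theorem integral_bubble_energy_eq_mass (hγ : 0 < γ) {R : ℝ} (hR : 0 ≤ R) :
    (∫ r in (0 : ℝ)..R, bubbleDeriv γ r ^ 2 * r ^ (2 * γ + 1))
        - 4 * γ * (γ + 1) * ∫ r in (0 : ℝ)..R, |bubble γ r| ^ (2 + 2 / γ) * r ^ (2 * γ + 1)
      = -(2 * γ * (R ^ (2 * γ + 2) * (1 + R ^ 2) ^ (-(2 * γ) - 1))) := by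
  have hm : Continuous fun r =>
      4 * γ * (γ + 1) * (|bubble γ r| ^ (2 + 2 / γ) * r ^ (2 * γ + 1)) :=
    continuous_const.mul (continuous_bubble_mass hγ)
  rw [← intervalIntegral.integral_const_mul, ← intervalIntegral.integral_sub
    ((continuous_bubble_energy hγ).intervalIntegrable _ _) (hm.intervalIntegrable _ _)]
  refine (intervalIntegral.integral_eq_sub_of_hasDerivAt_of_le hR
    (f := fun r => -(2 * γ * (r ^ (2 * γ + 2) * (1 + r ^ 2) ^ (-(2 * γ) - 1))))
    (Continuous.continuousOn ?_) (fun r hr => ?_)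
    (((continuous_bubble_energy hγ).sub hm).intervalIntegrable _ _)).trans ?_
  rotate_left 2
  · simp [Real.zero_rpow (show 2 * γ + 2 ≠ 0 by positivity)]
  · have h1 : Continuous fun r : ℝ => r ^ (2 * γ + 2) :=
      continuous_id.rpow_const fun _ => Or.inr (by positivity)
    have h2 : Continuous fun r : ℝ => (1 + r ^ 2) ^ (-(2 * γ) - 1) :=
      Continuous.rpow_const (by fun_prop) fun r => Or.inl (one_add_sq_pos r).ne'
    fun_prop
  · have hr0 : 0 < r := hr.1
    have hp := one_add_sq_pos r
    have h1 : HasDerivAt (fun r : ℝ => 1 + r ^ 2) (2 * r) r := by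
      simpa using (hasDerivAt_pow 2 r).const_add 1
    have h2 := h1.rpow_const (p := -(2 * γ) - 1) (Or.inl hp.ne')
    have h3 := Real.hasDerivAt_rpow_const (x := r) (p := 2 * γ + 2) (Or.inl hr0.ne')
    refine (((h3.mul h2).const_mul (2 * γ)).neg).congr_deriv ?_
    have e1 : |bubble γ r| ^ (2 + 2 / γ) = (1 + r ^ 2) ^ (-(2 * γ) - 2) := by
      rw [abs_of_pos (bubble_pos γ r), bubble, ← Real.rpow_mul hp.le]
      congr 1
      field_simp
      ring
    have e2 : bubbleDeriv γ r ^ 2 = 4 * γ ^ 2 * r ^ 2 * (1 + r ^ 2) ^ (-(2 * γ) - 2) := by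
      unfold bubbleDeriv
      rw [neg_sq, mul_pow, ← Real.rpow_mul_natCast hp.le]
      push_cast
      rw [show (-γ - 1) * 2 = -(2 * γ) - 2 by ring]
      ring
    have e3 : (1 + r ^ 2) ^ (-(2 * γ) - 1) = (1 + r ^ 2) * (1 + r ^ 2) ^ (-(2 * γ) - 2) := by
      rw [show -(2 * γ) - 1 = 1 + (-(2 * γ) - 2) by ring, Real.rpow_add hp, Real.rpow_one]
    have e4 : r ^ (2 * γ + 2) = r * r ^ (2 * γ + 1) := by
      rw [show 2 * γ + 2 = 1 + (2 * γ + 1) by ring, Real.rpow_add hr0, Real.rpow_one]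
    simp only [Pi.sub_apply]
    rw [show 2 * γ + 2 - 1 = 2 * γ + 1 by ring, show -(2 * γ) - 1 - 1 = -(2 * γ) - 2 by ring,
      e1, e2, e3, e4]
    ring

theorem sq_rpow_mul_bubble_le {R : ℝ} (hγ : 0 < γ) (hR : 0 < R) :
    (R ^ γ * bubble γ R) ^ 2 ≤ R ^ (-(2 * γ)) := by
  have h0 : 0 < R ^ γ := Real.rpow_pos_of_pos hR γ
  have h1 := bubble_pos γ R
  have h2 : R ^ γ * bubble γ R ≤ R ^ (-γ) := by
    calc R ^ γ * bubble γ R ≤ R ^ γ * R ^ (-(2 * γ)) :=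
          mul_le_mul_of_nonneg_left (bubble_le_rpow hγ hR) h0.le
      _ = R ^ (-γ) := by rw [← Real.rpow_add hR]; congr 1; ring
  calc (R ^ γ * bubble γ R) ^ 2 ≤ (R ^ (-γ)) ^ 2 := by gcongr
    _ = R ^ (-(2 * γ)) := by
      rw [← Real.rpow_mul_natCast hR.le]; congr 1; push_cast; ring

theorem abs_integral_bubble_mass_sub_le (hγ : 0 < γ) {R : ℝ} (hR : 1 ≤ R) :
    |(∫ r in (0 : ℝ)..R, |bubble γ r| ^ (2 + 2 / γ) * r ^ (2 * γ + 1)) - blissMass γ|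
      ≤ R ^ (-(2 * γ)) := by
  have hR0 : 0 < R := by linarith
  have h1 := integral_bubble_energy_eq hγ hR
  have h2 := integral_bubble_energy_eq_mass hγ hR0.le
  have hv := sq_rpow_mul_bubble_le hγ hR0
  have hP := two_mul_calibPrim_le hγ (R ^ γ * bubble γ R)
  have hP0 : 0 ≤ calibPrim γ (R ^ γ * bubble γ R) :=
    calibPrim_nonneg hγ (by have := bubble_pos γ R; positivity)
  have hp := one_add_sq_pos R
  have h3 : R ^ (2 * γ + 2) * (1 + R ^ 2) ^ (-(2 * γ) - 1) ≤ R ^ (-(2 * γ)) := by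
    calc R ^ (2 * γ + 2) * (1 + R ^ 2) ^ (-(2 * γ) - 1)
        ≤ R ^ (2 * γ + 2) * (R ^ 2) ^ (-(2 * γ) - 1) := by
          gcongr ?_ * ?_
          exact Real.rpow_le_rpow_of_nonpos (by positivity) (by linarith) (by linarith)
      _ = R ^ (-(2 * γ)) := by
        rw [← Real.rpow_two, ← Real.rpow_mul hR0.le, ← Real.rpow_add hR0]
        congr 1
        ring
  have h4 : 0 ≤ R ^ (2 * γ + 2) * (1 + R ^ 2) ^ (-(2 * γ) - 1) := by positivity
  have hE : blissGap γ = 4 * γ * blissMass γ := by unfold blissMass; field_simp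
  rw [hE] at h1
  generalize (∫ r in (0 : ℝ)..R, |bubble γ r| ^ (2 + 2 / γ) * r ^ (2 * γ + 1)) = B at *
  generalize (∫ r in (0 : ℝ)..R, bubbleDeriv γ r ^ 2 * r ^ (2 * γ + 1)) = A at *
  generalize R ^ (2 * γ + 2) * (1 + R ^ 2) ^ (-(2 * γ) - 1) = y at *
  generalize (R ^ γ * bubble γ R) ^ 2 = z at *
  have key : 4 * γ * (B - blissMass γ)
      = 2 * γ * y - γ * z - 2 * calibPrim γ (R ^ γ * bubble γ R) := by linarith
  have hz : γ * z ≤ γ * R ^ (-(2 * γ)) := mul_le_mul_of_nonneg_left hv hγ.le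
  have hy : γ * y ≤ γ * R ^ (-(2 * γ)) := mul_le_mul_of_nonneg_left h3 hγ.le
  have hy0 : 0 ≤ γ * y := mul_nonneg hγ.le h4
  have hz0 : 0 ≤ γ * z := by linarith
  have hw : 0 ≤ γ * R ^ (-(2 * γ)) := by positivity
  rw [abs_le]
  constructor
  · rw [← mul_le_mul_iff_right₀ (show 0 < 4 * γ by positivity)]
    linarith
  · rw [← mul_le_mul_iff_right₀ (show 0 < 4 * γ by positivity)]
    linarith

theorem integral_bubble_energy_le (hγ : 0 < γ) {R : ℝ} (hR : 1 ≤ R) :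
    ∫ r in (0 : ℝ)..R, bubbleDeriv γ r ^ 2 * r ^ (2 * γ + 1)
      ≤ 4 * γ * (γ + 1) * blissMass γ + 4 * γ ^ 2 * R ^ (-(2 * γ)) := by
  have h1 := integral_bubble_energy_eq hγ hR
  have h2 := (abs_le.1 (abs_integral_bubble_mass_sub_le hγ hR)).2
  have hP0 : 0 ≤ calibPrim γ (R ^ γ * bubble γ R) :=
    calibPrim_nonneg hγ (by have := bubble_pos γ R; positivity)
  have hE : blissGap γ = 4 * γ * blissMass γ := by unfold blissMass; field_simp
  have h3 : 0 ≤ γ * (R ^ γ * bubble γ R) ^ 2 := by positivity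
  have h4 := mul_le_mul_of_nonneg_left h2 (show 0 ≤ 4 * γ ^ 2 by positivity)
  linarith

theorem rpow_sub_le_sub_rpow {x c q : ℝ} (hx : 0 < x) (hcx : c ≤ x) (hq : 1 ≤ q) :
    x ^ q - q * c * x ^ (q - 1) ≤ (x - c) ^ q := by
  have h := one_add_mul_self_le_rpow_one_add (s := -(c / x)) (p := q)
    (neg_le_neg ((div_le_one hx).2 hcx)) hq
  have h2 := mul_le_mul_of_nonneg_left h (Real.rpow_nonneg hx.le q)
  rw [← Real.mul_rpow hx.le (by rw [← sub_eq_add_neg, sub_nonneg]; exact (div_le_one hx).2 hcx)]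
    at h2
  have e1 : x * (1 + -(c / x)) = x - c := by field_simp; ring
  have e2 : x ^ q * (1 + q * -(c / x)) = x ^ q - q * c * x ^ (q - 1) := by
    rw [Real.rpow_sub_one hx.ne']; field_simp; ring
  rwa [e1, e2] at h2

theorem integral_bubble_subcritical_le (hγ : 0 < γ) {R : ℝ} (hR : 0 ≤ R) :
    ∫ r in (0 : ℝ)..R, bubble γ r ^ (1 + 2 / γ) * r ^ (2 * γ + 1) ≤ 1 / 2 := by
  have hd : ∀ r : ℝ, HasDerivAt (fun r : ℝ => -(1 / 2 * (1 + r ^ 2)⁻¹))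
      (r * ((1 + r ^ 2) ^ 2)⁻¹) r := fun r => by
    have h1 : HasDerivAt (fun r : ℝ => 1 + r ^ 2) (2 * r) r := by
      simpa using (hasDerivAt_pow 2 r).const_add 1
    refine (((h1.inv (one_add_sq_pos r).ne').const_mul (1 / 2)).neg).congr_deriv ?_
    field_simp
  have hc : Continuous fun r : ℝ => r * ((1 + r ^ 2) ^ 2)⁻¹ :=
    continuous_id.mul (Continuous.inv₀ (by fun_prop) fun r => (pow_pos (one_add_sq_pos r) 2).ne')
  have hcb : Continuous fun r : ℝ => bubble γ r ^ (1 + 2 / γ) * r ^ (2 * γ + 1) :=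
    ((continuous_bubble γ).rpow_const fun r => Or.inl (bubble_pos γ r).ne').mul
      (continuous_id.rpow_const fun _ => Or.inr (by positivity))
  calc ∫ r in (0 : ℝ)..R, bubble γ r ^ (1 + 2 / γ) * r ^ (2 * γ + 1)
      ≤ ∫ r in (0 : ℝ)..R, r * ((1 + r ^ 2) ^ 2)⁻¹ := by
        refine intervalIntegral.integral_mono_on hR (hcb.intervalIntegrable _ _)
          (hc.intervalIntegrable _ _) fun r hr => ?_
        have hp := one_add_sq_pos r
        have e1 : bubble γ r ^ (1 + 2 / γ) = (1 + r ^ 2) ^ (-γ) * ((1 + r ^ 2) ^ 2)⁻¹ := by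
          rw [bubble, ← Real.rpow_mul hp.le, ← Real.rpow_natCast (1 + r ^ 2) 2,
            ← Real.rpow_neg hp.le, ← Real.rpow_add hp]
          congr 1
          push_cast
          field_simp
          ring
        have e2 : r ^ (2 * γ + 1) = (r ^ 2) ^ γ * r := by
          rw [Real.rpow_add_one' hr.1 (by positivity), Real.rpow_mul hr.1, Real.rpow_two]
        have e3 : (r ^ 2) ^ γ * (1 + r ^ 2) ^ (-γ) ≤ 1 := by
          rw [Real.rpow_neg hp.le, ← div_eq_mul_inv, ← Real.div_rpow (sq_nonneg r) hp.le]
          exact Real.rpow_le_one (by positivity) ((div_le_one hp).2 (by linarith)) hγ.le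
        rw [e1, e2]
        calc (1 + r ^ 2) ^ (-γ) * ((1 + r ^ 2) ^ 2)⁻¹ * ((r ^ 2) ^ γ * r)
            = ((r ^ 2) ^ γ * (1 + r ^ 2) ^ (-γ)) * (r * ((1 + r ^ 2) ^ 2)⁻¹) := by ring
          _ ≤ 1 * (r * ((1 + r ^ 2) ^ 2)⁻¹) := by
            have := hr.1
            gcongr
          _ = _ := one_mul _
    _ = -(1 / 2 * (1 + R ^ 2)⁻¹) - -(1 / 2 * (1 + (0 : ℝ) ^ 2)⁻¹) :=
        intervalIntegral.integral_eq_sub_of_hasDerivAt (fun r _ => hd r)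
          (hc.intervalIntegrable _ _)
    _ ≤ 1 / 2 := by
        have : 0 < (1 + R ^ 2)⁻¹ := inv_pos.2 (one_add_sq_pos R)
        have h0 : (1 + (0 : ℝ) ^ 2)⁻¹ = 1 := by norm_num
        rw [h0]
        linarith

/-- Truncating the extremal at radius `R` costs mass of order `R^(-2γ)`. -/
theorem le_integral_truncated_bubble (hγ : 0 < γ) {R : ℝ} (hR : 1 ≤ R) :
    blissMass γ - (3 + 2 / γ) * R ^ (-(2 * γ))
      ≤ ∫ r in (0 : ℝ)..R, (bubble γ r - bubble γ R) ^ (2 + 2 / γ) * r ^ (2 * γ + 1) := by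
  have hR0 : 0 < R := by linarith
  have hcs : Continuous fun r : ℝ => bubble γ r ^ (1 + 2 / γ) * r ^ (2 * γ + 1) :=
    ((continuous_bubble γ).rpow_const fun r => Or.inl (bubble_pos γ r).ne').mul
      (continuous_id.rpow_const fun _ => Or.inr (by positivity))
  have hct : Continuous fun r : ℝ =>
      (bubble γ r - bubble γ R) ^ (2 + 2 / γ) * r ^ (2 * γ + 1) :=
    (((continuous_bubble γ).sub continuous_const).rpow_const fun r => Or.inr (by positivity)).mul
      (continuous_id.rpow_const fun _ => Or.inr (by positivity))
  have hm := continuous_bubble_mass hγ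
  have hcs' : Continuous fun r : ℝ =>
      (2 + 2 / γ) * bubble γ R * (bubble γ r ^ (1 + 2 / γ) * r ^ (2 * γ + 1)) :=
    continuous_const.mul hcs
  have h1 : (∫ r in (0 : ℝ)..R, |bubble γ r| ^ (2 + 2 / γ) * r ^ (2 * γ + 1))
      - (2 + 2 / γ) * bubble γ R * ∫ r in (0 : ℝ)..R, bubble γ r ^ (1 + 2 / γ) * r ^ (2 * γ + 1)
      ≤ ∫ r in (0 : ℝ)..R, (bubble γ r - bubble γ R) ^ (2 + 2 / γ) * r ^ (2 * γ + 1) := by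
    rw [← intervalIntegral.integral_const_mul, ← intervalIntegral.integral_sub
      (hm.intervalIntegrable _ _) (hcs'.intervalIntegrable _ _)]
    refine intervalIntegral.integral_mono_on hR0.le ((hm.sub hcs').intervalIntegrable _ _)
      (hct.intervalIntegrable _ _) fun r hr => ?_
    have h := rpow_sub_le_sub_rpow (bubble_pos γ r)
      (bubble_antitoneOn hγ hr.1 hr.2) (q := 2 + 2 / γ)
      (by have : 0 < 2 / γ := by positivity
          linarith)
    rw [show 2 + 2 / γ - 1 = 1 + 2 / γ by ring] at h
    rw [abs_of_pos (bubble_pos γ r)]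
    have h2 := mul_le_mul_of_nonneg_right h (Real.rpow_nonneg hr.1 (2 * γ + 1))
    linarith
  have h2 := (abs_le.1 (abs_integral_bubble_mass_sub_le hγ hR)).1
  have h3 : (2 + 2 / γ) * bubble γ R
        * ∫ r in (0 : ℝ)..R, bubble γ r ^ (1 + 2 / γ) * r ^ (2 * γ + 1)
      ≤ (2 + 2 / γ) * R ^ (-(2 * γ)) * (1 / 2) := by
    have := bubble_pos γ R
    have h4 : 0 ≤ ∫ r in (0 : ℝ)..R, bubble γ r ^ (1 + 2 / γ) * r ^ (2 * γ + 1) :=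
      intervalIntegral.integral_nonneg hR0.le fun r hr =>
        mul_nonneg (Real.rpow_nonneg (bubble_pos γ r).le _) (Real.rpow_nonneg hr.1 _)
    gcongr
    · exact bubble_le_rpow hγ hR0
    · exact integral_bubble_subcritical_le hγ hR0.le
  have h5 : 0 ≤ (2 + 2 / γ) * R ^ (-(2 * γ)) := by positivity
  linarith

end Bubble

/-! ### Radial mollification -/

section Mollification

variable {N : ℕ}

/-- An unnormalized smooth radial bump supported in the closed unit ball. -/
noncomputable def radialBump (N : ℕ) (x : Space N) : ℝ := expNegInvGlue (1 - ‖x‖ ^ 2)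

/-- The radial mollifier at scale `δ`. -/
noncomputable def mollifier (N : ℕ) (δ : ℝ) (x : Space N) : ℝ :=
  (δ ^ N * ∫ y, radialBump N y)⁻¹ * radialBump N (δ⁻¹ • x)

/-- The mollification of `u` by the kernel `ρ`. -/
noncomputable def mollify {F : Type*} [NormedAddCommGroup F] [NormedSpace ℝ F]
    (ρ : Space N → ℝ) (u : Space N → F) (x : Space N) : F := ∫ y, ρ (x - y) • u y

theorem contDiff_radialBump : ContDiff ℝ ∞ (radialBump N) :=
  expNegInvGlue.contDiff.comp (contDiff_const.sub (contDiff_norm_sq ℝ))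

theorem radialBump_nonneg (x : Space N) : 0 ≤ radialBump N x := expNegInvGlue.nonneg _

theorem radialBump_eq_zero {x : Space N} (hx : 1 ≤ ‖x‖) : radialBump N x = 0 :=
  expNegInvGlue.zero_of_nonpos (by nlinarith)

theorem radialBump_le_one (x : Space N) : radialBump N x ≤ 1 := by
  unfold radialBump expNegInvGlue
  split_ifs with h
  · exact zero_le_one
  · rw [Real.exp_le_one_iff]
    have : 0 ≤ (1 - ‖x‖ ^ 2)⁻¹ := inv_nonneg.2 (not_le.1 h).le
    linarith

theorem hasCompactSupport_radialBump : HasCompactSupport (radialBump N) :=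
  HasCompactSupport.of_support_subset_isCompact (isCompact_closedBall (0 : Space N) 1)
    fun x hx => by
      rw [mem_closedBall_zero_iff]
      by_contra h
      exact hx (radialBump_eq_zero (not_le.1 h).le)

theorem integral_radialBump_pos : 0 < ∫ x, radialBump N x := by
  refine Continuous.integral_pos_of_hasCompactSupport_nonneg_nonzero
    contDiff_radialBump.continuous hasCompactSupport_radialBump radialBump_nonneg (x := 0) ?_
  have : 0 < radialBump N 0 := expNegInvGlue.pos_of_pos (by simp)
  exact this.ne'

variable {δ : ℝ}

theorem contDiff_mollifier : ContDiff ℝ ∞ (mollifier N δ) :=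
  contDiff_const.mul (contDiff_radialBump.comp (contDiff_const_smul _))

theorem mollifier_nonneg (hδ : 0 < δ) (x : Space N) : 0 ≤ mollifier N δ x := by
  have h1 := integral_radialBump_pos (N := N)
  have h2 := radialBump_nonneg (δ⁻¹ • x)
  exact mul_nonneg (inv_nonneg.2 (mul_nonneg (pow_nonneg hδ.le N) h1.le)) h2

theorem mollifier_eq_zero (hδ : 0 < δ) {x : Space N} (hx : δ ≤ ‖x‖) : mollifier N δ x = 0 := by
  unfold mollifier
  rw [radialBump_eq_zero, mul_zero]
  rw [norm_smul, norm_inv, Real.norm_of_nonneg hδ.le, ← div_eq_inv_mul, le_div_iff₀ hδ, one_mul]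
  exact hx

theorem hasCompactSupport_mollifier (hδ : 0 < δ) : HasCompactSupport (mollifier N δ) :=
  HasCompactSupport.of_support_subset_isCompact (isCompact_closedBall (0 : Space N) δ)
    fun x hx => by
      rw [mem_closedBall_zero_iff]
      by_contra h
      exact hx (mollifier_eq_zero hδ (not_le.1 h).le)

theorem mollifier_comp_isometry (O : Space N ≃ₗᵢ[ℝ] Space N) (x : Space N) :
    mollifier N δ (O x) = mollifier N δ x := by
  unfold mollifier radialBump
  rw [norm_smul, norm_smul, O.norm_map]

theorem integral_mollifier (hδ : 0 < δ) : ∫ x, mollifier N δ x = 1 := by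
  unfold mollifier
  rw [integral_const_mul, integral_comp_dilation (inv_pos.2 hδ) (f := radialBump N)
    (fun _ => rfl), smul_eq_mul, Real.inv_rpow hδ.le, Real.rpow_neg hδ.le, inv_inv,
    Real.rpow_natCast]
  have h1 := (integral_radialBump_pos (N := N)).ne'
  field_simp

theorem integral_mollifier_sub (hδ : 0 < δ) (x : Space N) :
    ∫ y, mollifier N δ (x - y) = 1 := by
  rw [integral_sub_left_eq_self (mollifier N δ) volume x, integral_mollifier hδ]

theorem tendsto_mollify_ae {F : Type*} [NormedAddCommGroup F] [NormedSpace ℝ F] [CompleteSpace F]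
    {u : Space N → F} (hu : LocallyIntegrable u volume) {ε : ℕ → ℝ} (hε : ∀ n, 0 < ε n)
    (hε0 : Filter.Tendsto ε Filter.atTop (nhds 0)) :
    ∀ᵐ x, Filter.Tendsto (fun n => mollify (mollifier N (ε n)) u x) Filter.atTop (nhds (u x)) := by
  filter_upwards [(Besicovitch.vitaliFamily volume).ae_tendsto_average_norm_sub hu] with x hx
  have hε' : Filter.Tendsto ε Filter.atTop (nhdsWithin 0 (Set.Ioi 0)) :=
    tendsto_nhdsWithin_iff.2 ⟨hε0, Filter.Eventually.of_forall hε⟩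
  have h := (hx.comp (Besicovitch.tendsto_filterAt volume x)).comp hε'
  refine tendsto_integral_smul_of_tendsto_average_norm_sub
    (volume.real (Metric.ball (0 : Space N) 1) / ∫ y, radialBump N y) h ?_ ?_ ?_ ?_
  · exact Filter.Eventually.of_forall fun n => hu.integrableOn_isCompact (isCompact_closedBall _ _)
  · exact tendsto_const_nhds.congr fun n => (integral_mollifier_sub (hε n) x).symm
  · refine Filter.Eventually.of_forall fun n y hy => ?_
    rw [Metric.mem_closedBall, dist_comm, dist_eq_norm]
    by_contra hlt
    exact hy (mollifier_eq_zero (hε n) (not_le.1 hlt).le)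
  · refine Filter.Eventually.of_forall fun n y => ?_
    have h1 := integral_radialBump_pos (N := N)
    have h2 : 0 < volume.real (Metric.ball (0 : Space N) 1) :=
      ENNReal.toReal_pos (Metric.measure_ball_pos _ _ one_pos).ne' measure_ball_lt_top.ne
    rw [abs_of_nonneg (mollifier_nonneg (hε n) _)]
    have h3 : volume.real (Metric.closedBall x (ε n))
        = ε n ^ N * volume.real (Metric.ball (0 : Space N) 1) := by
      have := Measure.addHaar_real_closedBall (volume : Measure (Space N)) x (hε n).le
      rwa [finrank_euclideanSpace_fin] at this
    have e : volume.real (Metric.ball (0 : Space N) 1) / (∫ y, radialBump N y)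
        / volume.real (Metric.closedBall x (ε n)) = (ε n ^ N * ∫ y, radialBump N y)⁻¹ * 1 := by
      rw [h3]
      have := (pow_pos (hε n) N).ne'
      field_simp
    rw [e]
    have hp := pow_pos (hε n) N
    exact mul_le_mul_of_nonneg_left (radialBump_le_one _) (by positivity)

/-- Averaging does not increase Lebesgue norms, by Jensen's inequality. -/
theorem lintegral_enorm_mollify_rpow_le {F : Type*} [NormedAddCommGroup F] [NormedSpace ℝ F]
    {ρ : Space N → ℝ} (hρc : Continuous ρ) (hρ0 : ∀ x, 0 ≤ ρ x) (hρ1 : ∫ x, ρ x = 1)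
    {q : ℝ} (hq : 1 ≤ q) {u : Space N → F} (hu : AEStronglyMeasurable u volume) :
    ∫⁻ x, ‖mollify ρ u x‖ₑ ^ q ≤ ∫⁻ x, ‖u x‖ₑ ^ q := by
  have hq0 : 0 < q := by linarith
  have hm : Measurable fun z : Space N × Space N => ENNReal.ofReal (ρ (z.1 - z.2)) :=
    (ENNReal.continuous_ofReal.comp (hρc.comp (continuous_fst.sub continuous_snd))).measurable
  have hint : Integrable ρ volume := by
    by_contra h
    rw [integral_undef h] at hρ1
    exact zero_ne_one hρ1
  have hone : ∫⁻ y, ENNReal.ofReal (ρ y) = 1 := by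
    rw [← ofReal_integral_eq_lintegral_ofReal hint (Filter.Eventually.of_forall hρ0), hρ1,
      ENNReal.ofReal_one]
  have hpt : ∀ x, ‖mollify ρ u x‖ₑ ^ q
      ≤ ∫⁻ y, ENNReal.ofReal (ρ (x - y)) * ‖u y‖ₑ ^ q := by
    intro x
    have hmx : Measurable fun y => ENNReal.ofReal (ρ (x - y)) :=
      (ENNReal.continuous_ofReal.comp (hρc.comp (continuous_const.sub continuous_id))).measurable
    let ν : Measure (Space N) := volume.withDensity fun y => ENNReal.ofReal (ρ (x - y))
    have hac : ν ≪ volume := withDensity_absolutelyContinuous _ _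
    have : IsProbabilityMeasure ν := ⟨by
      rw [withDensity_apply _ MeasurableSet.univ, Measure.restrict_univ,
        lintegral_sub_left_eq_self (fun y => ENNReal.ofReal (ρ y)) x, hone]⟩
    have hJ := eLpNorm'_le_eLpNorm'_of_exponent_le zero_lt_one hq ν (hu.mono_ac hac)
    rw [eLpNorm'_eq_lintegral_enorm, eLpNorm'_eq_lintegral_enorm] at hJ
    simp only [ENNReal.rpow_one, div_one] at hJ
    have hJ2 := ENNReal.rpow_le_rpow hJ hq0.le
    rw [← ENNReal.rpow_mul, one_div, inv_mul_cancel₀ hq0.ne', ENNReal.rpow_one] at hJ2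
    rw [lintegral_withDensity_eq_lintegral_mul₀ hmx.aemeasurable hu.enorm,
      lintegral_withDensity_eq_lintegral_mul₀ hmx.aemeasurable (hu.enorm.pow_const q)] at hJ2
    refine le_trans (ENNReal.rpow_le_rpow ?_ hq0.le) hJ2
    refine (enorm_integral_le_lintegral_enorm _).trans_eq (lintegral_congr fun y => ?_)
    rw [enorm_smul, Pi.mul_apply, Real.enorm_of_nonneg (hρ0 _)]
  calc ∫⁻ x, ‖mollify ρ u x‖ₑ ^ q
      ≤ ∫⁻ x, ∫⁻ y, ENNReal.ofReal (ρ (x - y)) * ‖u y‖ₑ ^ q := lintegral_mono hpt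
    _ = ∫⁻ y, ∫⁻ x, ENNReal.ofReal (ρ (x - y)) * ‖u y‖ₑ ^ q :=
        lintegral_lintegral_swap (hm.aemeasurable.mul (hu.enorm.pow_const q).comp_snd)
    _ = ∫⁻ y, ‖u y‖ₑ ^ q := by
        refine lintegral_congr fun y => ?_
        have hmy : Measurable fun x => ENNReal.ofReal (ρ (x - y)) :=
          (ENNReal.continuous_ofReal.comp
            (hρc.comp (continuous_id.sub continuous_const))).measurable
        rw [lintegral_mul_const _ hmy,
          lintegral_sub_right_eq_self (fun x => ENNReal.ofReal (ρ x)) y, hone, one_mul]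

theorem mollify_congr_ae {F : Type*} [NormedAddCommGroup F] [NormedSpace ℝ F]
    {ρ : Space N → ℝ} {u v : Space N → F} (h : u =ᵐ[volume] v) (x : Space N) :
    mollify ρ u x = mollify ρ v x := by
  refine integral_congr_ae ?_
  filter_upwards [h] with y hy
  rw [hy]

theorem mollify_radial {u : Space N → ℝ} (hu : IsRadial N u) {x y : Space N} (hxy : ‖x‖ = ‖y‖) :
    mollify (mollifier N δ) u x = mollify (mollifier N δ) u y := by
  obtain ⟨f, hf⟩ := hu
  rw [mollify_congr_ae hf, mollify_congr_ae hf]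
  let O : Space N ≃ₗᵢ[ℝ] Space N := (Submodule.span ℝ {x - y})ᗮ.reflection
  have hO : O x = y := Submodule.reflection_sub hxy
  unfold mollify
  rw [← O.measurePreserving.integral_comp O.toHomeomorph.measurableEmbedding
    (fun z => mollifier N δ (y - z) • f ‖z‖)]
  refine integral_congr_ae (Filter.Eventually.of_forall fun z => ?_)
  simp only []
  rw [O.norm_map, ← hO, ← map_sub, mollifier_comp_isometry]

theorem mollify_eq_convolution (ρ : Space N → ℝ) (u : Space N → ℝ) :
    mollify ρ u = convolution ρ u (ContinuousLinearMap.lsmul ℝ ℝ) volume := by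
  funext x
  rw [convolution_eq_swap]
  rfl

theorem contDiff_mollify (hδ : 0 < δ) {u : Space N → ℝ} (hu : LocallyIntegrable u volume) :
    ContDiff ℝ 1 (mollify (mollifier N δ) u) := by
  rw [mollify_eq_convolution]
  exact (hasCompactSupport_mollifier hδ).contDiff_convolution_left _
    (n := 1) (contDiff_mollifier.of_le (by exact_mod_cast le_top)) hu

/-- Mollification commutes with the weak gradient. -/
theorem HasWeakGradient.gradient_mollify (hδ : 0 < δ) {u : Space N → ℝ} {g : Space N → Space N}
    (h : HasWeakGradient N u g) (x : Space N) :
    gradient (mollify (mollifier N δ) u) x = mollify (mollifier N δ) g x := by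
  have hρ : ContDiff ℝ ∞ (mollifier N δ) := contDiff_mollifier
  have hρc := hasCompactSupport_mollifier (N := N) hδ
  have hφ : ContDiff ℝ ∞ fun y => mollifier N δ (x - y) :=
    hρ.comp (contDiff_const.sub contDiff_id)
  have hφc : HasCompactSupport fun y => mollifier N δ (x - y) :=
    hρc.comp_homeomorph (Homeomorph.subLeft x)
  have h1 := h.2.2 _ hφ hφc
  have hgrad : ∀ y, gradient (fun y => mollifier N δ (x - y)) y
      = - gradient (mollifier N δ) (x - y) := fun y => by
    have hd := (hρ.differentiable (by simp) (x - y)).hasFDerivAt.comp y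
      ((hasFDerivAt_id y).const_sub x)
    unfold gradient
    rw [← map_neg]
    refine congrArg (InnerProductSpace.toDual ℝ (Space N)).symm (hd.fderiv.trans ?_)
    ext v
    simp
  have h2 : mollify (mollifier N δ) g x = ∫ y, u y • gradient (mollifier N δ) (x - y) := by
    have h3 : ∀ y, u y • gradient (fun y => mollifier N δ (x - y)) y
        = -(u y • gradient (mollifier N δ) (x - y)) := fun y => by rw [hgrad, smul_neg]
    rw [funext h3, integral_neg] at h1
    exact (neg_injective h1).symm
  have h4 := hρc.hasFDerivAt_convolution_left (ContinuousLinearMap.lsmul ℝ ℝ)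
    (hρ.of_le (by exact_mod_cast le_top)) h.1 x
  rw [← mollify_eq_convolution] at h4
  rw [h2, gradient, h4.fderiv, convolution_eq_swap]
  rw [← LinearIsometryEquiv.coe_toContinuousLinearEquiv, ← ContinuousLinearEquiv.integral_comp_comm]
  refine integral_congr_ae (Filter.Eventually.of_forall fun y => ?_)
  simp only [gradient]
  rw [← map_smul]
  refine congrArg (InnerProductSpace.toDual ℝ (Space N)).symm (ContinuousLinearMap.ext fun v => ?_)
  simp [mul_comm]

end Mollification

/-! ### The sharp radial Sobolev inequality -/

section Sobolev

variable {γ : ℝ}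

/-- If the mass is finite, then `r^γ f` is small at arbitrarily large radii: otherwise the mass
density dominates a multiple of `1/r`. -/
theorem frequently_sq_lt {f : ℝ → ℝ} (hγ : 0 < γ)
    (hX : IntegrableOn (fun r => |f r| ^ (2 + 2 / γ) * r ^ (2 * γ + 1)) (Set.Ioi 0))
    {ε : ℝ} (hε : 0 < ε) : ∃ᶠ b in Filter.atTop, (b ^ γ * f b) ^ 2 < ε := by
  by_contra h
  rw [Filter.not_frequently] at h
  obtain ⟨b₀, hb₀⟩ := Filter.eventually_atTop.1 (h.and (Filter.eventually_gt_atTop (0 : ℝ)))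
  have hb0 : 0 < b₀ := (hb₀ b₀ le_rfl).2
  refine not_integrableOn_Ioi_inv (a := b₀) ?_
  have h1 := (hX.mono_set (Set.Ioi_subset_Ioi hb0.le)).const_mul (ε ^ (1 + 1 / γ))⁻¹
  refine h1.mono' measurable_inv.aestronglyMeasurable ?_
  refine (ae_restrict_iff' measurableSet_Ioi).2 (Filter.Eventually.of_forall fun b hb => ?_)
  obtain ⟨h2, h3⟩ := hb₀ b (le_of_lt hb)
  have hp : 0 < ε ^ (1 + 1 / γ) := Real.rpow_pos_of_pos hε _
  rw [Real.norm_of_nonneg (inv_nonneg.2 h3.le), abs_rpow_mul_rpow_eq hγ h3, ← div_eq_inv_mul,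
    le_div_iff₀ hp, inv_mul_eq_div]
  gcongr
  have e : |b ^ γ * f b| ^ (2 + 2 / γ) = ((b ^ γ * f b) ^ 2) ^ (1 + 1 / γ) := by
    rw [← sq_abs, ← Real.rpow_two, ← Real.rpow_mul (abs_nonneg _)]
    congr 1
    ring
  rw [e]
  exact Real.rpow_le_rpow hε.le (not_lt.1 h2) (by positivity)

/-- Bliss' inequality on the half-line. -/
theorem bliss_inequality_Ioi {f f' : ℝ → ℝ} (hγ : 0 < γ) (hf : ∀ r, HasDerivAt f (f' r) r)
    (hf' : Continuous f')
    (hD : IntegrableOn (fun r => f' r ^ 2 * r ^ (2 * γ + 1)) (Set.Ioi 0))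
    (hX : IntegrableOn (fun r => |f r| ^ (2 + 2 / γ) * r ^ (2 * γ + 1)) (Set.Ioi 0)) :
    blissConst γ * (∫ r in Set.Ioi 0, |f r| ^ (2 + 2 / γ) * r ^ (2 * γ + 1)) ^ (γ / (γ + 1))
      ≤ ∫ r in Set.Ioi 0, f' r ^ 2 * r ^ (2 * γ + 1) := by
  have hfc : Continuous f := continuous_iff_continuousAt.2 fun r => (hf r).continuousAt
  have hm : Continuous fun r => |f r| ^ (2 + 2 / γ) * r ^ (2 * γ + 1) :=
    (hfc.abs.rpow_const fun _ => Or.inr (by positivity)).mul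
      (continuous_id.rpow_const fun _ => Or.inr (by positivity))
  have hθ : 0 < γ / (γ + 1) := by positivity
  have h1 : ∀ b, 0 < b →
      blissConst γ * (∫ r in (0 : ℝ)..b, |f r| ^ (2 + 2 / γ) * r ^ (2 * γ + 1)) ^ (γ / (γ + 1))
        ≤ (∫ r in Set.Ioi 0, f' r ^ 2 * r ^ (2 * γ + 1)) + 2 * γ * (b ^ γ * f b) ^ 2 := by
    intro b hb
    have hc : Continuous fun a =>
        ∫ r in a..b, |f r| ^ (2 + 2 / γ) * r ^ (2 * γ + 1) := by
      have := (intervalIntegral.continuous_primitive (μ := volume)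
        (fun a b => hm.intervalIntegrable a b) b).neg
      refine this.congr fun a => ?_
      rw [Pi.neg_apply, intervalIntegral.integral_symm, neg_neg]
    have ht : Filter.Tendsto (fun a => blissConst γ *
        (∫ r in a..b, |f r| ^ (2 + 2 / γ) * r ^ (2 * γ + 1)) ^ (γ / (γ + 1)))
        (nhdsWithin 0 (Set.Ioi 0)) (nhds (blissConst γ *
        (∫ r in (0 : ℝ)..b, |f r| ^ (2 + 2 / γ) * r ^ (2 * γ + 1)) ^ (γ / (γ + 1)))) :=
      ((continuous_const.mul (hc.rpow_const fun _ => Or.inr hθ.le)).tendsto 0).mono_left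
        nhdsWithin_le_nhds
    refine le_of_tendsto ht ?_
    filter_upwards [Ioc_mem_nhdsGT hb] with a ha
    refine (bliss_inequality hγ ha.1 ha.2 (fun r _ => hf r) hf'.continuousOn).trans ?_
    gcongr
    rw [intervalIntegral.integral_of_le ha.2]
    refine setIntegral_mono_set hD ?_ ?_
    · refine (ae_restrict_iff' measurableSet_Ioi).2 (Filter.Eventually.of_forall fun r hr => ?_)
      exact mul_nonneg (sq_nonneg _) (Real.rpow_nonneg (le_of_lt hr) _)
    · exact Filter.Eventually.of_forall fun r hr => ha.1.trans hr.1
  have ht := (Real.continuous_rpow_const hθ.le).continuousAt.tendsto.comp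
    (intervalIntegral_tendsto_integral_Ioi 0 hX Filter.tendsto_id)
  have ht2 := ht.const_mul (blissConst γ)
  refine le_of_forall_pos_le_add fun ε hε => ?_
  have hf2 := (frequently_sq_lt hγ hX (ε := ε / (2 * γ)) (by positivity)).and_eventually
    (Filter.eventually_gt_atTop (0 : ℝ))
  refine le_of_tendsto_of_frequently ht2 (hf2.mono fun b hb => ?_)
  refine (h1 b hb.2).trans ?_
  gcongr
  have := hb.1.le
  rw [le_div_iff₀ (by positivity)] at this
  linarith

variable {N : ℕ}

/-- The area of the unit sphere of `ℝ^N`. -/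
noncomputable def sphereArea (N : ℕ) : ℝ := N * volume.real (Metric.ball (0 : Space N) 1)

/-- The exponent `(N-2)/2`. -/
noncomputable def gam (N : ℕ) : ℝ := ((N : ℝ) - 2) / 2

theorem gam_pos (hN : 3 ≤ N) : 0 < gam N := by
  have : (3 : ℝ) ≤ N := by exact_mod_cast hN
  unfold gam
  linarith

theorem twoStar_eq (hN : 3 ≤ N) : twoStar N = 2 + 2 / gam N := by
  have : (3 : ℝ) ≤ N := by exact_mod_cast hN
  have h : (N : ℝ) - 2 ≠ 0 := by linarith
  unfold twoStar gam
  field_simp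
  ring

theorem twoStar_gt_two (hN : 3 ≤ N) : 2 < twoStar N := by
  have := gam_pos hN
  rw [twoStar_eq hN]
  have : 0 < 2 / gam N := by positivity
  linarith

theorem two_div_twoStar (hN : 3 ≤ N) : 2 / twoStar N = gam N / (gam N + 1) := by
  have := gam_pos hN
  rw [twoStar_eq hN]
  field_simp

theorem sphereArea_pos (hN : 3 ≤ N) : 0 < sphereArea N := by
  have : (3 : ℝ) ≤ N := by exact_mod_cast hN
  have h2 : 0 < volume.real (Metric.ball (0 : Space N) 1) :=
    ENNReal.toReal_pos (Metric.measure_ball_pos _ _ one_pos).ne' measure_ball_lt_top.ne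
  unfold sphereArea
  positivity

theorem pow_eq_rpow_gam (hN : 3 ≤ N) (r : ℝ) : r ^ (N - 1) = r ^ (2 * gam N + 1) := by
  rw [← Real.rpow_natCast, Nat.cast_sub (by omega)]
  congr 1
  unfold gam
  push_cast
  ring

theorem nontrivial_space (hN : 3 ≤ N) : Nontrivial (Space N) :=
  Module.nontrivial_of_finrank_pos (R := ℝ) (by rw [finrank_euclideanSpace_fin]; omega)

/-- Integration in polar coordinates. -/
theorem integral_radial (hN : 3 ≤ N) (f : ℝ → ℝ) :
    ∫ x : Space N, f ‖x‖
      = sphereArea N * ∫ r in Set.Ioi 0, f r * r ^ (2 * gam N + 1) := by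
  have := nontrivial_space hN
  rw [integral_fun_norm_addHaar (volume : Measure (Space N)) f, finrank_euclideanSpace_fin,
    nsmul_eq_mul, smul_eq_mul, sphereArea, mul_assoc]
  congr 2
  refine integral_congr_ae (Filter.Eventually.of_forall fun r => ?_)
  simp only [smul_eq_mul]
  rw [pow_eq_rpow_gam hN, mul_comm]

theorem integrable_radial_iff (hN : 3 ≤ N) (f : ℝ → ℝ) :
    Integrable (fun x : Space N => f ‖x‖)
      ↔ IntegrableOn (fun r => f r * r ^ (2 * gam N + 1)) (Set.Ioi 0) := by
  have := nontrivial_space hN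
  rw [integrable_fun_norm_addHaar (volume : Measure (Space N)), finrank_euclideanSpace_fin]
  simp only [smul_eq_mul, pow_eq_rpow_gam hN, mul_comm]

/-- The sharp Sobolev constant for radial functions, in terms of the one-dimensional constant. -/
noncomputable def sharpConst (N : ℕ) : ℝ :=
  sphereArea N * blissConst (gam N) / sphereArea N ^ (gam N / (gam N + 1))

theorem sharpConst_pos (hN : 3 ≤ N) : 0 < sharpConst N := by
  have h1 := sphereArea_pos hN
  have h2 := blissConst_pos (gam_pos hN)
  unfold sharpConst
  positivity

theorem norm_gradient {φ : Space N → ℝ} (x : Space N) : ‖gradient φ x‖ = ‖fderiv ℝ φ x‖ := by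
  unfold gradient
  rw [LinearIsometryEquiv.norm_map]

/-- The sharp Sobolev inequality for continuously differentiable radial functions. -/
theorem sharp_sobolev_of_contDiff (hN : 3 ≤ N) {U : Space N → ℝ} (hU : ContDiff ℝ 1 U)
    (hrad : ∀ x y : Space N, ‖x‖ = ‖y‖ → U x = U y)
    (hD : Integrable fun x => ‖gradient U x‖ ^ 2)
    (hX : Integrable fun x => |U x| ^ twoStar N) :
    sharpConst N * (∫ x, |U x| ^ twoStar N) ^ (2 / twoStar N) ≤ ∫ x, ‖gradient U x‖ ^ 2 := by
  have := nontrivial_space hN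
  have hγ := gam_pos hN
  have hω := sphereArea_pos hN
  obtain ⟨e, he⟩ := exists_norm_eq (Space N) zero_le_one
  let f : ℝ → ℝ := fun r => U (r • e)
  let f' : ℝ → ℝ := fun r => fderiv ℝ U (r • e) e
  have hdiff : Differentiable ℝ U := hU.differentiable one_ne_zero
  have hf : ∀ r, HasDerivAt f (f' r) r := fun r => by
    have h1 : HasDerivAt (fun r : ℝ => r • e) e r := by
      simpa using (hasDerivAt_id r).smul_const e
    exact (hdiff (r • e)).hasFDerivAt.comp_hasDerivAt r h1
  have hf'c : Continuous f' :=
    ((hU.continuous_fderiv one_ne_zero).comp (continuous_id.smul continuous_const)).clm_apply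
      continuous_const
  have hUf : ∀ x, U x = f ‖x‖ := fun x => hrad _ _ (by
    rw [norm_smul, he, norm_norm, mul_one])
  have hle : ∀ x, f' ‖x‖ ^ 2 ≤ ‖gradient U x‖ ^ 2 := by
    intro x
    rw [norm_gradient, ← sq_abs]
    by_cases hx : x = 0
    · rw [hx, norm_zero]
      have := (fderiv ℝ U ((0 : ℝ) • e)).le_opNorm e
      rw [he, mul_one, Real.norm_eq_abs] at this
      rw [zero_smul] at this
      simp only [f', zero_smul]
      gcongr
    · have hx0 : ‖x‖ ≠ 0 := norm_ne_zero_iff.2 hx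
      let y : Space N := ‖x‖⁻¹ • x
      have hy : ‖y‖ = 1 := by rw [norm_smul, norm_inv, norm_norm, inv_mul_cancel₀ hx0]
      have hfy : f = fun r => U (r • y) := funext fun r => hrad _ _ (by
        rw [norm_smul, norm_smul, he, hy])
      have h1 : HasDerivAt (fun r : ℝ => r • y) y ‖x‖ := by
        simpa using (hasDerivAt_id ‖x‖).smul_const y
      have h2 := (hdiff (‖x‖ • y)).hasFDerivAt.comp_hasDerivAt ‖x‖ h1
      have hxy : ‖x‖ • y = x := by rw [smul_smul, mul_inv_cancel₀ hx0, one_smul]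
      have h3 : f' ‖x‖ = fderiv ℝ U x y := by
        have h4 := hf ‖x‖
        rw [hfy] at h4
        have h5 := h4.unique h2
        rwa [hxy] at h5
      rw [h3]
      have := (fderiv ℝ U x).le_opNorm y
      rw [hy, mul_one, Real.norm_eq_abs] at this
      gcongr
  have hDf : Integrable fun x : Space N => (fun r => f' r ^ 2) ‖x‖ := by
    refine hD.mono' ((hf'c.pow 2).comp continuous_norm).aestronglyMeasurable
      (Filter.Eventually.of_forall fun x => ?_)
    rw [Real.norm_of_nonneg (sq_nonneg _)]
    exact hle x
  have hXf : Integrable fun x : Space N => (fun r => |f r| ^ (2 + 2 / gam N)) ‖x‖ := by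
    simp only [← hUf, ← twoStar_eq hN]
    exact hX
  have hB := bliss_inequality_Ioi hγ hf hf'c ((integrable_radial_iff hN _).1 hDf)
    ((integrable_radial_iff hN _).1 hXf)
  have h1 : ∫ x, |U x| ^ twoStar N
      = sphereArea N * ∫ r in Set.Ioi 0, |f r| ^ (2 + 2 / gam N) * r ^ (2 * gam N + 1) := by
    rw [← integral_radial hN (fun r => |f r| ^ (2 + 2 / gam N))]
    simp only [← hUf, ← twoStar_eq hN]
  have h2 : sphereArea N * ∫ r in Set.Ioi 0, f' r ^ 2 * r ^ (2 * gam N + 1)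
      ≤ ∫ x, ‖gradient U x‖ ^ 2 := by
    rw [← integral_radial hN (fun r => f' r ^ 2)]
    exact integral_mono hDf hD hle
  have hB0 : 0 ≤ ∫ r in Set.Ioi 0, |f r| ^ (2 + 2 / gam N) * r ^ (2 * gam N + 1) :=
    setIntegral_nonneg measurableSet_Ioi fun r hr =>
      mul_nonneg (Real.rpow_nonneg (abs_nonneg _) _) (Real.rpow_nonneg (le_of_lt hr) _)
  refine le_trans ?_ h2
  rw [h1, two_div_twoStar hN, Real.mul_rpow hω.le hB0, sharpConst]
  have hp := (Real.rpow_pos_of_pos hω (gam N / (gam N + 1))).ne'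
  calc _ = sphereArea N * (blissConst (gam N) *
        (∫ r in Set.Ioi 0, |f r| ^ (2 + 2 / gam N) * r ^ (2 * gam N + 1)) ^
          (gam N / (gam N + 1))) := by field_simp
    _ ≤ _ := mul_le_mul_of_nonneg_left hB hω.le

end Sobolev

/-! ### The sharp Sobolev inequality for weakly differentiable functions -/

section SobolevER

variable {N : ℕ}

theorem ofReal_norm_rpow {F : Type*} [NormedAddCommGroup F] (x : F) {q : ℝ} (hq : 0 ≤ q) :
    ENNReal.ofReal (‖x‖ ^ q) = ‖x‖ₑ ^ q := by
  rw [← ENNReal.ofReal_rpow_of_nonneg (norm_nonneg _) hq, ofReal_norm]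

theorem integrable_norm_rpow_iff {F : Type*} [NormedAddCommGroup F] {f : Space N → F}
    (hf : AEStronglyMeasurable f volume) {q : ℝ} (hq : 0 ≤ q) :
    Integrable (fun x => ‖f x‖ ^ q) ↔ ∫⁻ x, ‖f x‖ₑ ^ q < ⊤ := by
  have hm : AEStronglyMeasurable (fun x => ‖f x‖ ^ q) volume :=
    (hf.norm.aemeasurable.pow_const q).aestronglyMeasurable
  rw [← lintegral_congr fun x => ofReal_norm_rpow (f x) hq,
    ← hasFiniteIntegral_iff_ofReal (Filter.Eventually.of_forall fun x => by positivity)]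
  exact ⟨fun h => h.2, fun h => ⟨hm, h⟩⟩

theorem ofReal_integral_norm_rpow {F : Type*} [NormedAddCommGroup F] {f : Space N → F}
    {q : ℝ} (hq : 0 ≤ q) (hi : Integrable (fun x => ‖f x‖ ^ q)) :
    ENNReal.ofReal (∫ x, ‖f x‖ ^ q) = ∫⁻ x, ‖f x‖ₑ ^ q := by
  rw [ofReal_integral_eq_lintegral_ofReal hi (Filter.Eventually.of_forall fun x => by positivity)]
  exact lintegral_congr fun x => ofReal_norm_rpow (f x) hq

/-- The sharp Sobolev inequality for weakly differentiable radial functions: mollify and pass to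
the limit by Fatou's lemma. -/
theorem sharp_sobolev_of_hasWeakGradient (hN : 3 ≤ N) {u : Space N → ℝ} {g : Space N → Space N}
    (hg : HasWeakGradient N u g) (hg2 : MemLp g 2 volume) (hrad : IsRadial N u)
    (hX : Integrable fun x => |u x| ^ twoStar N) :
    sharpConst N * (∫ x, |u x| ^ twoStar N) ^ (2 / twoStar N) ≤ ∫ x, ‖g x‖ ^ 2 := by
  have hQ := twoStar_gt_two hN
  have hQ0 : 0 < twoStar N := by linarith
  have hS := sharpConst_pos hN
  have hgi : Integrable fun x => ‖g x‖ ^ (2 : ℝ) := by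
    simpa only [Real.rpow_two] using (memLp_two_iff_integrable_sq_norm hg2.1).1 hg2
  simp only [← Real.norm_eq_abs] at hX ⊢
  simp only [← Real.rpow_two]
  have hD0 : 0 ≤ ∫ x, ‖g x‖ ^ (2 : ℝ) := integral_nonneg fun x => by positivity
  let δ : ℕ → ℝ := fun n => 1 / ((n : ℝ) + 1)
  have hδ : ∀ n, 0 < δ n := fun n => Nat.one_div_pos_of_nat
  let v : ℕ → Space N → ℝ := fun n => mollify (mollifier N (δ n)) u
  have hvc : ∀ n, ContDiff ℝ 1 (v n) := fun n => contDiff_mollify (hδ n) hg.1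
  have hρc : ∀ n, Continuous (mollifier N (δ n)) := fun n => contDiff_mollifier.continuous
  have hum : AEStronglyMeasurable u volume := hg.1.aestronglyMeasurable
  set C : ℝ := ((∫ x, ‖g x‖ ^ (2 : ℝ)) / sharpConst N) ^ (twoStar N / 2) with hC
  have hC0 : 0 ≤ C := Real.rpow_nonneg (div_nonneg hD0 hS.le) _
  have hbound : ∀ n, ∫⁻ x, ‖v n x‖ₑ ^ twoStar N ≤ ENNReal.ofReal C := by
    intro n
    have hXle : ∫⁻ x, ‖v n x‖ₑ ^ twoStar N ≤ ∫⁻ x, ‖u x‖ₑ ^ twoStar N :=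
      lintegral_enorm_mollify_rpow_le (hρc n) (mollifier_nonneg (hδ n))
        (integral_mollifier (hδ n)) (by linarith) hum
    have hDle : ∫⁻ x, ‖gradient (v n) x‖ₑ ^ (2 : ℝ) ≤ ∫⁻ x, ‖g x‖ₑ ^ (2 : ℝ) := by
      simp only [v, hg.gradient_mollify (hδ n)]
      exact lintegral_enorm_mollify_rpow_le (hρc n) (mollifier_nonneg (hδ n))
        (integral_mollifier (hδ n)) (by norm_num) hg2.1
    have hXn : Integrable fun x => ‖v n x‖ ^ twoStar N :=
      (integrable_norm_rpow_iff (hvc n).continuous.aestronglyMeasurable hQ0.le).2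
        (hXle.trans_lt ((integrable_norm_rpow_iff hum hQ0.le).1 hX))
    have hgc : Continuous (gradient (v n)) :=
      (LinearIsometryEquiv.continuous _).comp ((hvc n).continuous_fderiv one_ne_zero)
    have hDn : Integrable fun x => ‖gradient (v n) x‖ ^ (2 : ℝ) :=
      (integrable_norm_rpow_iff hgc.aestronglyMeasurable (by norm_num)).2
        (hDle.trans_lt ((integrable_norm_rpow_iff hg2.1 (by norm_num)).1 hgi))
    have hDr : ∫ x, ‖gradient (v n) x‖ ^ (2 : ℝ) ≤ ∫ x, ‖g x‖ ^ (2 : ℝ) := by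
      rw [← ENNReal.ofReal_le_ofReal_iff hD0, ofReal_integral_norm_rpow (by norm_num) hDn,
        ofReal_integral_norm_rpow (by norm_num) hgi]
      exact hDle
    have hsob := sharp_sobolev_of_contDiff hN (hvc n) (fun x y hxy => mollify_radial hrad hxy)
      (by simpa only [Real.rpow_two] using hDn) (by simpa only [← Real.norm_eq_abs] using hXn)
    simp only [← Real.rpow_two, ← Real.norm_eq_abs] at hsob
    rw [← ofReal_integral_norm_rpow hQ0.le hXn]
    refine ENNReal.ofReal_le_ofReal ?_
    have hXn0 : 0 ≤ ∫ x, ‖v n x‖ ^ twoStar N := integral_nonneg fun x => by positivity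
    have h1 : (∫ x, ‖v n x‖ ^ twoStar N) ^ (2 / twoStar N)
        ≤ (∫ x, ‖g x‖ ^ (2 : ℝ)) / sharpConst N := by
      rw [le_div_iff₀ hS, mul_comm]
      exact hsob.trans hDr
    have h2 := Real.rpow_le_rpow (Real.rpow_nonneg hXn0 _) h1
      (show 0 ≤ twoStar N / 2 by positivity)
    rwa [← Real.rpow_mul hXn0, show 2 / twoStar N * (twoStar N / 2) = 1 by field_simp,
      Real.rpow_one] at h2
  have hlim : ∀ᵐ x, Filter.Tendsto (fun n => v n x) Filter.atTop (nhds (u x)) :=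
    tendsto_mollify_ae hg.1 hδ tendsto_one_div_add_atTop_nhds_zero_nat
  have hfatou : ∫⁻ x, ‖u x‖ₑ ^ twoStar N ≤ ENNReal.ofReal C := by
    calc ∫⁻ x, ‖u x‖ₑ ^ twoStar N
        = ∫⁻ x, Filter.liminf (fun n => ‖v n x‖ₑ ^ twoStar N) Filter.atTop := by
          refine lintegral_congr_ae ?_
          filter_upwards [hlim] with x hx
          exact (((ENNReal.continuous_rpow_const.tendsto _).comp hx.enorm).liminf_eq).symm
      _ ≤ Filter.liminf (fun n => ∫⁻ x, ‖v n x‖ₑ ^ twoStar N) Filter.atTop :=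
          lintegral_liminf_le fun n =>
            (ENNReal.continuous_rpow_const.comp (hvc n).continuous.enorm).measurable
      _ ≤ ENNReal.ofReal C := Filter.liminf_le_of_le (by isBoundedDefault) fun b hb => by
          obtain ⟨n, hn⟩ := hb.exists
          exact hn.trans (hbound n)
  have hXC : ∫ x, ‖u x‖ ^ twoStar N ≤ C := by
    rw [← ENNReal.ofReal_le_ofReal_iff hC0, ofReal_integral_norm_rpow hQ0.le hX]
    exact hfatou
  have hX0 : 0 ≤ ∫ x, ‖u x‖ ^ twoStar N := integral_nonneg fun x => by positivity
  have h3 := Real.rpow_le_rpow hX0 hXC (show 0 ≤ 2 / twoStar N by positivity)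
  rw [hC, ← Real.rpow_mul (div_nonneg hD0 hS.le),
    show twoStar N / 2 * (2 / twoStar N) = 1 by field_simp, Real.rpow_one, le_div_iff₀ hS] at h3
  linarith

theorem dirichlet_nonneg (N : ℕ) (u : Space N → ℝ) : 0 ≤ dirichlet N u :=
  integral_nonneg fun _ => by positivity

theorem integral_abs_rpow_nonneg (u : Space N → ℝ) (l : ℝ) : 0 ≤ ∫ x, |u x| ^ l :=
  integral_nonneg fun _ => by positivity

theorem sq_rpow_one_div_twoStar (hN : 3 ≤ N) {X : ℝ} (hX : 0 ≤ X) :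
    (X ^ (1 / twoStar N)) ^ 2 = X ^ (2 / twoStar N) := by
  have := twoStar_gt_two hN
  rw [← Real.rpow_mul_natCast hX]
  congr 1
  push_cast
  ring

/-- The sharp Sobolev inequality on `E_R`. -/
theorem sharpConst_mul_le_dirichlet (hN : 3 ≤ N) {α p : ℝ} {u : Space N → ℝ}
    (hu : u ∈ ER N α p) :
    sharpConst N * ((∫ x, |u x| ^ twoStar N) ^ (1 / twoStar N)) ^ 2 ≤ dirichlet N u := by
  have hQ := twoStar_gt_two hN
  rw [sq_rpow_one_div_twoStar hN (integral_abs_rpow_nonneg u _)]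
  obtain ⟨-, -, ⟨g, hg, hg2⟩, hrad⟩ := hu
  by_cases hX : Integrable fun x => |u x| ^ twoStar N
  · rw [hg.dirichlet_eq]
    exact sharp_sobolev_of_hasWeakGradient hN hg hg2 hrad hX
  -- The Bochner integral of a non-integrable function is `0`, and the inequality is then trivial.
  · rw [integral_undef hX, Real.zero_rpow (by positivity), mul_zero]
    exact dirichlet_nonneg N u

end SobolevER

/-! ### Truncated Aubin–Talenti functions -/

section Truncated

variable {N : ℕ} {R : ℝ}

/-- The Aubin–Talenti function lowered so as to vanish on the sphere of radius `R`, and cut off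
there. -/
noncomputable def truncBubble (N : ℕ) (R : ℝ) (x : Space N) : ℝ :=
  max (bubble (gam N) ‖x‖ - bubble (gam N) R) 0

/-- The gradient of `truncBubble N R`. -/
noncomputable def truncBubbleGrad (N : ℕ) (R : ℝ) : Space N → Space N :=
  (Metric.ball (0 : Space N) R).indicator
    fun x => -(2 * gam N * (1 + ‖x‖ ^ 2) ^ (-gam N - 1)) • x

theorem truncBubble_nonneg (x : Space N) : 0 ≤ truncBubble N R x := le_max_right _ _

theorem truncBubble_of_le (hN : 3 ≤ N) {x : Space N} (hx : ‖x‖ ≤ R) :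
    truncBubble N R x = bubble (gam N) ‖x‖ - bubble (gam N) R :=
  max_eq_left (sub_nonneg.2 (bubble_antitoneOn (gam_pos hN) (norm_nonneg x) hx))

theorem truncBubble_of_ge (hN : 3 ≤ N) (hR : 0 ≤ R) {x : Space N} (hx : R ≤ ‖x‖) :
    truncBubble N R x = 0 :=
  max_eq_right (sub_nonpos.2 (bubble_antitoneOn (gam_pos hN) hR hx))

theorem truncBubble_le (x : Space N) : truncBubble N R x ≤ bubble (gam N) ‖x‖ :=
  max_le (by linarith [bubble_pos (gam N) R]) (bubble_pos _ _).le

theorem continuous_truncBubble : Continuous (truncBubble N R) :=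
  (((continuous_bubble _).comp continuous_norm).sub continuous_const).max continuous_const

theorem hasCompactSupport_truncBubble (hN : 3 ≤ N) (hR : 0 ≤ R) :
    HasCompactSupport (truncBubble N R) :=
  HasCompactSupport.of_support_subset_isCompact (isCompact_closedBall (0 : Space N) R)
    fun x hx => by
      rw [mem_closedBall_zero_iff]
      by_contra h
      exact hx (truncBubble_of_ge hN hR (not_le.1 h).le)

theorem isRadial_truncBubble : IsRadial N (truncBubble N R) :=
  ⟨fun r => max (bubble (gam N) r - bubble (gam N) R) 0, Filter.EventuallyEq.rfl⟩

theorem abs_bubbleDeriv_le {γ : ℝ} (hγ : 0 < γ) (r : ℝ) : |bubbleDeriv γ r| ≤ γ := by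
  have hp := one_add_sq_pos r
  have h1 : (1 + r ^ 2) ^ (-γ - 1) ≤ (1 + r ^ 2)⁻¹ := by
    rw [← Real.rpow_neg_one]
    exact Real.rpow_le_rpow_of_exponent_le (by nlinarith [sq_nonneg r]) (by linarith)
  have h2 : 2 * |r| ≤ 1 + r ^ 2 := by
    rw [← sq_abs]; nlinarith [sq_nonneg (|r| - 1)]
  unfold bubbleDeriv
  rw [abs_neg, abs_mul, abs_mul, abs_of_pos (show 0 < 2 * γ by positivity),
    abs_of_nonneg (Real.rpow_nonneg hp.le _)]
  calc 2 * γ * |r| * (1 + r ^ 2) ^ (-γ - 1) ≤ 2 * γ * |r| * (1 + r ^ 2)⁻¹ := by gcongr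
    _ = γ * ((2 * |r|) / (1 + r ^ 2)) := by ring
    _ ≤ γ * 1 := by
      gcongr
      exact (div_le_one hp).2 h2
    _ = γ := mul_one γ

theorem lipschitzWith_truncBubble (hN : 3 ≤ N) :
    LipschitzWith (gam N).toNNReal (truncBubble N R) := by
  have h1 : LipschitzWith (gam N).toNNReal (bubble (gam N)) := by
    refine lipschitzWith_of_nnnorm_deriv_le
      (fun r => (hasDerivAt_bubble _ r).differentiableAt) fun r => ?_
    rw [(hasDerivAt_bubble _ r).deriv]
    rw [← NNReal.coe_le_coe, Real.coe_toNNReal _ (gam_pos hN).le]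
    exact abs_bubbleDeriv_le (gam_pos hN) r
  have h2 := h1.comp (lipschitzWith_one_norm (E := Space N))
  rw [mul_one] at h2
  refine LipschitzWith.max_const (LipschitzWith.of_dist_le_mul fun x y => ?_) 0
  have := h2.dist_le_mul x y
  simpa only [Function.comp_apply, dist_sub_right] using this

theorem hasFDerivAt_bubble_norm (γ : ℝ) (x : Space N) :
    HasFDerivAt (fun x : Space N => bubble γ ‖x‖)
      (innerSL ℝ (-(2 * γ * (1 + ‖x‖ ^ 2) ^ (-γ - 1)) • x)) x := by
  have h1 : HasFDerivAt (fun x : Space N => 1 + ‖x‖ ^ 2) (2 • innerSL ℝ x) x :=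
    ((hasStrictFDerivAt_norm_sq x).hasFDerivAt).const_add 1
  refine (h1.rpow_const (p := -γ) (Or.inl (one_add_sq_pos _).ne')).congr_fderiv ?_
  ext v
  simp
  ring

theorem lineDeriv_truncBubble (hN : 3 ≤ N) (hR : 0 ≤ R) {x : Space N} (hx : ‖x‖ ≠ R)
    (v : Space N) :
    lineDeriv ℝ (truncBubble N R) x v = inner ℝ (truncBubbleGrad N R x) v := by
  rcases lt_or_gt_of_ne hx with h | h
  · have hmem : x ∈ Metric.ball (0 : Space N) R := by simpa using h
    have heq : truncBubble N R =ᶠ[nhds x] fun y => bubble (gam N) ‖y‖ - bubble (gam N) R := by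
      filter_upwards [Metric.isOpen_ball.mem_nhds hmem] with y hy
      exact truncBubble_of_le hN (by simpa using (mem_ball_zero_iff.1 hy).le)
    have hd := ((hasFDerivAt_bubble_norm (gam N) x).sub_const (bubble (gam N) R)
      |>.congr_of_eventuallyEq heq)
    rw [hd.hasLineDerivAt v |>.lineDeriv, truncBubbleGrad, Set.indicator_of_mem hmem]
    rfl
  · have hmem : x ∉ Metric.ball (0 : Space N) R := by simpa using h.le
    have heq : truncBubble N R =ᶠ[nhds x] fun _ => 0 := by
      filter_upwards [(isOpen_lt continuous_const continuous_norm).mem_nhds h] with y hy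
      exact truncBubble_of_ge hN hR (le_of_lt hy)
    have hd := (hasFDerivAt_const (𝕜 := ℝ) (0 : ℝ) x).congr_of_eventuallyEq heq
    rw [hd.hasLineDerivAt v |>.lineDeriv, truncBubbleGrad, Set.indicator_of_notMem hmem]
    simp

theorem norm_truncBubbleGrad_sq (x : Space N) :
    ‖truncBubbleGrad N R x‖ ^ 2
      = (Set.Iio R).indicator (fun r => bubbleDeriv (gam N) r ^ 2) ‖x‖ := by
  by_cases h : ‖x‖ < R
  · have hmem : x ∈ Metric.ball (0 : Space N) R := by simpa using h
    rw [truncBubbleGrad, Set.indicator_of_mem hmem, Set.indicator_of_mem (Set.mem_Iio.2 h),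
      norm_smul, mul_pow, Real.norm_eq_abs, sq_abs, bubbleDeriv]
    ring
  · have hmem : x ∉ Metric.ball (0 : Space N) R := by simpa using h
    rw [truncBubbleGrad, Set.indicator_of_notMem hmem,
      Set.indicator_of_notMem (fun h' => h (Set.mem_Iio.1 h'))]
    simp

theorem measurable_truncBubbleGrad : Measurable (truncBubbleGrad N R) := by
  refine Measurable.indicator ?_ measurableSet_ball
  have : Continuous fun x : Space N => (1 + ‖x‖ ^ 2) ^ (-gam N - 1) :=
    Continuous.rpow_const (by fun_prop) fun x => Or.inl (one_add_sq_pos _).ne'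
  exact (((continuous_const.mul this).neg).smul continuous_id).measurable

theorem integral_Ioi_indicator_Iio (hR : 0 ≤ R) (f h : ℝ → ℝ) :
    ∫ r in Set.Ioi 0, (Set.Iio R).indicator f r * h r = ∫ r in (0 : ℝ)..R, f r * h r := by
  have : ∀ r, (Set.Iio R).indicator f r * h r = (Set.Iio R).indicator (fun r => f r * h r) r :=
    fun r => (Set.indicator_mul_left _ _ _).symm
  simp_rw [this]
  rw [setIntegral_indicator measurableSet_Iio, Set.Ioi_inter_Iio,
    intervalIntegral.integral_of_le hR, integral_Ioc_eq_integral_Ioo]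

theorem integral_norm_truncBubbleGrad_sq (hN : 3 ≤ N) (hR : 0 ≤ R) :
    ∫ x, ‖truncBubbleGrad N R x‖ ^ 2 = sphereArea N *
      ∫ r in (0 : ℝ)..R, bubbleDeriv (gam N) r ^ 2 * r ^ (2 * gam N + 1) := by
  simp_rw [norm_truncBubbleGrad_sq]
  rw [integral_radial hN, integral_Ioi_indicator_Iio hR]

theorem memLp_truncBubbleGrad (hN : 3 ≤ N) : MemLp (truncBubbleGrad N R) 2 volume := by
  rw [memLp_two_iff_integrable_sq_norm measurable_truncBubbleGrad.aestronglyMeasurable]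
  have h1 : IntegrableOn (fun _ : Space N => gam N ^ 2) (Metric.ball (0 : Space N) R) volume :=
    integrableOn_const measure_ball_lt_top.ne
  rw [← integrable_indicator_iff measurableSet_ball] at h1
  refine h1.mono' (measurable_truncBubbleGrad.norm.pow_const 2).aestronglyMeasurable
    (Filter.Eventually.of_forall fun x => ?_)
  rw [Real.norm_of_nonneg (sq_nonneg _), norm_truncBubbleGrad_sq]
  by_cases h : ‖x‖ < R
  · have hmem : x ∈ Metric.ball (0 : Space N) R := by simpa using h
    rw [Set.indicator_of_mem (Set.mem_Iio.2 h), Set.indicator_of_mem hmem, ← sq_abs]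
    exact pow_le_pow_left₀ (abs_nonneg _) (abs_bubbleDeriv_le (gam_pos hN) _) 2
  · rw [Set.indicator_of_notMem (fun h' => h (Set.mem_Iio.1 h'))]
    exact Set.indicator_nonneg (fun _ _ => sq_nonneg _) _

theorem hasWeakGradient_truncBubble (hN : 3 ≤ N) (hR : 0 < R) :
    HasWeakGradient N (truncBubble N R) (truncBubbleGrad N R) := by
  have hgloc : LocallyIntegrable (truncBubbleGrad N R) volume :=
    (memLp_truncBubbleGrad hN).locallyIntegrable (by norm_num)
  refine ⟨continuous_truncBubble.locallyIntegrable, hgloc, fun φ hφ hc => ?_⟩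
  have hφ1 : ContDiff ℝ 1 φ := hφ.of_le (by exact_mod_cast le_top)
  obtain ⟨C, hC⟩ := hφ1.lipschitzWith_of_hasCompactSupport hc one_ne_zero
  have hgradc : Continuous (gradient φ) :=
    (LinearIsometryEquiv.continuous _).comp (hφ1.continuous_fderiv one_ne_zero)
  have hi1 : Integrable (fun x => truncBubble N R x • gradient φ x) volume :=
    (continuous_truncBubble.smul hgradc).integrable_of_hasCompactSupport
      (hasCompactSupport_truncBubble hN hR.le).smul_right
  have hi2 : Integrable (fun x => φ x • truncBubbleGrad N R x) volume :=
    hgloc.integrable_smul_left_of_hasCompactSupport hφ.continuous hc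
  refine ext_inner_left ℝ fun v => ?_
  rw [inner_neg_right, ← integral_inner hi1, ← integral_inner hi2]
  have hsphere : ∀ᵐ x : Space N, ‖x‖ ≠ R := by
    have := Measure.addHaar_sphere_of_ne_zero (volume : Measure (Space N)) 0 hR.ne'
    filter_upwards [compl_mem_ae_iff.2 this] with x hx h
    exact hx (by simpa using h)
  have h1 := (lipschitzWith_truncBubble (R := R) hN).integral_lineDeriv_mul_eq
    (μ := volume) hC hc v
  have h2 : ∫ x, inner ℝ v (φ x • truncBubbleGrad N R x)
      = ∫ x, lineDeriv ℝ (truncBubble N R) x v * φ x := by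
    refine integral_congr_ae ?_
    filter_upwards [hsphere] with x hx
    rw [lineDeriv_truncBubble hN hR.le hx, inner_smul_right, real_inner_comm, mul_comm]
  have h3 : ∀ x, lineDeriv ℝ φ x (-v) * truncBubble N R x
      = -inner ℝ v (truncBubble N R x • gradient φ x) := fun x => by
    have hd : DifferentiableAt ℝ φ x := hφ1.differentiable one_ne_zero x
    rw [hd.lineDeriv_eq_fderiv, map_neg, inner_smul_right, real_inner_comm, gradient,
      InnerProductSpace.toDual_symm_apply]
    ring
  rw [h2, h1, funext h3, integral_neg, neg_neg]

theorem dirichlet_truncBubble (hN : 3 ≤ N) (hR : 0 < R) :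
    dirichlet N (truncBubble N R) = sphereArea N *
      ∫ r in (0 : ℝ)..R, bubbleDeriv (gam N) r ^ 2 * r ^ (2 * gam N + 1) := by
  rw [(hasWeakGradient_truncBubble hN hR).dirichlet_eq, integral_norm_truncBubbleGrad_sq hN hR.le]

theorem integral_truncBubble_rpow (hN : 3 ≤ N) (hR : 0 ≤ R) {q : ℝ} (hq : 0 < q) :
    ∫ x, |truncBubble N R x| ^ q = sphereArea N *
      ∫ r in (0 : ℝ)..R, (bubble (gam N) r - bubble (gam N) R) ^ q * r ^ (2 * gam N + 1) := by
  have : ∀ x : Space N, |truncBubble N R x| ^ q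
      = (Set.Iio R).indicator (fun r => (bubble (gam N) r - bubble (gam N) R) ^ q) ‖x‖ := by
    intro x
    rw [abs_of_nonneg (truncBubble_nonneg x)]
    by_cases h : ‖x‖ < R
    · rw [truncBubble_of_le hN h.le, Set.indicator_of_mem (Set.mem_Iio.2 h)]
    · rw [truncBubble_of_ge hN hR (not_lt.1 h),
        Set.indicator_of_notMem (fun h' => h (Set.mem_Iio.1 h')), Real.zero_rpow hq.ne']
  simp_rw [this]
  rw [integral_radial hN, integral_Ioi_indicator_Iio hR]

theorem integrable_truncBubble_rpow (hN : 3 ≤ N) (hR : 0 ≤ R) {q : ℝ} (hq : 0 < q) :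
    Integrable fun x => |truncBubble N R x| ^ q := by
  have hc : Continuous fun x => |truncBubble N R x| ^ q :=
    continuous_truncBubble.abs.rpow_const fun _ => Or.inr hq.le
  refine hc.integrable_of_hasCompactSupport ?_
  exact (hasCompactSupport_truncBubble hN hR).comp_left (g := fun y => |y| ^ q)
    (by simp [Real.zero_rpow hq.ne'])

/-- The Lebesgue norms of the truncated functions are bounded below, uniformly in `R ≥ 1`. -/
theorem exists_le_integral_truncBubble_rpow (hN : 3 ≤ N) {q : ℝ} (hq : 0 < q) :
    ∃ c : ℝ, 0 < c ∧ ∀ R : ℝ, 1 ≤ R → c ≤ ∫ x, |truncBubble N R x| ^ q := by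
  have hγ := gam_pos hN
  set d := bubble (gam N) (1 / 2) - bubble (gam N) 1 with hd
  have hd0 : 0 < d := sub_pos.2 (bubble_strictAntiOn hγ (by norm_num) (by norm_num))
  have hv : 0 < volume.real (Metric.ball (0 : Space N) (1 / 2)) :=
    ENNReal.toReal_pos (Metric.measure_ball_pos _ _ (by norm_num)).ne' measure_ball_lt_top.ne
  refine ⟨d ^ q * volume.real (Metric.ball (0 : Space N) (1 / 2)), by positivity, fun R hR => ?_⟩
  have hi := integrable_truncBubble_rpow (R := R) hN (by linarith) hq
  calc d ^ q * volume.real (Metric.ball (0 : Space N) (1 / 2))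
      = ∫ _ in Metric.ball (0 : Space N) (1 / 2), d ^ q := by
        rw [setIntegral_const, smul_eq_mul, mul_comm]
    _ ≤ ∫ x in Metric.ball (0 : Space N) (1 / 2), |truncBubble N R x| ^ q := by
        refine setIntegral_mono_on (integrableOn_const measure_ball_lt_top.ne) hi.integrableOn
          measurableSet_ball fun x hx => ?_
        have hx' : ‖x‖ < 1 / 2 := by simpa using hx
        rw [abs_of_nonneg (truncBubble_nonneg x), truncBubble_of_le hN (by linarith)]
        have h1 := bubble_antitoneOn hγ (norm_nonneg x) hx'.le
        have h2 := bubble_antitoneOn hγ zero_le_one hR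
        gcongr
        linarith
    _ ≤ ∫ x, |truncBubble N R x| ^ q :=
        setIntegral_le_integral hi (Filter.Eventually.of_forall fun x => by positivity)

end Truncated

/-! ### Coulomb energy of the truncated functions -/

section Coulomb

variable {N : ℕ} {α p : ℝ}

/-- The indicator function of the ball of radius `ρ` about the origin. -/
noncomputable def ballInd (N : ℕ) (ρ : ℝ) : Space N → ℝ :=
  (Metric.ball (0 : Space N) ρ).indicator fun _ => 1

theorem measurable_ballInd {ρ : ℝ} : Measurable (ballInd N ρ) :=
  measurable_const.indicator measurableSet_ball

theorem measurable_rieszKernel (β : ℝ) : Measurable (rieszKernel N β) :=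
  (measurable_norm.pow_const _).const_div _

theorem rieszConv_ballInd (hp : 0 < p) (ρ : ℝ) (x : Space N) :
    rieszConv N α p (ballInd N ρ) x
      = ∫⁻ y in Metric.ball 0 ρ, ENNReal.ofReal (rieszKernel N (α / 2) (x - y)) := by
  rw [← lintegral_indicator measurableSet_ball]
  refine lintegral_congr fun y => ?_
  by_cases hy : y ∈ Metric.ball (0 : Space N) ρ
  · simp [ballInd, Set.indicator_of_mem hy]
  · simp [ballInd, Set.indicator_of_notMem hy, Real.zero_rpow hp.ne']

theorem ofReal_rieszKernel_le (β : ℝ) (x : Space N) :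
    ENNReal.ofReal (rieszKernel N β x)
      ≤ ENNReal.ofReal (|rieszConst N β| * ‖x‖ ^ (-((N : ℝ) - β))) := by
  refine ENNReal.ofReal_le_ofReal ?_
  rw [rieszKernel, Real.rpow_neg (norm_nonneg _), ← div_eq_mul_inv]
  gcongr
  exact le_abs_self _

/-- The Riesz potential of the unit ball is bounded and decays like the kernel. -/
theorem exists_rieszConv_ballInd_le (hN : 3 ≤ N) (hα0 : 0 < α) (hαN : α < N) (hp : 0 < p) :
    ∃ K : ℝ, 0 ≤ K ∧ ∀ x : Space N, rieszConv N α p (ballInd N 1) x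
      ≤ ENNReal.ofReal (K * (1 + ‖x‖) ^ (-((N : ℝ) - α / 2))) := by
  set s : ℝ := (N : ℝ) - α / 2 with hs
  have hs0 : 0 < s := by rw [hs]; linarith
  set A := |rieszConst N (α / 2)| with hA
  have hA0 : 0 ≤ A := abs_nonneg _
  let k : Space N → ℝ := fun z => A * ‖z‖ ^ (-s)
  have hkm : Measurable k := (measurable_norm.pow_const _).const_mul _
  have hk0 : ∀ z, 0 ≤ k z := fun z => by positivity
  have hki : IntegrableOn k (Metric.ball 0 3) volume := by
    refine integrableOn_ball_of_norm_le_rpow (C := A) (α := s) ?_ ?_ ?_ hkm.aestronglyMeasurable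
    · rw [finrank_euclideanSpace_fin]; omega
    · rw [finrank_euclideanSpace_fin, hs]; linarith
    · refine Filter.Eventually.of_forall fun z => ?_
      rw [Real.norm_of_nonneg (hk0 z)]
  set M := ∫ z in Metric.ball (0 : Space N) 3, k z with hM
  have hM0 : 0 ≤ M := integral_nonneg hk0
  set V := volume.real (Metric.ball (0 : Space N) 1) with hV
  have hV0 : 0 ≤ V := ENNReal.toReal_nonneg
  have hle : ∀ x, rieszConv N α p (ballInd N 1) x
      ≤ ∫⁻ y in Metric.ball (0 : Space N) 1, ENNReal.ofReal (k (x - y)) := fun x => by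
    rw [rieszConv_ballInd hp]
    exact lintegral_mono fun y => ofReal_rieszKernel_le _ _
  refine ⟨max (M * 3 ^ s) (A * 4 ^ s * V), le_max_of_le_right (by positivity), fun x => ?_⟩
  refine (hle x).trans ?_
  have h1x : 0 < 1 + ‖x‖ := by positivity
  rcases lt_or_ge ‖x‖ 2 with hx | hx
  · have h1 : ∫⁻ y in Metric.ball (0 : Space N) 1, ENNReal.ofReal (k (x - y))
        ≤ ENNReal.ofReal M := by
      rw [hM, ofReal_integral_eq_lintegral_ofReal hki (Filter.Eventually.of_forall hk0),
        ← lintegral_indicator measurableSet_ball, ← lintegral_indicator measurableSet_ball,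
        ← lintegral_sub_left_eq_self
          ((Metric.ball (0 : Space N) 3).indicator fun z => ENNReal.ofReal (k z)) x]
      refine lintegral_mono fun y => ?_
      by_cases hy : y ∈ Metric.ball (0 : Space N) 1
      · have hxy : x - y ∈ Metric.ball (0 : Space N) 3 := by
          rw [mem_ball_zero_iff] at hy ⊢
          linarith [norm_sub_le x y]
        rw [Set.indicator_of_mem hy, Set.indicator_of_mem hxy]
      · rw [Set.indicator_of_notMem hy]
        exact zero_le
    refine h1.trans (ENNReal.ofReal_le_ofReal ?_)
    have h2 : (3 : ℝ) ^ (-s) ≤ (1 + ‖x‖) ^ (-s) :=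
      Real.rpow_le_rpow_of_nonpos h1x (by linarith) (by linarith)
    calc M = M * 3 ^ s * 3 ^ (-s) := by
          rw [mul_assoc, ← Real.rpow_add (by norm_num), add_neg_cancel, Real.rpow_zero, mul_one]
      _ ≤ max (M * 3 ^ s) (A * 4 ^ s * V) * (1 + ‖x‖) ^ (-s) := by
          gcongr
          exact le_max_left _ _
  · have h1 : ∀ y ∈ Metric.ball (0 : Space N) 1,
        ENNReal.ofReal (k (x - y)) ≤ ENNReal.ofReal (A * 4 ^ s * (1 + ‖x‖) ^ (-s)) := by
      intro y hy
      rw [mem_ball_zero_iff] at hy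
      refine ENNReal.ofReal_le_ofReal ?_
      have h2 : (1 + ‖x‖) / 4 ≤ ‖x - y‖ := by linarith [norm_sub_norm_le x y]
      have h3 : ‖x - y‖ ^ (-s) ≤ ((1 + ‖x‖) / 4) ^ (-s) :=
        Real.rpow_le_rpow_of_nonpos (by positivity) h2 (by linarith)
      rw [Real.div_rpow h1x.le (by norm_num), Real.rpow_neg (by norm_num : (0 : ℝ) ≤ 4),
        div_inv_eq_mul] at h3
      calc A * ‖x - y‖ ^ (-s) ≤ A * ((1 + ‖x‖) ^ (-s) * 4 ^ s) := by gcongr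
        _ = A * 4 ^ s * (1 + ‖x‖) ^ (-s) := by ring
    refine (setLIntegral_mono measurable_const h1).trans ?_
    rw [setLIntegral_const]
    have hVe : volume (Metric.ball (0 : Space N) 1) = ENNReal.ofReal V :=
      (ENNReal.ofReal_toReal measure_ball_lt_top.ne).symm
    rw [hVe, ← ENNReal.ofReal_mul (by positivity)]
    refine ENNReal.ofReal_le_ofReal ?_
    calc A * 4 ^ s * (1 + ‖x‖) ^ (-s) * V = A * 4 ^ s * V * (1 + ‖x‖) ^ (-s) := by ring
      _ ≤ _ := by
        gcongr
        exact le_max_right _ _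

theorem coulomb_ballInd_one_lt_top (hN : 3 ≤ N) (hα0 : 0 < α) (hαN : α < N) (hp : 0 < p) :
    coulomb N α p (ballInd N 1) < ⊤ := by
  obtain ⟨K, hK0, hK⟩ := exists_rieszConv_ballInd_le hN hα0 hαN hp
  have h1 : ∀ x : Space N, rieszConv N α p (ballInd N 1) x ^ 2
      ≤ ENNReal.ofReal (K ^ 2) * ENNReal.ofReal ((1 + ‖x‖) ^ (-(2 * N - α))) := by
    intro x
    have h1x : 0 < 1 + ‖x‖ := by positivity
    refine (pow_le_pow_left' (hK x) 2).trans_eq ?_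
    rw [← ENNReal.ofReal_pow (by positivity), ← ENNReal.ofReal_mul (by positivity), mul_pow,
      ← Real.rpow_mul_natCast h1x.le]
    congr 3
    push_cast
    ring
  refine (lintegral_mono h1).trans_lt ?_
  rw [lintegral_const_mul' _ _ ENNReal.ofReal_ne_top]
  refine ENNReal.mul_lt_top ENNReal.ofReal_lt_top (finite_integral_one_add_norm ?_)
  rw [finrank_euclideanSpace_fin]
  linarith

theorem coulomb_ballInd {ρ : ℝ} (hρ : 0 < ρ) :
    coulomb N α p (ballInd N ρ)
      = ENNReal.ofReal (ρ ^ (α + N)) * coulomb N α p (ballInd N 1) := by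
  have h : ballInd N ρ = dilate 1 ρ⁻¹ (ballInd N 1) := by
    funext x
    have : x ∈ Metric.ball (0 : Space N) ρ ↔ ρ⁻¹ • x ∈ Metric.ball (0 : Space N) 1 := by
      rw [mem_ball_zero_iff, mem_ball_zero_iff, norm_smul, norm_inv, Real.norm_of_nonneg hρ.le,
        ← div_eq_inv_mul, div_lt_one hρ]
    by_cases hx : x ∈ Metric.ball (0 : Space N) ρ
    · simp only [ballInd, dilate, Set.indicator_of_mem hx, Set.indicator_of_mem (this.1 hx),
        one_mul]
    · simp only [ballInd, dilate, Set.indicator_of_notMem hx,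
        Set.indicator_of_notMem (fun h => hx (this.2 h)), mul_zero]
  rw [h, coulomb_dilate α p zero_le_one (inv_pos.2 hρ), Real.one_rpow, one_mul,
    Real.inv_rpow hρ.le, ← Real.rpow_neg hρ.le, neg_neg]

theorem measurable_rieszConv {u : Space N → ℝ} (hu : Measurable u) :
    Measurable (rieszConv N α p u) := by
  have h : Measurable fun z : Space N × Space N =>
      ENNReal.ofReal (rieszKernel N (α / 2) (z.1 - z.2) * |u z.2| ^ p) :=
    (((measurable_rieszKernel _).comp (measurable_fst.sub measurable_snd)).mul
      (((hu.comp measurable_snd).norm).pow_const p)).ennreal_ofReal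
  exact h.lintegral_prod_right'

/-- The Coulomb energy of a function dominated by a finite sum of multiples of given functions. -/
theorem coulomb_le_of_le_sum {ι : Type*} (s : Finset ι) (c : ι → ℝ) (hc : ∀ i, 0 ≤ c i)
    (v : ι → Space N → ℝ) (hv : ∀ i, Measurable (v i)) {u : Space N → ℝ}
    (h : ∀ x, |u x| ^ p ≤ ∑ i ∈ s, c i * |v i x| ^ p) (hk : ∀ x, 0 ≤ rieszKernel N (α / 2) x) :
    coulomb N α p u
      ≤ s.card * ∑ i ∈ s, ENNReal.ofReal (c i ^ 2) * coulomb N α p (v i) := by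
  have h1 : ∀ x, rieszConv N α p u x
      ≤ ∑ i ∈ s, ENNReal.ofReal (c i) * rieszConv N α p (v i) x := by
    intro x
    have hm : ∀ i, Measurable fun y =>
        ENNReal.ofReal (rieszKernel N (α / 2) (x - y) * |v i y| ^ p) := fun i =>
      (((measurable_rieszKernel _).comp (measurable_const.sub measurable_id)).mul
        ((hv i).norm.pow_const p)).ennreal_ofReal
    calc rieszConv N α p u x
        ≤ ∫⁻ y, ∑ i ∈ s, ENNReal.ofReal (c i) *
            ENNReal.ofReal (rieszKernel N (α / 2) (x - y) * |v i y| ^ p) := by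
          refine lintegral_mono fun y => ?_
          have e : ∀ i ∈ s, ENNReal.ofReal (c i) *
              ENNReal.ofReal (rieszKernel N (α / 2) (x - y) * |v i y| ^ p)
              = ENNReal.ofReal (c i * (rieszKernel N (α / 2) (x - y) * |v i y| ^ p)) :=
            fun i _ => (ENNReal.ofReal_mul (hc i)).symm
          rw [Finset.sum_congr rfl e, ← ENNReal.ofReal_sum_of_nonneg fun i _ =>
            mul_nonneg (hc i) (mul_nonneg (hk _) (Real.rpow_nonneg (abs_nonneg _) _))]
          refine ENNReal.ofReal_le_ofReal ((mul_le_mul_of_nonneg_left (h y) (hk _)).trans_eq ?_)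
          rw [Finset.mul_sum]
          exact Finset.sum_congr rfl fun i _ => by ring
      _ = ∑ i ∈ s, ENNReal.ofReal (c i) * rieszConv N α p (v i) x := by
          rw [lintegral_finsetSum _ fun i _ => (hm i).const_mul _]
          exact Finset.sum_congr rfl fun i _ =>
            lintegral_const_mul' _ _ ENNReal.ofReal_ne_top
  have h2 : ∀ x, rieszConv N α p u x ^ 2
      ≤ s.card * ∑ i ∈ s, ENNReal.ofReal (c i ^ 2) * rieszConv N α p (v i) x ^ 2 := by
    intro x
    refine (pow_le_pow_left' (h1 x) 2).trans ?_
    have h3 := ENNReal.rpow_sum_le_const_mul_sum_rpow s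
      (fun i => ENNReal.ofReal (c i) * rieszConv N α p (v i) x) (one_le_two (α := ℝ))
    norm_num at h3
    refine h3.trans_eq ?_
    congr 1
    refine Finset.sum_congr rfl fun i _ => ?_
    rw [mul_pow, ENNReal.ofReal_pow (hc i)]
  calc coulomb N α p u
      ≤ ∫⁻ x, s.card * ∑ i ∈ s, ENNReal.ofReal (c i ^ 2) * rieszConv N α p (v i) x ^ 2 :=
        lintegral_mono h2
    _ = _ := by
      rw [lintegral_const_mul' _ _ (ENNReal.natCast_ne_top _),
        lintegral_finsetSum _ fun i _ => ((measurable_rieszConv (hv i)).pow_const 2).const_mul _]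
      congr 1
      exact Finset.sum_congr rfl fun i _ => lintegral_const_mul' _ _ ENNReal.ofReal_ne_top

theorem rieszKernel_nonneg (hα0 : 0 < α) (hαN : α < N) (x : Space N) :
    0 ≤ rieszKernel N (α / 2) x := by
  have h1 : 0 < Real.Gamma (((N : ℝ) - α / 2) / 2) := Real.Gamma_pos_of_pos (by linarith)
  have h2 : 0 < Real.Gamma (α / 2 / 2) := Real.Gamma_pos_of_pos (by linarith)
  have := Real.pi_pos
  unfold rieszKernel rieszConst
  positivity

/-- Dyadic layers of the truncated extremal. -/
theorem truncBubble_rpow_le_sum (hN : 3 ≤ N) (hp : 0 < p) (J : ℕ) (x : Space N) :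
    |truncBubble N (2 ^ J) x| ^ p ≤ ∑ j ∈ Finset.range (J + 1),
      (2 : ℝ) ^ (-(2 * gam N * p) * ((j : ℝ) - 1)) * |ballInd N (2 ^ j) x| ^ p := by
  have hγ := gam_pos hN
  have hnn : ∀ j ∈ Finset.range (J + 1),
      0 ≤ (2 : ℝ) ^ (-(2 * gam N * p) * ((j : ℝ) - 1)) * |ballInd N (2 ^ j) x| ^ p :=
    fun j _ => by positivity
  rw [abs_of_nonneg (truncBubble_nonneg x)]
  by_cases hx : ‖x‖ < 2 ^ J
  · classical
    have hex : ∃ j : ℕ, ‖x‖ < 2 ^ j := ⟨J, hx⟩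
    -- The layer containing `x`: `2^(j-1) ≤ ‖x‖ < 2^j`, or `‖x‖ < 1` and `j = 0`.
    set j := Nat.find hex with hj
    have hjx : ‖x‖ < 2 ^ j := Nat.find_spec hex
    have hjJ : j ≤ J := Nat.find_min' hex hx
    refine le_trans ?_ (Finset.single_le_sum hnn (Finset.mem_range.2 (Nat.lt_succ_of_le hjJ)))
    have hmem : x ∈ Metric.ball (0 : Space N) (2 ^ j) := by simpa using hjx
    rw [ballInd, Set.indicator_of_mem hmem, abs_one, Real.one_rpow, mul_one]
    have hb : truncBubble N (2 ^ J) x ≤ (2 : ℝ) ^ (-(2 * gam N) * ((j : ℝ) - 1)) := by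
      refine (truncBubble_le x).trans ?_
      rcases Nat.eq_zero_or_pos j with h0 | h0
      · refine (bubble_le_one hγ _).trans (Real.one_le_rpow one_le_two ?_)
        rw [h0]
        push_cast
        linarith
      · have hlow : (2 : ℝ) ^ (j - 1) ≤ ‖x‖ :=
          not_lt.1 (Nat.find_min hex (show j - 1 < Nat.find hex by omega))
        have hx0 : 0 < ‖x‖ := lt_of_lt_of_le (by positivity) hlow
        refine (bubble_le_rpow hγ hx0).trans
          ((Real.rpow_le_rpow_of_nonpos (by positivity) hlow (by linarith)).trans_eq ?_)
        rw [← Real.rpow_natCast, ← Real.rpow_mul (by norm_num), Nat.cast_sub h0]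
        congr 1
        push_cast
        ring
    calc truncBubble N (2 ^ J) x ^ p ≤ ((2 : ℝ) ^ (-(2 * gam N) * ((j : ℝ) - 1))) ^ p :=
          Real.rpow_le_rpow (truncBubble_nonneg x) hb hp.le
      _ = _ := by
        rw [← Real.rpow_mul (by norm_num)]
        congr 1
        ring
  · rw [truncBubble_of_ge hN (by positivity) (not_lt.1 hx), Real.zero_rpow hp.ne']
    exact Finset.sum_nonneg hnn

/-- Growth of the Coulomb energy of the truncated extremals. The factor `(J+1)²` absorbs the
logarithm that occurs for `2(N-2)p = N+α`. -/
theorem exists_coulomb_truncBubble_le (hN : 3 ≤ N) (hα0 : 0 < α) (hαN : α < N) (hp : 0 < p) :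
    ∃ C : ℝ, 0 ≤ C ∧ ∀ J : ℕ, coulomb N α p (truncBubble N (2 ^ J))
      ≤ ENNReal.ofReal (C * ((J : ℝ) + 1) ^ 2
          * ((2 : ℝ) ^ J) ^ max ((N : ℝ) + α - 2 * ((N : ℝ) - 2) * p) 0) := by
  set P := 2 * gam N * p with hP
  set m := max ((N : ℝ) + α - 2 * ((N : ℝ) - 2) * p) 0 with hm
  have hmP : (N : ℝ) + α - 2 * P ≤ m := by
    have : 2 * P = 2 * ((N : ℝ) - 2) * p := by rw [hP, gam]; ring
    rw [this]
    exact le_max_left _ _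
  set C₁ := (coulomb N α p (ballInd N 1)).toReal with hC₁
  have hC₁e : coulomb N α p (ballInd N 1) = ENNReal.ofReal C₁ :=
    (ENNReal.ofReal_toReal (coulomb_ballInd_one_lt_top hN hα0 hαN hp).ne).symm
  have hC₁0 : 0 ≤ C₁ := ENNReal.toReal_nonneg
  refine ⟨(2 : ℝ) ^ (2 * P) * C₁, by positivity, fun J => ?_⟩
  refine (coulomb_le_of_le_sum (Finset.range (J + 1))
    (fun j => (2 : ℝ) ^ (-P * ((j : ℝ) - 1))) (fun j => by positivity)
    (fun j => ballInd N (2 ^ j)) (fun j => measurable_ballInd)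
    (truncBubble_rpow_le_sum hN hp J) (rieszKernel_nonneg hα0 hαN)).trans ?_
  have hterm : ∀ j ∈ Finset.range (J + 1),
      ENNReal.ofReal (((2 : ℝ) ^ (-P * ((j : ℝ) - 1))) ^ 2) * coulomb N α p (ballInd N (2 ^ j))
        ≤ ENNReal.ofReal ((2 : ℝ) ^ (2 * P) * C₁ * ((2 : ℝ) ^ J) ^ m) := by
    intro j hj
    have hjJ : (j : ℝ) ≤ J := by exact_mod_cast Nat.lt_succ_iff.1 (Finset.mem_range.1 hj)
    rw [coulomb_ballInd (by positivity), hC₁e, ← mul_assoc, ← ENNReal.ofReal_mul (by positivity),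
      ← ENNReal.ofReal_mul (by positivity)]
    refine ENNReal.ofReal_le_ofReal ?_
    have e : ((2 : ℝ) ^ (-P * ((j : ℝ) - 1))) ^ 2 * ((2 : ℝ) ^ j) ^ (α + N)
        = (2 : ℝ) ^ (2 * P) * (2 : ℝ) ^ ((j : ℝ) * ((N : ℝ) + α - 2 * P)) := by
      rw [← Real.rpow_mul_natCast (by norm_num), ← Real.rpow_natCast 2 j,
        ← Real.rpow_mul (by norm_num), ← Real.rpow_add (by norm_num),
        ← Real.rpow_add (by norm_num)]
      congr 1
      push_cast
      ring
    have e2 : ((2 : ℝ) ^ J) ^ m = (2 : ℝ) ^ ((J : ℝ) * m) := by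
      rw [← Real.rpow_natCast, ← Real.rpow_mul (by norm_num)]
    rw [e, e2]
    have h5 : (2 : ℝ) ^ ((j : ℝ) * ((N : ℝ) + α - 2 * P)) ≤ (2 : ℝ) ^ ((J : ℝ) * m) := by
      refine Real.rpow_le_rpow_of_exponent_le one_le_two ?_
      calc (j : ℝ) * ((N : ℝ) + α - 2 * P) ≤ (j : ℝ) * m := by gcongr
        _ ≤ (J : ℝ) * m := by
          have : 0 ≤ m := le_max_right _ _
          gcongr
    calc (2 : ℝ) ^ (2 * P) * (2 : ℝ) ^ ((j : ℝ) * ((N : ℝ) + α - 2 * P)) * C₁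
        ≤ (2 : ℝ) ^ (2 * P) * (2 : ℝ) ^ ((J : ℝ) * m) * C₁ := by gcongr
      _ = _ := by ring
  refine (mul_le_mul_right (Finset.sum_le_card_nsmul _ _ _ hterm) _).trans_eq ?_
  rw [Finset.card_range, nsmul_eq_mul, ← mul_assoc, ← ENNReal.ofReal_natCast,
    ← ENNReal.ofReal_mul (by positivity), ← ENNReal.ofReal_mul (by positivity)]
  congr 1
  push_cast
  ring

end Coulomb

/-! ### Scaling exponents and fibering maps -/

section Fibering

variable {N : ℕ} {α p r : ℝ}

theorem two_mul_sigma_mul_sub (hp1 : 1 < p) : 2 * sigma α p * p - α = 2 * sigma α p + 2 := by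
  have : p - 1 ≠ 0 := by linarith
  unfold sigma
  field_simp
  ring

theorem sExp_qExp (hα0 : 0 < α) (hp1 : 1 < p) :
    sExp N α p (qExp α p) = 2 * sigma α p + 2 - N := by
  have h1 : p - 1 ≠ 0 := by linarith
  have h2 : 2 + α ≠ 0 := by linarith
  unfold sExp sigma qExp
  field_simp
  ring

theorem sigma_pos (hα0 : 0 < α) (hp1 : 1 < p) : 0 < sigma α p := by
  have h1 : 0 < p - 1 := by linarith
  unfold sigma
  positivity

theorem two_mul_gam_add_two : 2 * gam N + 2 = N := by unfold gam; ring

theorem sExp_qExp_pos (hN : 3 ≤ N) (hα0 : 0 < α) (hp1 : 1 < p)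
    (hp2 : p < ((N : ℝ) + α) / ((N : ℝ) - 2)) : 0 < sExp N α p (qExp α p) := by
  have h1 : 0 < p - 1 := by linarith
  have hn : 0 < (N : ℝ) - 2 := by have := gam_pos hN; unfold gam at this; linarith
  rw [lt_div_iff₀ hn] at hp2
  rw [sExp_qExp hα0 hp1]
  have h2 : 2 * sigma α p = (2 + α) / (p - 1) := by unfold sigma; field_simp
  have h3 : (N : ℝ) - 2 < (2 + α) / (p - 1) := by
    rw [lt_div_iff₀ h1]
    linarith
  linarith

theorem sExp_twoStar (hN : 3 ≤ N) (hα0 : 0 < α) (hp1 : 1 < p) :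
    gam N * sExp N α p (twoStar N) = (gam N + 1) * sExp N α p (qExp α p) := by
  have hγ := gam_pos hN
  rw [sExp_qExp hα0 hp1, sExp, twoStar_eq hN, ← two_mul_gam_add_two (N := N)]
  field_simp
  ring

theorem cStar_eq (hN : 3 ≤ N) (hα0 : 0 < α) (hp1 : 1 < p)
    (hp2 : p < ((N : ℝ) + α) / ((N : ℝ) - 2)) :
    cStar N α p = sobolevConst N α p ^ (gam N + 1) / (2 * (gam N + 1)) := by
  have hγ := gam_pos hN
  have hq := sExp_qExp_pos hN hα0 hp1 hp2
  have h2 : sExp N α p (twoStar N) = (gam N + 1) / gam N * sExp N α p (qExp α p) := by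
    have := sExp_twoStar hN hα0 hp1
    field_simp
    linarith
  simp only [cStar]
  rw [h2, twoStar_eq hN]
  generalize sExp N α p (qExp α p) = s at *
  have e1 : (gam N + 1) / gam N * s - s = s / gam N := by field_simp; ring
  have e2 : (2 + 2 / gam N) / 2 * (s / ((gam N + 1) / gam N * s)) = 1 := by field_simp
  have e3 : (gam N + 1) / gam N * s / (s / gam N) = gam N + 1 := by field_simp
  rw [e1, e2, e3, Real.one_rpow]
  field_simp

theorem energyI_scale (hp1 : 1 < p) (hα0 : 0 < α) {u : Space N → ℝ} (hu : u ∈ ER N α p)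
    {t : ℝ} (ht : 0 < t) :
    energyI N α p (scale N α p t u) = t ^ sExp N α p (qExp α p) * energyI N α p u := by
  obtain ⟨-, -, ⟨g, hg, -⟩, -⟩ := hu
  have hA : 0 ≤ t ^ sigma α p := by positivity
  rw [energyI, energyI, scale_eq_dilate, hg.dirichlet_dilate ht, coulomb_dilate α p hA ht,
    ENNReal.toReal_mul, ENNReal.toReal_ofReal (by positivity), sExp_qExp hα0 hp1]
  have e1 : (t ^ sigma α p) ^ 2 * t ^ (2 - (N : ℝ)) = t ^ (2 * sigma α p + 2 - N) := by
    rw [← Real.rpow_mul_natCast ht.le, ← Real.rpow_add ht]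
    congr 1
    push_cast
    ring
  have e2 : (t ^ sigma α p) ^ (2 * p) * t ^ (-(α + N)) = t ^ (2 * sigma α p + 2 - N) := by
    rw [← Real.rpow_mul ht.le, ← Real.rpow_add ht, ← two_mul_sigma_mul_sub hp1]
    congr 1
    ring
  rw [e1, e2]
  ring

theorem integral_rpow_scale (u : Space N → ℝ) (l : ℝ) {t : ℝ} (ht : 0 < t) :
    ∫ x, |scale N α p t u x| ^ l = t ^ sExp N α p l * ∫ x, |u x| ^ l := by
  rw [scale_eq_dilate, integral_rpow_dilate (by positivity) ht, ← Real.rpow_mul ht.le,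
    ← Real.rpow_add ht]
  rfl

theorem energyF_scale (u : Space N → ℝ) {t : ℝ} (ht : 0 < t) :
    energyF N r (scale N α p t u) = t ^ sExp N α p r * energyF N r u := by
  rw [energyF, energyF, integral_rpow_scale u r ht]
  ring

theorem energyG_scale (u : Space N → ℝ) {t : ℝ} (ht : 0 < t) :
    energyG N (scale N α p t u) = t ^ sExp N α p (twoStar N) * energyG N u := by
  rw [energyG, energyG, integral_rpow_scale u _ ht]
  ring

theorem hasDerivAt_fibering (a b s i g c F : ℝ) {t : ℝ} (ht : 0 < t) :
    HasDerivAt (fun t : ℝ => (t ^ a * i - t ^ b * g - c) / (t ^ s * F))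
      (t ^ (-s - 1) / F * (c * s - ((s - a) * (t ^ a * i) + (b - s) * (t ^ b * g)))) t := by
  have h1 : HasDerivAt (fun t : ℝ => (t ^ (a - s) * i - t ^ (b - s) * g - c * t ^ (-s)) / F)
      (((a - s) * t ^ (a - s - 1) * i - (b - s) * t ^ (b - s - 1) * g
        - c * (-s * t ^ (-s - 1))) / F) t :=
    ((((Real.hasDerivAt_rpow_const (Or.inl ht.ne')).mul_const i).sub
      ((Real.hasDerivAt_rpow_const (Or.inl ht.ne')).mul_const g)).sub
      ((Real.hasDerivAt_rpow_const (Or.inl ht.ne')).const_mul c)).div_const F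
  have heq : (fun t : ℝ => (t ^ a * i - t ^ b * g - c) / (t ^ s * F))
      =ᶠ[nhds t] fun t : ℝ => (t ^ (a - s) * i - t ^ (b - s) * g - c * t ^ (-s)) / F := by
    filter_upwards [lt_mem_nhds ht] with τ hτ
    have hs := (Real.rpow_pos_of_pos hτ s).ne'
    rw [Real.rpow_sub hτ, Real.rpow_sub hτ, Real.rpow_neg hτ.le, ← div_div]
    congr 1
    field_simp
  refine (h1.congr_of_eventuallyEq heq).congr_deriv ?_
  have e : ∀ y : ℝ, t ^ (y - s - 1) = t ^ (-s - 1) * t ^ y := fun y => by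
    rw [← Real.rpow_add ht]
    congr 1
    ring
  rw [e a, e b]
  ring

/-- The equation of the critical points of the fibering map. -/
theorem hasDerivAt_fiber_iff (hp1 : 1 < p) (hα0 : 0 < α) {u : Space N → ℝ} (hu : u ∈ ER N α p)
    (hF : energyF N r u ≠ 0) (c : ℝ) {t : ℝ} (ht : 0 < t) :
    HasDerivAt (fiber N α p r c u) 0 t ↔
      (sExp N α p r - sExp N α p (qExp α p))
          * (t ^ sExp N α p (qExp α p) * energyI N α p u)
        + (sExp N α p (twoStar N) - sExp N α p r)
          * (t ^ sExp N α p (twoStar N) * energyG N u) = c * sExp N α p r := by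
  have heq : fiber N α p r c u =ᶠ[nhds t] fun t =>
      (t ^ sExp N α p (qExp α p) * energyI N α p u
        - t ^ sExp N α p (twoStar N) * energyG N u - c) / (t ^ sExp N α p r * energyF N r u) := by
    filter_upwards [lt_mem_nhds ht] with τ hτ
    rw [fiber, lam, energyI_scale hp1 hα0 hu hτ, energyF_scale u hτ, energyG_scale u hτ]
  have hd := (hasDerivAt_fibering (sExp N α p (qExp α p)) (sExp N α p (twoStar N))
    (sExp N α p r) (energyI N α p u) (energyG N u) c (energyF N r u) ht).congr_of_eventuallyEq heq
  have hne : t ^ (-sExp N α p r - 1) / energyF N r u ≠ 0 :=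
    div_ne_zero (Real.rpow_pos_of_pos ht _).ne' hF
  constructor
  · intro h
    have h0 := h.unique hd
    rcases mul_eq_zero.1 h0.symm with h1 | h1
    · exact absurd h1 hne
    · linarith
  · intro h
    refine hd.congr_deriv ?_
    rw [h, sub_self, mul_zero]

/-- At a critical point the numerator of `λ_c` is nonnegative, for the level
`c = S^(γ+1)/(2(γ+1)) = S^(N/2)/N`. Here `y` is the energy `I` and `z` is `G`. -/
theorem nonneg_of_critical {γ S X y z c sq s2 sr : ℝ} (hγ : 0 < γ) (hS : 0 < S) (hX : 0 ≤ X)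
    (hy : S * X ^ (γ / (γ + 1)) ≤ 2 * y) (hz : z = X / (2 + 2 / γ))
    (hc : c = S ^ (γ + 1) / (2 * (γ + 1))) (hsq : 0 < sq) (hs2 : γ * s2 = (γ + 1) * sq)
    (hqr : sq ≤ sr) (hr2 : sr < s2) (hcrit : (sr - sq) * y + (s2 - sr) * z = c * sr) :
    0 ≤ y - z - c := by
  have hsr : 0 < sr := hsq.trans_le hqr
  have hg : 0 < γ + 1 := by linarith
  have hy0 : 0 ≤ y := by
    have : 0 ≤ S * X ^ (γ / (γ + 1)) := by positivity
    linarith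
  have hXz : γ * X = 2 * (γ + 1) * z := by rw [hz]; field_simp
  have hkey : sr * (y - z - c) = sq * y - s2 * z := by linear_combination hcrit
  suffices h : s2 * z ≤ sq * y by
    have : 0 ≤ sr * (y - z - c) := by linarith
    exact nonneg_of_mul_nonneg_right this hsr
  by_contra hlt
  rw [not_le] at hlt
  -- Multiplying by `γ` and dividing by `sq` turns the assumption into `2 y < X`.
  have h1 : 2 * y < X := by
    have h2 : γ * (sq * y) < (γ + 1) * sq * z := by
      rw [← hs2]
      nlinarith
    have h3 : γ * y < (γ + 1) * z := by
      by_contra h4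
      rw [not_lt] at h4
      nlinarith
    nlinarith
  have hX0 : 0 < X := by linarith
  have hypos : 0 < 2 * y := lt_of_lt_of_le (by positivity) hy
  -- Sobolev's inequality then bounds `y` from below; with the equation of the critical points this
  -- is incompatible with the value of `c`.
  have h5 : S ^ (γ + 1) < 2 * y := by
    have h6 : S * (2 * y) ^ (γ / (γ + 1)) < (2 * y) ^ (1 / (γ + 1)) * (2 * y) ^ (γ / (γ + 1)) := by
      rw [← Real.rpow_add hypos, show 1 / (γ + 1) + γ / (γ + 1) = 1 by field_simp; ring,
        Real.rpow_one]
      refine lt_of_lt_of_le ?_ hy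
      exact mul_lt_mul_of_pos_left (Real.rpow_lt_rpow hypos.le h1 (by positivity)) hS
    have h7 : S < (2 * y) ^ (1 / (γ + 1)) :=
      lt_of_mul_lt_mul_right h6 (Real.rpow_nonneg hypos.le _)
    have h8 := Real.rpow_lt_rpow hS.le h7 hg
    rwa [← Real.rpow_mul hypos.le, one_div, inv_mul_cancel₀ hg.ne', Real.rpow_one] at h8
  have h9 : c * (γ + 1) < y := by
    have : c * (γ + 1) = S ^ (γ + 1) / 2 := by rw [hc]; field_simp
    rw [this]
    linarith
  have h10 : γ * y < (γ + 1) * z := by nlinarith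
  have h11 : sr * (c * (γ + 1)) < sr * y := mul_lt_mul_of_pos_left h9 hsr
  have h12 : (s2 - sr) * (γ * y) < (s2 - sr) * ((γ + 1) * z) :=
    mul_lt_mul_of_pos_left h10 (by linarith)
  have h13 : (γ + 1) * ((sr - sq) * y) + (s2 - sr) * ((γ + 1) * z) = sr * (c * (γ + 1)) := by
    linear_combination (γ + 1) * hcrit
  have h14 : (γ + 1) * ((sr - sq) * y) + (s2 - sr) * (γ * y) = sr * y := by
    linear_combination y * hs2
  linarith

end Fibering

/-! ### The best constant and the lower bound -/

section LowerBound

variable {N : ℕ} {α p r : ℝ}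

theorem truncBubble_mem_ER (hN : 3 ≤ N) (hα0 : 0 < α) (hαN : α < N) (hp : 0 < p) (J : ℕ) :
    truncBubble N (2 ^ J) ∈ ER N α p := by
  obtain ⟨C, -, hC⟩ := exists_coulomb_truncBubble_le hN hα0 hαN hp
  exact ⟨continuous_truncBubble.aestronglyMeasurable, (hC J).trans_lt ENNReal.ofReal_lt_top,
    ⟨_, hasWeakGradient_truncBubble hN (by positivity), memLp_truncBubbleGrad hN⟩,
    isRadial_truncBubble⟩

theorem bddAbove_sobolev (hN : 3 ≤ N) (hα0 : 0 < α) (hαN : α < N) (hp : 0 < p) :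
    BddAbove {S : ℝ | ∀ u ∈ ER N α p,
      S * ((∫ x, |u x| ^ twoStar N) ^ (1 / twoStar N)) ^ 2 ≤ dirichlet N u} := by
  have hQ := twoStar_gt_two hN
  obtain ⟨c, hc0, hc⟩ := exists_le_integral_truncBubble_rpow hN (q := twoStar N) (by linarith)
  have hX := hc0.trans_le (hc (2 ^ 0) (by norm_num))
  have hY : 0 < ((∫ x, |truncBubble N (2 ^ 0) x| ^ twoStar N) ^ (1 / twoStar N)) ^ 2 := by
    positivity
  refine ⟨_, fun S hS => (le_div_iff₀ hY).2 (hS _ (truncBubble_mem_ER hN hα0 hαN hp 0))⟩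

theorem sharpConst_le_sobolevConst (hN : 3 ≤ N) (hα0 : 0 < α) (hαN : α < N) (hp : 0 < p) :
    sharpConst N ≤ sobolevConst N α p :=
  le_csSup (bddAbove_sobolev hN hα0 hαN hp) fun _ hu => sharpConst_mul_le_dirichlet hN hu

theorem sobolevConst_mul_le (hN : 3 ≤ N) {u : Space N → ℝ} (hu : u ∈ ER N α p) :
    sobolevConst N α p * (∫ x, |u x| ^ twoStar N) ^ (gam N / (gam N + 1)) ≤ dirichlet N u := by
  rw [← two_div_twoStar hN, ← sq_rpow_one_div_twoStar hN (integral_abs_rpow_nonneg u _)]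
  set Y := ((∫ x, |u x| ^ twoStar N) ^ (1 / twoStar N)) ^ 2 with hY
  have hY0 : 0 ≤ Y := sq_nonneg _
  rcases hY0.eq_or_lt with h | h
  · rw [← h, mul_zero]
    exact dirichlet_nonneg N u
  · rw [← le_div_iff₀ h]
    exact csSup_le ⟨_, fun _ hv => sharpConst_mul_le_dirichlet hN hv⟩ fun S hS =>
      (le_div_iff₀ h).2 (hS u hu)

theorem sobolevConst_pos (hN : 3 ≤ N) (hα0 : 0 < α) (hαN : α < N) (hp : 0 < p) :
    0 < sobolevConst N α p :=
  (sharpConst_pos hN).trans_le (sharpConst_le_sobolevConst hN hα0 hαN hp)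

theorem dirichlet_le_two_mul_energyI (hp : 0 < p) (u : Space N → ℝ) :
    dirichlet N u ≤ 2 * energyI N α p u := by
  have h : 0 ≤ 1 / (2 * p) * (coulomb N α p u).toReal :=
    mul_nonneg (by positivity) ENNReal.toReal_nonneg
  unfold energyI
  linarith

theorem sExp_lt_sExp (hα0 : 0 < α) (hp1 : 1 < p) {l m : ℝ} (h : l < m) :
    sExp N α p l < sExp N α p m := by
  have := sigma_pos hα0 hp1
  unfold sExp
  gcongr

theorem sExp_le_sExp (hα0 : 0 < α) (hp1 : 1 < p) {l m : ℝ} (h : l ≤ m) :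
    sExp N α p l ≤ sExp N α p m := by
  have := sigma_pos hα0 hp1
  unfold sExp
  gcongr

/-- `λ_{c^*}` is nonnegative on the scaled Nehari manifold. -/
theorem lam_nonneg_of_mem_scaledNehari (hN : 3 ≤ N) (hα0 : 0 < α) (hαN : α < N) (hp1 : 1 < p)
    (hp2 : p < ((N : ℝ) + α) / ((N : ℝ) - 2)) (hrq : qExp α p ≤ r) (hr2 : r < twoStar N)
    {w : Space N → ℝ} (hw : w ∈ scaledNehari N α p r (cStar N α p)) :
    0 ≤ lam N α p r (cStar N α p) w := by
  obtain ⟨u, hu, t, ht, hd, rfl⟩ := hw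
  have hp : 0 < p := by linarith
  by_cases hF : energyF N r u = 0
  · -- If the integral of `|u|^r` is `0`, be it as a junk value, then `λ` is a division by `0`.
    rw [lam, energyF_scale u ht, hF, mul_zero, div_zero]
  have hwER : scale N α p t u ∈ ER N α p := by
    rw [scale_eq_dilate]
    exact dilate_mem_ER (by positivity) ht hu.1
  rw [hasDerivAt_fiber_iff hp1 hα0 hu.1 hF _ ht, ← energyI_scale hp1 hα0 hu.1 ht,
    ← energyG_scale u ht] at hd
  have hq := sExp_qExp_pos hN hα0 hp1 hp2
  have hrq' := sExp_le_sExp (N := N) hα0 hp1 hrq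
  have h := nonneg_of_critical (gam_pos hN) (sobolevConst_pos hN hα0 hαN hp)
    (integral_abs_rpow_nonneg (scale N α p t u) (twoStar N))
    ((sobolevConst_mul_le hN hwER).trans (dirichlet_le_two_mul_energyI (α := α) hp _))
    (z := energyG N (scale N α p t u))
    (by rw [energyG, ← twoStar_eq hN]; ring) (cStar_eq hN hα0 hp1 hp2) hq
    (sExp_twoStar hN hα0 hp1) hrq' (sExp_lt_sExp hα0 hp1 hr2) hd
  refine div_nonneg h ?_
  have hr : 0 < r := by
    refine lt_of_lt_of_le ?_ hrq
    unfold qExp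
    positivity
  exact mul_nonneg (by positivity) (integral_abs_rpow_nonneg _ _)

end LowerBound

/-! ### Concentrating test functions -/

section UpperBound

/-- The energy `D/2 - X/2^*` is at most its maximum over dilations, by Young's inequality. -/
theorem half_sub_le_quotient {γ D X : ℝ} (hγ : 0 < γ) (hD : 0 ≤ D) (hX : 0 < X) :
    D / 2 - X / (2 + 2 / γ) ≤ D ^ (γ + 1) * X ^ (-γ) / (2 * (γ + 1)) := by
  have hg : 0 < γ + 1 := by linarith
  have h := Real.geom_mean_le_arith_mean2_weighted (w₁ := 1 / (γ + 1)) (w₂ := γ / (γ + 1))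
    (p₁ := D ^ (γ + 1) * X ^ (-γ)) (p₂ := X) (by positivity) (by positivity) (by positivity) hX.le
    (by field_simp; ring)
  rw [Real.mul_rpow (by positivity) (by positivity), ← Real.rpow_mul hD, ← Real.rpow_mul hX.le,
    mul_assoc, ← Real.rpow_add hX, mul_one_div_cancel hg.ne', Real.rpow_one,
    show -γ * (1 / (γ + 1)) + γ / (γ + 1) = 0 by ring, Real.rpow_zero, mul_one] at h
  have e1 : X / (2 + 2 / γ) = (γ / (γ + 1) * X) / 2 := by field_simp
  have e2 : D ^ (γ + 1) * X ^ (-γ) / (2 * (γ + 1))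
      = (1 / (γ + 1) * (D ^ (γ + 1) * X ^ (-γ))) / 2 := by field_simp
  rw [e1, e2]
  linarith

/-- Existence of a critical point of the fibering map, for the equation given by
`hasDerivAt_fiber_iff`. -/
theorem exists_critical {c sq s2 sr i g : ℝ} (hc : 0 < c) (hsq : 0 < sq) (hqr : sq ≤ sr)
    (hr2 : sr < s2) (hi : 0 ≤ i) (hg : 0 < g) :
    ∃ t : ℝ, 0 < t ∧ (sr - sq) * (t ^ sq * i) + (s2 - sr) * (t ^ s2 * g) = c * sr := by
  have hsr : 0 < sr := hsq.trans_le hqr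
  have hs2 : 0 < s2 := hsr.trans hr2
  have hd : 0 < s2 - sr := by linarith
  let H : ℝ → ℝ := fun t => (sr - sq) * (t ^ sq * i) + (s2 - sr) * (t ^ s2 * g)
  have hH : Continuous H :=
    (continuous_const.mul ((Real.continuous_rpow_const hsq.le).mul continuous_const)).add
      (continuous_const.mul ((Real.continuous_rpow_const hs2.le).mul continuous_const))
  have hH0 : H 0 = 0 := by simp [H, Real.zero_rpow hsq.ne', Real.zero_rpow hs2.ne']
  have hK0 : 0 < c * sr / ((s2 - sr) * g) := by positivity
  set T := (c * sr / ((s2 - sr) * g)) ^ (1 / s2) with hT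
  have hT0 : 0 < T := Real.rpow_pos_of_pos hK0 _
  have hTs : T ^ s2 = c * sr / ((s2 - sr) * g) := by
    rw [hT, ← Real.rpow_mul hK0.le, one_div, inv_mul_cancel₀ hs2.ne', Real.rpow_one]
  have hHT : c * sr ≤ H T := by
    have h1 : (s2 - sr) * (T ^ s2 * g) = c * sr := by rw [hTs]; field_simp
    have h2 : 0 ≤ (sr - sq) * (T ^ sq * i) :=
      mul_nonneg (by linarith) (mul_nonneg (Real.rpow_nonneg hT0.le _) hi)
    simp only [H]
    linarith
  obtain ⟨t, ht, htH⟩ := intermediate_value_Icc hT0.le hH.continuousOn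
    (show c * sr ∈ Set.Icc (H 0) (H T) from ⟨by rw [hH0]; positivity, hHT⟩)
  refine ⟨t, lt_of_le_of_ne ht.1 fun h0 => ?_, htH⟩
  rw [← h0, hH0] at htH
  have : 0 < c * sr := by positivity
  linarith

/-- Upper bound for the value of `λ_c` at a critical point in terms of the gap `η` of the Sobolev
quotient and of the Coulomb contribution `κ`. The constant only depends on the upper bound `L`. -/
theorem critical_value_le {γ sq s2 sr D X κ c F F₁ t L η : ℝ} (hγ : 0 < γ) (hD : 0 ≤ D)
    (hX : 0 < X) (hκ : 0 ≤ κ) (hc : 0 < c) (hsq : 0 < sq) (hs2 : γ * s2 = (γ + 1) * sq)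
    (hqr : sq ≤ sr) (hr2 : sr < s2) (ht : 0 < t) (hL0 : 0 < L) (hη : 0 ≤ η) (hF₁ : 0 < F₁)
    (hF : F₁ ≤ F)
    (hcrit : (sr - sq) * (t ^ sq * (D / 2 + κ)) + (s2 - sr) * (t ^ s2 * (X / (2 + 2 / γ)))
      = c * sr)
    (hL : (sr - sq) * (D / 2 + κ) + (s2 - sr) * (X / (2 + 2 / γ)) ≤ L)
    (hgap : D ^ (γ + 1) * X ^ (-γ) / (2 * (γ + 1)) ≤ c + η) :
    (t ^ sq * (D / 2 + κ) - t ^ s2 * (X / (2 + 2 / γ)) - c) / (t ^ sr * F)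
      ≤ min 1 (c * sr / L) ^ (-(sr / sq)) * (η + κ) / F₁ := by
  have hsr : 0 < sr := hsq.trans_le hqr
  -- The number `τ` is a lower bound for `t ^ sq`, uniform in the data apart from `L`.
  set τ := min 1 (c * sr / L) with hτ
  have hτ0 : 0 < τ := lt_min one_pos (by positivity)
  have hτ1 : τ ≤ 1 := min_le_left _ _
  have htq : 0 < t ^ sq := Real.rpow_pos_of_pos ht _
  have htr : 0 < t ^ sr := Real.rpow_pos_of_pos ht _
  have hτt : τ ≤ t ^ sq := by
    rcases le_total 1 t with h1 | h1
    · exact hτ1.trans (Real.one_le_rpow h1 hsq.le)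
    · have h2 : t ^ s2 ≤ t ^ sq := Real.rpow_le_rpow_of_exponent_ge ht h1 (by linarith)
      have h3 : c * sr ≤ t ^ sq * L := by
        have hG : 0 ≤ X / (2 + 2 / γ) := by positivity
        calc c * sr ≤ (sr - sq) * (t ^ sq * (D / 2 + κ))
              + (s2 - sr) * (t ^ sq * (X / (2 + 2 / γ))) := by
              rw [← hcrit]
              have : 0 ≤ s2 - sr := by linarith
              gcongr
          _ = t ^ sq * ((sr - sq) * (D / 2 + κ) + (s2 - sr) * (X / (2 + 2 / γ))) := by ring
          _ ≤ t ^ sq * L := by gcongr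
      exact (min_le_right _ _).trans ((div_le_iff₀ hL0).2 h3)
  have hYoung := half_sub_le_quotient hγ (mul_nonneg htq.le hD)
    (mul_pos (Real.rpow_pos_of_pos ht s2) hX)
  have hinv : (t ^ sq * D) ^ (γ + 1) * (t ^ s2 * X) ^ (-γ) = D ^ (γ + 1) * X ^ (-γ) := by
    rw [Real.mul_rpow htq.le hD, Real.mul_rpow (Real.rpow_nonneg ht.le _) hX.le,
      ← Real.rpow_mul ht.le, ← Real.rpow_mul ht.le,
      show s2 * -γ = -(sq * (γ + 1)) by linear_combination -hs2, Real.rpow_neg ht.le]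
    have := (Real.rpow_pos_of_pos ht (sq * (γ + 1))).ne'
    field_simp
  rw [hinv] at hYoung
  have hnum : t ^ sq * (D / 2 + κ) - t ^ s2 * (X / (2 + 2 / γ)) - c ≤ η + t ^ sq * κ := by
    have e1 : t ^ s2 * (X / (2 + 2 / γ)) = t ^ s2 * X / (2 + 2 / γ) := by ring
    have e2 : t ^ sq * (D / 2 + κ) = t ^ sq * D / 2 + t ^ sq * κ := by ring
    rw [e1, e2]
    linarith
  have hpow : ∀ x : ℝ, (t ^ sq) ^ (x / sq) = t ^ x := fun x => by
    rw [← Real.rpow_mul ht.le]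
    congr 1
    field_simp
  have h1 : (t ^ sr)⁻¹ ≤ τ ^ (-(sr / sq)) := by
    rw [← hpow, ← Real.rpow_neg htq.le]
    exact Real.rpow_le_rpow_of_nonpos hτ0 hτt (by rw [neg_nonpos]; positivity)
  have h2 : t ^ sq * (t ^ sr)⁻¹ ≤ τ ^ (-(sr / sq)) := by
    have e : t ^ sq * (t ^ sr)⁻¹ = (t ^ sq) ^ ((sq - sr) / sq) := by
      rw [hpow, Real.rpow_sub ht, div_eq_mul_inv]
    rw [e]
    calc (t ^ sq) ^ ((sq - sr) / sq) ≤ τ ^ ((sq - sr) / sq) :=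
          Real.rpow_le_rpow_of_nonpos hτ0 hτt (div_nonpos_of_nonpos_of_nonneg (by linarith) hsq.le)
      _ ≤ τ ^ (-(sr / sq)) := by
          refine Real.rpow_le_rpow_of_exponent_ge hτ0 hτ1 ?_
          rw [← neg_div]
          gcongr
          linarith
  have hF0 : 0 < F := hF₁.trans_le hF
  calc (t ^ sq * (D / 2 + κ) - t ^ s2 * (X / (2 + 2 / γ)) - c) / (t ^ sr * F)
      ≤ (η + t ^ sq * κ) / (t ^ sr * F) := by gcongr
    _ = ((t ^ sr)⁻¹ * η + (t ^ sq * (t ^ sr)⁻¹) * κ) / F := by field_simp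
    _ ≤ (τ ^ (-(sr / sq)) * η + τ ^ (-(sr / sq)) * κ) / F := by gcongr
    _ = τ ^ (-(sr / sq)) * (η + κ) / F := by ring
    _ ≤ τ ^ (-(sr / sq)) * (η + κ) / F₁ := by gcongr

variable {N : ℕ} {α p r : ℝ}

/-- The energy of the extremal function on `ℝ^N`. -/
noncomputable def bubbleEnergy (N : ℕ) : ℝ :=
  sphereArea N * (4 * gam N * (gam N + 1) * blissMass (gam N))

theorem bubbleEnergy_quotient (hN : 3 ≤ N) :
    bubbleEnergy N ^ (gam N + 1) * (sphereArea N * blissMass (gam N)) ^ (-gam N)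
      = sharpConst N ^ (gam N + 1) := by
  have hγ := gam_pos hN
  have hω := sphereArea_pos hN
  have hB := blissMass_pos hγ
  have hE : 0 < bubbleEnergy N := by unfold bubbleEnergy; positivity
  have hX : 0 < sphereArea N * blissMass (gam N) := by positivity
  have h1 : sharpConst N = bubbleEnergy N *
      (sphereArea N * blissMass (gam N)) ^ (-(gam N / (gam N + 1))) := by
    rw [Real.rpow_neg hX.le, Real.mul_rpow hω.le hB.le, sharpConst, blissConst, bubbleEnergy]
    field_simp
  rw [h1, Real.mul_rpow hE.le (by positivity), ← Real.rpow_mul hX.le]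
  congr 2
  field_simp

theorem dirichlet_truncBubble_le (hN : 3 ≤ N) {R : ℝ} (hR : 1 ≤ R) :
    dirichlet N (truncBubble N R)
      ≤ bubbleEnergy N + sphereArea N * (4 * gam N ^ 2) * R ^ (-(2 * gam N)) := by
  rw [dirichlet_truncBubble hN (by linarith)]
  refine (mul_le_mul_of_nonneg_left (integral_bubble_energy_le (gam_pos hN) hR)
    (sphereArea_pos hN).le).trans_eq ?_
  unfold bubbleEnergy
  ring

theorem le_integral_truncBubble_twoStar (hN : 3 ≤ N) {R : ℝ} (hR : 1 ≤ R) :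
    sphereArea N * blissMass (gam N)
        - sphereArea N * (3 + 2 / gam N) * R ^ (-(2 * gam N))
      ≤ ∫ x, |truncBubble N R x| ^ twoStar N := by
  have hQ := twoStar_gt_two hN
  rw [integral_truncBubble_rpow hN (by linarith) (by linarith), twoStar_eq hN]
  refine le_trans (le_of_eq ?_) (mul_le_mul_of_nonneg_left
    (le_integral_truncated_bubble (gam_pos hN) hR) (sphereArea_pos hN).le)
  ring

/-- The Sobolev quotient of the truncated extremals is optimal up to an error `O(R^(2-N))`. -/
theorem exists_quotient_truncBubble_le (hN : 3 ≤ N) :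
    ∃ M : ℝ, 0 ≤ M ∧ ∀ᶠ R : ℝ in Filter.atTop,
      dirichlet N (truncBubble N R) ^ (gam N + 1)
          * (∫ x, |truncBubble N R x| ^ twoStar N) ^ (-gam N)
        ≤ sharpConst N ^ (gam N + 1) + M * R ^ (-(2 * gam N)) := by
  have hγ := gam_pos hN
  have hω := sphereArea_pos hN
  have hB := blissMass_pos hγ
  set c₁ := sphereArea N * (4 * gam N ^ 2) with hc₁
  set c₂ := sphereArea N * (3 + 2 / gam N) with hc₂
  set X₀ := sphereArea N * blissMass (gam N) with hX₀
  have hX₀0 : 0 < X₀ := by positivity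
  have hE : 0 < bubbleEnergy N := by unfold bubbleEnergy; positivity
  -- The quotient is bounded by a differentiable function of `δ = R^(2-N)` with the value
  -- `sharpConst ^ (γ+1)` at `0`.
  let h : ℝ → ℝ := fun δ => (bubbleEnergy N + c₁ * δ) ^ (gam N + 1) * (X₀ - c₂ * δ) ^ (-gam N)
  have hdiff : DifferentiableAt ℝ h 0 := by
    refine DifferentiableAt.mul (DifferentiableAt.rpow_const (by fun_prop) (Or.inl ?_))
      (DifferentiableAt.rpow_const (by fun_prop) (Or.inl ?_))
    · simpa using hE.ne'
    · simpa using hX₀0.ne'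
  obtain ⟨M, hM⟩ := hdiff.isBigO_sub.bound
  have hδ : Filter.Tendsto (fun R : ℝ => R ^ (-(2 * gam N))) Filter.atTop (nhds 0) :=
    tendsto_rpow_neg_atTop (by positivity)
  have hpos : ∀ᶠ δ : ℝ in nhds 0, 0 < X₀ - c₂ * δ :=
    (ContinuousAt.tendsto (f := fun δ : ℝ => X₀ - c₂ * δ) (by fun_prop)).eventually_const_lt
      (by simpa using hX₀0)
  refine ⟨|M|, abs_nonneg M, ?_⟩
  filter_upwards [hδ.eventually hM, hδ.eventually hpos, Filter.eventually_ge_atTop 1]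
    with R hR1 hR2 hR3
  have hR0 : 0 < R ^ (-(2 * gam N)) := Real.rpow_pos_of_pos (by linarith) _
  have hh0 : h 0 = sharpConst N ^ (gam N + 1) := by
    simp only [h, mul_zero, add_zero, sub_zero]
    exact bubbleEnergy_quotient hN
  rw [hh0, Real.norm_eq_abs, sub_zero, Real.norm_of_nonneg hR0.le] at hR1
  have h1 := (le_abs_self _).trans hR1
  have h2 : M * R ^ (-(2 * gam N)) ≤ |M| * R ^ (-(2 * gam N)) := by
    gcongr
    exact le_abs_self M
  have h3 : dirichlet N (truncBubble N R) ^ (gam N + 1)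
      * (∫ x, |truncBubble N R x| ^ twoStar N) ^ (-gam N) ≤ h (R ^ (-(2 * gam N))) := by
    refine mul_le_mul (Real.rpow_le_rpow (dirichlet_nonneg N _) (dirichlet_truncBubble_le hN hR3)
      (by positivity)) ?_ (Real.rpow_nonneg (integral_abs_rpow_nonneg _ _) _) (by positivity)
    exact Real.rpow_le_rpow_of_nonpos hR2 (le_integral_truncBubble_twoStar hN hR3) (by linarith)
  linarith

/-- The truncated extremal at radius `2^J`, concentrated at scale `2^(-J)` in a way that preserves
the energy and the critical norm. -/
noncomputable def testFun (N J : ℕ) : Space N → ℝ :=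
  dilate (((2 : ℝ) ^ J) ^ gam N) (2 ^ J) (truncBubble N (2 ^ J))

theorem dirichlet_testFun (hN : 3 ≤ N) (J : ℕ) :
    dirichlet N (testFun N J) = dirichlet N (truncBubble N (2 ^ J)) := by
  have hR : (0 : ℝ) < 2 ^ J := by positivity
  rw [testFun, (hasWeakGradient_truncBubble hN hR).dirichlet_dilate hR,
    ← Real.rpow_mul_natCast hR.le, ← Real.rpow_add hR, ← two_mul_gam_add_two (N := N)]
  push_cast
  rw [show gam N * 2 + (2 - (2 * gam N + 2)) = 0 by ring, Real.rpow_zero, one_mul]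

theorem integral_testFun_rpow (J : ℕ) (l : ℝ) :
    ∫ x, |testFun N J x| ^ l
      = ((2 : ℝ) ^ J) ^ (gam N * l - N) * ∫ x, |truncBubble N (2 ^ J) x| ^ l := by
  have hR : (0 : ℝ) < 2 ^ J := by positivity
  rw [testFun, integral_rpow_dilate (by positivity) hR, ← Real.rpow_mul hR.le, ← Real.rpow_add hR]
  rfl

theorem integral_testFun_twoStar (hN : 3 ≤ N) (J : ℕ) :
    ∫ x, |testFun N J x| ^ twoStar N = ∫ x, |truncBubble N (2 ^ J) x| ^ twoStar N := by
  have hγ := gam_pos hN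
  have h : gam N * twoStar N - N = 0 := by
    rw [twoStar_eq hN, ← two_mul_gam_add_two (N := N)]
    field_simp
    ring
  rw [integral_testFun_rpow, h, Real.rpow_zero, one_mul]

theorem coulomb_testFun (J : ℕ) :
    (coulomb N α p (testFun N J)).toReal = ((2 : ℝ) ^ J) ^ (2 * gam N * p - α - N)
      * (coulomb N α p (truncBubble N (2 ^ J))).toReal := by
  have hR : (0 : ℝ) < 2 ^ J := by positivity
  rw [testFun, coulomb_dilate α p (by positivity) hR, ENNReal.toReal_mul,
    ENNReal.toReal_ofReal (by positivity), ← Real.rpow_mul hR.le, ← Real.rpow_add hR]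
  congr 2
  ring

theorem testFun_mem_ERNonzero (hN : 3 ≤ N) (hα0 : 0 < α) (hαN : α < N) (hp : 0 < p) (J : ℕ) :
    testFun N J ∈ ERNonzero N α p := by
  refine dilate_mem_ERNonzero (by positivity) (by positivity)
    ⟨truncBubble_mem_ER hN hα0 hαN hp J, fun h => ?_⟩
  obtain ⟨c, hc0, hc⟩ := exists_le_integral_truncBubble_rpow hN zero_lt_one
  have h1 := hc (2 ^ J) (one_le_pow₀ one_le_two)
  have h2 : ∫ x, |truncBubble N (2 ^ J) x| ^ (1 : ℝ) = 0 := by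
    rw [← integral_zero (Space N) ℝ]
    refine integral_congr_ae ?_
    filter_upwards [h] with x hx
    simp [hx]
  linarith

theorem tendsto_pow_rpow_zero {e : ℝ} (he : e < 0) :
    Filter.Tendsto (fun J : ℕ => ((2 : ℝ) ^ J) ^ e) Filter.atTop (nhds 0) := by
  have h : ∀ J : ℕ, ((2 : ℝ) ^ J) ^ e = ((2 : ℝ) ^ e) ^ J := fun J => by
    rw [← Real.rpow_natCast, ← Real.rpow_mul (by norm_num), mul_comm,
      Real.rpow_mul (by norm_num), Real.rpow_natCast]
  simp_rw [h]
  exact tendsto_pow_atTop_nhds_zero_of_lt_one (by positivity)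
    (Real.rpow_lt_one_of_one_lt_of_neg one_lt_two he)

theorem tendsto_sq_mul_pow_rpow_zero {e : ℝ} (he : e < 0) :
    Filter.Tendsto (fun J : ℕ => ((J : ℝ) + 1) ^ 2 * ((2 : ℝ) ^ J) ^ e) Filter.atTop (nhds 0) := by
  have hρ0 : (0 : ℝ) < 2 ^ e := by positivity
  have hρ1 : (2 : ℝ) ^ e < 1 := Real.rpow_lt_one_of_one_lt_of_neg one_lt_two he
  have h1 := (tendsto_pow_const_mul_const_pow_of_abs_lt_one 2
    (by rwa [abs_of_pos hρ0] : |(2 : ℝ) ^ e| < 1)).comp (Filter.tendsto_add_atTop_nat 1)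
  have h2 := h1.const_mul ((2 : ℝ) ^ e)⁻¹
  rw [mul_zero] at h2
  refine h2.congr fun J => ?_
  have h3 : ((2 : ℝ) ^ J) ^ e = ((2 : ℝ) ^ e) ^ J := by
    rw [← Real.rpow_natCast, ← Real.rpow_mul (by norm_num), mul_comm,
      Real.rpow_mul (by norm_num), Real.rpow_natCast]
  rw [h3]
  simp only [Function.comp_apply]
  push_cast
  field_simp
  ring

/-- The concentrating test functions provide points of the scaled Nehari manifold on which
`λ_{c^*}` is arbitrarily small. -/
theorem exists_tendsto_lam_le (hN : 3 ≤ N) (hα0 : 0 < α) (hαN : α < N) (hp1 : 1 < p)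
    (hp2 : p < ((N : ℝ) + α) / ((N : ℝ) - 2)) (hrq : qExp α p ≤ r) (hr2 : r < twoStar N)
    (h1 : 2 < gam N * r)
    (h2 : 2 * gam N * p - α - gam N * r + max ((N : ℝ) + α - 2 * ((N : ℝ) - 2) * p) 0 < 0) :
    ∃ e : ℕ → ℝ, Filter.Tendsto e Filter.atTop (nhds 0) ∧ ∀ᶠ J in Filter.atTop,
      ∃ w ∈ scaledNehari N α p r (cStar N α p), lam N α p r (cStar N α p) w ≤ e J := by
  have hp : 0 < p := by linarith
  have hγ := gam_pos hN
  have hQ := twoStar_gt_two hN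
  have hQγ : gam N * r < N := by
    have : gam N * r < gam N * twoStar N := mul_lt_mul_of_pos_left hr2 hγ
    refine this.trans_eq ?_
    rw [twoStar_eq hN, ← two_mul_gam_add_two (N := N)]
    field_simp
  have hr : 0 < r := by
    by_contra h
    nlinarith
  have hq := sExp_qExp_pos hN hα0 hp1 hp2
  have hqr := sExp_le_sExp (N := N) hα0 hp1 hrq
  have hr2' := sExp_lt_sExp (N := N) hα0 hp1 hr2
  have hs2 := sExp_twoStar hN hα0 hp1
  have hS := sobolevConst_pos hN hα0 hαN hp
  have hcS := cStar_eq hN hα0 hp1 hp2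
  set c := cStar N α p with hc
  have hc0 : 0 < c := by rw [hcS]; positivity
  set sq := sExp N α p (qExp α p) with hsq
  set s2 := sExp N α p (twoStar N) with hs2def
  set sr := sExp N α p r with hsr
  set m := max ((N : ℝ) + α - 2 * ((N : ℝ) - 2) * p) 0 with hm
  obtain ⟨C, hC0, hC⟩ := exists_coulomb_truncBubble_le hN hα0 hαN hp
  obtain ⟨M, hM0, hM⟩ := exists_quotient_truncBubble_le hN
  obtain ⟨Y, hY0, hY⟩ := exists_le_integral_truncBubble_rpow hN hr
  obtain ⟨Y₂, hY₂0, hY₂⟩ := exists_le_integral_truncBubble_rpow hN (q := twoStar N) (by linarith)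
  -- Uniform bounds for the energy and the mass of the test functions, and for the left-hand side
  -- of the equation of the critical points at `t = 1`.
  set D₁ := bubbleEnergy N + sphereArea N * (4 * gam N ^ 2) with hD₁
  have hω := sphereArea_pos hN
  have hD₁0 : 0 ≤ D₁ := by
    have := blissMass_pos hγ
    rw [hD₁, bubbleEnergy]
    positivity
  set X₁ := (D₁ / sobolevConst N α p) ^ ((gam N + 1) / gam N) with hX₁
  have hX₁0 : 0 ≤ X₁ := by positivity
  set L := (sr - sq) * (D₁ / 2 + 1) + (s2 - sr) * (X₁ / (2 + 2 / gam N)) + 1 with hL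
  have hd1 : 0 ≤ sr - sq := by linarith
  have hd2 : 0 ≤ s2 - sr := by linarith
  have hL0 : 0 < L := by rw [hL]; positivity
  set Λ := min 1 (c * sr / L) ^ (-(sr / sq)) with hΛ
  let κ : ℕ → ℝ := fun J => 1 / (2 * p) * (coulomb N α p (testFun N J)).toReal
  let η : ℕ → ℝ := fun J => M * ((2 : ℝ) ^ J) ^ (-(2 * gam N)) / (2 * (gam N + 1))
  let F₁ : ℕ → ℝ := fun J => 1 / r * (((2 : ℝ) ^ J) ^ (gam N * r - N) * Y)
  have hF₁0 : ∀ J, 0 < F₁ J := fun J => by positivity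
  have hκ0 : ∀ J, 0 ≤ κ J := fun J => mul_nonneg (by positivity) ENNReal.toReal_nonneg
  have hκle : ∀ J : ℕ, κ J ≤ 1 / (2 * p) * C *
      (((J : ℝ) + 1) ^ 2 * ((2 : ℝ) ^ J) ^ (2 * gam N * p - α - N + m)) := by
    intro J
    have hR : (0 : ℝ) < 2 ^ J := by positivity
    have h3 := ENNReal.toReal_mono ENNReal.ofReal_ne_top (hC J)
    rw [ENNReal.toReal_ofReal (by positivity)] at h3
    simp only [κ]
    rw [coulomb_testFun, Real.rpow_add hR]
    calc 1 / (2 * p) * (((2 : ℝ) ^ J) ^ (2 * gam N * p - α - N)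
          * (coulomb N α p (truncBubble N (2 ^ J))).toReal)
        ≤ 1 / (2 * p) * (((2 : ℝ) ^ J) ^ (2 * gam N * p - α - N)
          * (C * ((J : ℝ) + 1) ^ 2 * ((2 : ℝ) ^ J) ^ m)) := by gcongr
      _ = _ := by ring
  have hκ1 : ∀ᶠ J in Filter.atTop, κ J ≤ 1 := by
    have h3 := (tendsto_sq_mul_pow_rpow_zero
      (show 2 * gam N * p - α - N + m < 0 by linarith)).const_mul (1 / (2 * p) * C)
    rw [mul_zero] at h3
    filter_upwards [h3.eventually_lt_const one_pos] with J hJ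
    exact (hκle J).trans hJ.le
  have hpow : Filter.Tendsto (fun J : ℕ => (2 : ℝ) ^ J) Filter.atTop Filter.atTop :=
    tendsto_pow_atTop_atTop_of_one_lt one_lt_two
  refine ⟨fun J => Λ * r / Y * (M / (2 * (gam N + 1)) * ((2 : ℝ) ^ J) ^ (2 - gam N * r)
      + 1 / (2 * p) * C * (((J : ℝ) + 1) ^ 2 *
        ((2 : ℝ) ^ J) ^ (2 * gam N * p - α - gam N * r + m))), ?_, ?_⟩
  · have h3 := (tendsto_pow_rpow_zero (show 2 - gam N * r < 0 by linarith)).const_mul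
      (M / (2 * (gam N + 1)))
    have h4 := (tendsto_sq_mul_pow_rpow_zero h2).const_mul (1 / (2 * p) * C)
    have h5 := (h3.add h4).const_mul (Λ * r / Y)
    rwa [mul_zero, mul_zero, add_zero, mul_zero] at h5
  · filter_upwards [hκ1, hpow.eventually hM] with J hJκ hJM
    have hR : (0 : ℝ) < 2 ^ J := by positivity
    have hR1 : (1 : ℝ) ≤ 2 ^ J := one_le_pow₀ one_le_two
    have hmem := testFun_mem_ERNonzero hN hα0 hαN hp J
    have hDw := dirichlet_testFun hN J
    have hXw := integral_testFun_twoStar hN J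
    have hD0 := dirichlet_nonneg N (testFun N J)
    have hX0 : 0 < ∫ x, |testFun N J x| ^ twoStar N := by
      rw [hXw]
      exact hY₂0.trans_le (hY₂ _ hR1)
    have hI : energyI N α p (testFun N J) = dirichlet N (testFun N J) / 2 + κ J := by
      rw [energyI]; ring
    have hG : energyG N (testFun N J)
        = (∫ x, |testFun N J x| ^ twoStar N) / (2 + 2 / gam N) := by
      rw [energyG, ← twoStar_eq hN]; ring
    have hFge : F₁ J ≤ energyF N r (testFun N J) := by
      simp only [F₁]
      rw [energyF, integral_testFun_rpow]
      gcongr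
      exact hY _ hR1
    have hDle : dirichlet N (testFun N J) ≤ D₁ := by
      rw [hDw]
      refine (dirichlet_truncBubble_le hN hR1).trans ?_
      have : ((2 : ℝ) ^ J) ^ (-(2 * gam N)) ≤ 1 :=
        Real.rpow_le_one_of_one_le_of_nonpos hR1 (by linarith)
      have h3 : sphereArea N * (4 * gam N ^ 2) * ((2 : ℝ) ^ J) ^ (-(2 * gam N))
          ≤ sphereArea N * (4 * gam N ^ 2) * 1 := by gcongr
      rw [hD₁]
      linarith
    have hXle : ∫ x, |testFun N J x| ^ twoStar N ≤ X₁ := by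
      have h3 := (sobolevConst_mul_le hN hmem.1).trans hDle
      rw [mul_comm, ← le_div_iff₀ hS] at h3
      have h4 := Real.rpow_le_rpow (by positivity) h3
        (show 0 ≤ (gam N + 1) / gam N by positivity)
      rwa [← Real.rpow_mul hX0.le,
        show gam N / (gam N + 1) * ((gam N + 1) / gam N) = 1 by field_simp, Real.rpow_one] at h4
    obtain ⟨t, ht, hcrit⟩ := exists_critical hc0 hq hqr hr2'
      (i := energyI N α p (testFun N J)) (g := energyG N (testFun N J))
      (by rw [hI]; have := hκ0 J; positivity) (by rw [hG]; positivity)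
    have hgap : dirichlet N (testFun N J) ^ (gam N + 1)
        * (∫ x, |testFun N J x| ^ twoStar N) ^ (-gam N) / (2 * (gam N + 1)) ≤ c + η J := by
      rw [hDw, hXw, hcS]
      simp only [η]
      rw [← add_div]
      gcongr
      refine hJM.trans ?_
      gcongr
      · exact (sharpConst_pos hN).le
      · exact sharpConst_le_sobolevConst hN hα0 hαN hp
    have hFne : energyF N r (testFun N J) ≠ 0 := ((hF₁0 J).trans_le hFge).ne'
    refine ⟨scale N α p t (testFun N J), ⟨testFun N J, hmem, t, ht,
      (hasDerivAt_fiber_iff hp1 hα0 hmem.1 hFne c ht).2 hcrit, rfl⟩, ?_⟩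
    rw [lam, energyI_scale hp1 hα0 hmem.1 ht, energyG_scale _ ht, energyF_scale _ ht]
    rw [hI, hG] at hcrit ⊢
    have hLle : (sr - sq) * (dirichlet N (testFun N J) / 2 + κ J)
        + (s2 - sr) * ((∫ x, |testFun N J x| ^ twoStar N) / (2 + 2 / gam N)) ≤ L := by
      have h3 : (sr - sq) * (dirichlet N (testFun N J) / 2 + κ J)
        + (s2 - sr) * ((∫ x, |testFun N J x| ^ twoStar N) / (2 + 2 / gam N))
        ≤ (sr - sq) * (D₁ / 2 + 1) + (s2 - sr) * (X₁ / (2 + 2 / gam N)) := by gcongr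
      rw [hL]
      linarith
    refine (critical_value_le hγ hD0 hX0 (hκ0 J) hc0 hq hs2 hqr hr2' ht hL0
      (show 0 ≤ η J by positivity) (hF₁0 J) hFge hcrit hLle hgap).trans ?_
    have hτ0 : 0 < min 1 (c * sr / L) := lt_min one_pos
      (div_pos (mul_pos hc0 (hq.trans_le hqr)) hL0)
    have hΛ0 : 0 ≤ Λ := (Real.rpow_pos_of_pos hτ0 _).le
    have e0 : ((2 : ℝ) ^ J) ^ (gam N * r - N) ≠ 0 := (Real.rpow_pos_of_pos hR _).ne'
    have e1 : Λ * (η J + κ J) / F₁ J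
        = Λ * r / Y * ((η J + κ J) * (((2 : ℝ) ^ J) ^ (gam N * r - N))⁻¹) := by
      simp only [F₁]
      field_simp
    have e2 : (((2 : ℝ) ^ J) ^ (gam N * r - N))⁻¹ = ((2 : ℝ) ^ J) ^ (N - gam N * r) := by
      rw [← Real.rpow_neg hR.le]; congr 1; ring
    rw [e1, e2]
    have h3 : (η J + κ J) * ((2 : ℝ) ^ J) ^ (N - gam N * r)
        ≤ M / (2 * (gam N + 1)) * ((2 : ℝ) ^ J) ^ (2 - gam N * r)
          + 1 / (2 * p) * C * (((J : ℝ) + 1) ^ 2 *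
            ((2 : ℝ) ^ J) ^ (2 * gam N * p - α - gam N * r + m)) := by
      have e3 : ((2 : ℝ) ^ J) ^ (2 - gam N * r)
          = ((2 : ℝ) ^ J) ^ (-(2 * gam N)) * ((2 : ℝ) ^ J) ^ (N - gam N * r) := by
        rw [← Real.rpow_add hR, ← two_mul_gam_add_two (N := N)]; congr 1; ring
      have e4 : ((2 : ℝ) ^ J) ^ (2 * gam N * p - α - gam N * r + m)
          = ((2 : ℝ) ^ J) ^ (2 * gam N * p - α - N + m) * ((2 : ℝ) ^ J) ^ (N - gam N * r) := by
        rw [← Real.rpow_add hR]; congr 1; ring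
      rw [add_mul, e3, e4]
      refine add_le_add (le_of_eq ?_) ?_
      · simp only [η]; ring
      · refine (mul_le_mul_of_nonneg_right (hκle J) (by positivity)).trans_eq ?_
        ring
    have hY' : 0 ≤ Λ * r / Y := by positivity
    exact mul_le_mul_of_nonneg_left h3 hY'

end UpperBound

/-! ### Parameter ranges -/

section Parameters

variable {N : ℕ} {α p r : ℝ}

/-- In each of the five cases `(N-2) r > 4`, that is, the Sobolev gap `O(R^(2-N))` of the test
functions is negligible with respect to their `L^r` norm. -/
theorem four_lt_of_cases
    (hcases :
      (2 * (N : ℝ) * p / ((N : ℝ) + α) > (N : ℝ) / ((N : ℝ) - 2) ∧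
        (N : ℝ) + α - ((N : ℝ) - 2) * (p + 1) ≥ 0 ∧ ((N : ℝ) - 2) * r - 4 > 0) ∨
      (2 * (N : ℝ) * p / ((N : ℝ) + α) > (N : ℝ) / ((N : ℝ) - 2) ∧
        (N : ℝ) + α - ((N : ℝ) - 2) * (p + 1) < 0 ∧
        2 * α + ((N : ℝ) - 2) * (r - 2 * p) > 0) ∨
      (2 * (N : ℝ) * p / ((N : ℝ) + α) = (N : ℝ) / ((N : ℝ) - 2) ∧
        4 + α - (N : ℝ) > 0 ∧ ((N : ℝ) - 2) * r - 4 > 0) ∨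
      (2 * (N : ℝ) * p / ((N : ℝ) + α) = (N : ℝ) / ((N : ℝ) - 2) ∧
        4 + α - (N : ℝ) ≤ 0 ∧ α - (N : ℝ) + ((N : ℝ) - 2) * r > 0) ∨
      (2 * (N : ℝ) * p / ((N : ℝ) + α) < (N : ℝ) / ((N : ℝ) - 2) ∧
        ((N : ℝ) - 2) * r - 4 > 0)) :
    2 < gam N * r := by
  have h : 4 < ((N : ℝ) - 2) * r := by
    rcases hcases with h | h | h | h | h
    · linarith [h.2.2]
    · nlinarith [h.2.1, h.2.2]
    · linarith [h.2.2]
    · linarith [h.2.1, h.2.2]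
    · linarith [h.2]
  unfold gam
  linarith

/-- The Coulomb energy of the test functions is negligible with respect to their `L^r` norm. -/
theorem coulomb_exponent_neg (hN : 3 ≤ N) (hα0 : 0 < α) (hp1 : 1 < p)
    (hp2 : p < ((N : ℝ) + α) / ((N : ℝ) - 2)) (hrq : qExp α p ≤ r) (h1 : 2 < gam N * r) :
    2 * gam N * p - α - gam N * r + max ((N : ℝ) + α - 2 * ((N : ℝ) - 2) * p) 0 < 0 := by
  have hγ := gam_pos hN
  have hn : 0 < (N : ℝ) - 2 := by unfold gam at hγ; linarith
  rw [lt_div_iff₀ hn] at hp2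
  have hN2 : (N : ℝ) = 2 * gam N + 2 := two_mul_gam_add_two.symm
  rcases le_total ((N : ℝ) + α - 2 * ((N : ℝ) - 2) * p) 0 with h | h
  · rw [max_eq_right h]
    have h2 : gam N * qExp α p ≤ gam N * r := mul_le_mul_of_nonneg_left hrq hγ.le
    have h3 : 2 * gam N * p - α - gam N * qExp α p
        = -(α / (2 + α)) * (2 + α - 2 * gam N * (p - 1)) := by
      unfold qExp
      field_simp
      ring
    have h4 : 0 < 2 + α - 2 * gam N * (p - 1) := by
      rw [hN2] at hp2
      linarith
    have h5 : 0 < α / (2 + α) * (2 + α - 2 * gam N * (p - 1)) := by positivity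
    linarith
  · rw [max_eq_left h, hN2]
    nlinarith

end Parameters

end SPS

theorem proposition2p12 (N : ℕ) (α p r : ℝ) (hN : 3 ≤ N)
    (hα0 : 0 < α) (hαN : α < (N : ℝ))
    (hp1 : 1 < p) (hp2 : p < ((N : ℝ) + α) / ((N : ℝ) - 2))
    (hrq : SPS.qExp α p ≤ r) (hr2 : r < SPS.twoStar N)
    (hrα : r = SPS.qExp α p → 1 < α)
    (hcases :
      (2 * (N : ℝ) * p / ((N : ℝ) + α) > (N : ℝ) / ((N : ℝ) - 2) ∧
        (N : ℝ) + α - ((N : ℝ) - 2) * (p + 1) ≥ 0 ∧ ((N : ℝ) - 2) * r - 4 > 0) ∨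
      (2 * (N : ℝ) * p / ((N : ℝ) + α) > (N : ℝ) / ((N : ℝ) - 2) ∧
        (N : ℝ) + α - ((N : ℝ) - 2) * (p + 1) < 0 ∧
        2 * α + ((N : ℝ) - 2) * (r - 2 * p) > 0) ∨
      (2 * (N : ℝ) * p / ((N : ℝ) + α) = (N : ℝ) / ((N : ℝ) - 2) ∧
        4 + α - (N : ℝ) > 0 ∧ ((N : ℝ) - 2) * r - 4 > 0) ∨
      (2 * (N : ℝ) * p / ((N : ℝ) + α) = (N : ℝ) / ((N : ℝ) - 2) ∧
        4 + α - (N : ℝ) ≤ 0 ∧ α - (N : ℝ) + ((N : ℝ) - 2) * r > 0) ∨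
      (2 * (N : ℝ) * p / ((N : ℝ) + α) < (N : ℝ) / ((N : ℝ) - 2) ∧
        ((N : ℝ) - 2) * r - 4 > 0)) :
    IsGLB (Set.range (SPS.Lam N α p r (SPS.cStar N α p))) 0 := by
  have h1 := SPS.four_lt_of_cases hcases
  have h2 := SPS.coulomb_exponent_neg hN hα0 hp1 hp2 hrq h1
  refine ⟨?_, fun b hb => ?_⟩
  · rintro _ ⟨⟨w, hw⟩, rfl⟩
    exact SPS.lam_nonneg_of_mem_scaledNehari hN hα0 hαN hp1 hp2 hrq hr2 hw
  · obtain ⟨e, he, hJ⟩ := SPS.exists_tendsto_lam_le hN hα0 hαN hp1 hp2 hrq hr2 h1 h2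
    refine ge_of_tendsto he ?_
    filter_upwards [hJ] with J hJ
    obtain ⟨w, hw, hle⟩ := hJ
    exact (hb ⟨⟨w, hw⟩, rfl⟩).trans hle
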